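/- **Middle sphere.** Let $R$ be a smooth positive function on an interval $(d_-,d_+)$, and let $d_-<s_-<0<s_+<d_+$, $b>0$, $r_0>0$, $R_0>0$ be such that $s_-\le -b$, $b\le s_+$, and: $R(s)=r_0\cos(s/r_0)$ for $|s|<b$ (near the equator $s=0$ the surface is a round sphere of radius $r_0$); $R(s_\pm)=R_0$, $R'(s_\pm)=0$, $R''(s_\pm)>0$ (two necks of equal radius $R_0$, negatively curved at the waists); and $R>R_0$ on $(s_-,s_+)$. Let $g_0=ds^2+R(s)^2\,d\theta^2$ on $(d_-,d_+)\times(\mathbf R/2\pi\mathbf Z)$. A *(positive) limiting geodesic* is a unit speed geodesic of $g_0$ that crosses the equator at the angle $\alpha_0=\arcsin(R_0/r_0)$ with the meridian (with $s$ and $\theta$ increasing) and spirals toward the upper neck $s=s_+$ as $t\to\infty$ and toward the lower neck $s=s_-$ as $t\to-\infty$ (that is, $s\to s_\pm$ and $\theta\to\pm\infty$ as $t\to\pm\infty$). **Bumps.** Let $f:\mathbf R\to\mathbf R$ be smooth, even, nonincreasing on $[0,\infty)$, with $f(0)>0$ and $f(x)=0$ for $x\ge 1/2$. Let $P_1,P_2,\dots$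 be infinitely many points of the equator and $\rho_i>0$ radii with $\rho_i/2\le b$, such that no positive limiting geodesic meets two of the open disks $B_{\rho_i/2}(P_i)$. Let $u=1+\sum_i e^{-1/\rho_i} f(\mathrm{dist}_{g_0}(\cdot,P_i)/\rho_i)\,\mathbf 1_{B_{\rho_i/2}(P_i)}$. **Statement.** Let $M^2$ be any smooth Hausdorff surface without boundary, with a smooth Riemannian metric $g$, that contains an isometric copy of $\big((d_-,d_+)\times(\mathbf R/2\pi\mathbf Z),\ u\,g_0\big)$ as an open subset; the rest of $M^2$ is arbitrary. For each $i$ there is a positive limiting geodesic $\zeta_i$ of $g_0$ through the bump center $P_i$, and $M^2$ has a geodesic lamination $\mathcal L$ such that 1. the union of the leaves of $\mathcal L$ is the closure in $M^2$ of $\bigcup_i\zeta_i$; 2. each curve $\zeta_i$ is (up to parameterization) a leaf of $\mathcal L$, and is a noncompact geodesic of $g$ that is unstable; 3. in particular, $\mathcal L$ has infinitely many (distinct) unstable leaves. Here a *geodesic lamination* is a collection of pairwise disjoint complete simple geodesics of $g$ (the leaves) whose union is closed, such that every $x\in M$ has an open neighborhood $U$ with a homeomorphism $\Phi:U\to(-1,1)^2$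 for which the image of $\ell\cap U$ is a union of slices $(-1,1)\times\{t\}$ for every leaf $\ell$. A noncompact geodesic is *unstable* if its index is positive; the index is the largest dimension of a vector space of smooth compactly supported normal variations $\varphi\,\mathbf n$ on which the second derivative of length $\int\big(\varphi'^2-K\varphi^2\big)\,dt$ is negative definite, where $K$ is the Gaussian curvature of $g$ along the geodesic and $t$ is arclength. -/

import Mathlib

open Set Filter
open scoped Manifold ContDiff Topology

noncomputable section

/-! ### Metrics, geodesics and curvature in local coordinates -/

/-- The coordinate plane. -/
abbrev Plane : Type := EuclideanSpace ℝ (Fin 2)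

/-- The partial derivative of `F` in the `k`-th coordinate direction. -/
def partialD (k : Fin 2) (F : Plane → ℝ) (q : Plane) : ℝ :=
  fderiv ℝ F q (EuclideanSpace.single k 1)

/-- The Christoffel symbols `Γᵏᵢⱼ` of the metric with coefficient matrix `G`. -/
def christoffel (G : Plane → Matrix (Fin 2) (Fin 2) ℝ) (k i j : Fin 2) (q : Plane) : ℝ :=
  (1 / 2) * ∑ l, (G q)⁻¹ k l *
    (partialD i (fun x => G x j l) q + partialD j (fun x => G x i l) q
      - partialD l (fun x => G x i j) q)

/-- The plane curve `c` is smooth near `t` and satisfies at `t` the geodesic equation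
`cᵏ'' + Γᵏᵢⱼ cⁱ' cʲ' = 0` of the metric with coefficients `G`. -/
def GeodesicEqAt (G : Plane → Matrix (Fin 2) (Fin 2) ℝ) (c : ℝ → Plane) (t : ℝ) : Prop :=
  ContDiffAt ℝ ∞ c t ∧
    ∀ k, deriv (deriv (fun τ => c τ k)) t +
      ∑ i, ∑ j, christoffel G k i j (c t) *
        deriv (fun τ => c τ i) t * deriv (fun τ => c τ j) t = 0

/-- The components of the curvature tensor: `R(∂ᵢ, ∂ⱼ) ∂ₖ = ∑ₗ (riemannCoeff G l i j k) ∂ₗ`, where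
`R(X, Y) Z = ∇_X ∇_Y Z - ∇_Y ∇_X Z - ∇_[X, Y] Z`. -/
def riemannCoeff (G : Plane → Matrix (Fin 2) (Fin 2) ℝ) (l i j k : Fin 2) (q : Plane) : ℝ :=
  partialD i (christoffel G l j k) q - partialD j (christoffel G l i k) q
    + ∑ m, (christoffel G l i m q * christoffel G m j k q
      - christoffel G l j m q * christoffel G m i k q)

/-- The Gaussian curvature `⟨R(∂₀, ∂₁) ∂₁, ∂₀⟩ / det G` of the metric with coefficients `G`. -/
def coordGaussCurvature (G : Plane → Matrix (Fin 2) (Fin 2) ℝ) (q : Plane) : ℝ :=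
  (∑ l, riemannCoeff G l 0 1 1 q * G q l 0) / (G q).det

section Surface

variable {M : Type*} [TopologicalSpace M] [ChartedSpace Plane M] [IsManifold (𝓡 2) ∞ M]

/-- A smooth Riemannian metric on the surface `M`. -/
abbrev SurfaceMetric (M : Type*) [TopologicalSpace M] [ChartedSpace Plane M]
    [IsManifold (𝓡 2) ∞ M] :=
  Bundle.ContMDiffRiemannianMetric (𝓡 2) ∞ Plane (fun p : M => TangentSpace (𝓡 2) p)

/-- The coefficients of the metric `g` in the chart `e`, as functions on the coordinate plane. -/
def chartMetric (g : SurfaceMetric M) (e : OpenPartialHomeomorph M Plane) (q : Plane) :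
    Matrix (Fin 2) (Fin 2) ℝ :=
  Matrix.of fun i j => g.inner (e.symm q)
    (mfderiv 𝓘(ℝ, Plane) (𝓡 2) e.symm q (EuclideanSpace.single i (1 : ℝ) : Plane))
    (mfderiv 𝓘(ℝ, Plane) (𝓡 2) e.symm q (EuclideanSpace.single j (1 : ℝ) : Plane))

/-- The velocity of a curve in `M`. -/
def velocity (γ : ℝ → M) (t : ℝ) : TangentSpace (𝓡 2) (γ t) :=
  mfderiv 𝓘(ℝ, ℝ) (𝓡 2) γ t (1 : ℝ)

/-- A complete geodesic of `g` parameterized by arclength.  The geodesic equation at a point does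
not depend on the smooth chart in which it is written, so that one chart suffices. -/
def IsUnitGeodesic (g : SurfaceMetric M) (γ : ℝ → M) : Prop :=
  ContMDiff 𝓘(ℝ, ℝ) (𝓡 2) ∞ γ ∧
    (∀ t, g.inner (γ t) (velocity γ t) (velocity γ t) = 1) ∧
    ∀ t, ∃ e ∈ IsManifold.maximalAtlas (𝓡 2) ∞ M,
      γ t ∈ e.source ∧ GeodesicEqAt (chartMetric g e) (fun τ => e (γ τ)) t

/-- `κ` is the Gaussian curvature of `g` at `p`.  It does not depend on the smooth chart around `p`
in which it is computed (Theorema Egregium). -/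
def HasGaussCurvature (g : SurfaceMetric M) (p : M) (κ : ℝ) : Prop :=
  ∃ e ∈ IsManifold.maximalAtlas (𝓡 2) ∞ M,
    p ∈ e.source ∧ coordGaussCurvature (chartMetric g e) (e p) = κ

/-! ### Laminations -/

/-- The curve `γ` has no self-intersections: it is injective, or it is closed and injective up to
its period. -/
def IsSimpleCurve (γ : ℝ → M) : Prop :=
  Function.Injective γ ∨
    ∃ T : ℝ, 0 < T ∧ ∀ t t' : ℝ, γ t = γ t' ↔ ∃ k : ℤ, t' = t + k * T

/-- A lamination of the surface `M`: a collection of disjoint smooth curves with closed union which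
are locally, in `C⁰` charts onto a square, unions of horizontal slices. -/
structure IsLamination (L : Set (Set M)) : Prop where
  smooth : ∀ ℓ ∈ L, ∃ γ : ℝ → M, ContMDiff 𝓘(ℝ, ℝ) (𝓡 2) ∞ γ ∧
    (∀ t, velocity γ t ≠ 0) ∧ IsSimpleCurve γ ∧ range γ = ℓ
  disjoint : L.PairwiseDisjoint id
  closed : IsClosed (⋃₀ L)
  chart : ∀ x : M, ∃ Φ : OpenPartialHomeomorph M (ℝ × ℝ), x ∈ Φ.source ∧
    Φ.target = Ioo (-1) 1 ×ˢ Ioo (-1) 1 ∧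
    ∀ ℓ ∈ L, ∃ T : Set ℝ, Φ '' (ℓ ∩ Φ.source) = (univ ×ˢ T) ∩ Φ.target

/-- A geodesic lamination: a lamination whose leaves are (complete) geodesics. -/
structure IsGeodesicLamination (g : SurfaceMetric M) (L : Set (Set M)) : Prop where
  isLamination : IsLamination L
  geodesic : ∀ ℓ ∈ L, ∃ γ : ℝ → M, IsUnitGeodesic g γ ∧ IsSimpleCurve γ ∧ range γ = ℓ

/-! ### Index of noncompact geodesics -/

/-- The second derivative of length of an arclength parameterized geodesic in the direction of the
normal variation `φ 𝐧`, where `κ` is the Gaussian curvature along the geodesic. -/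
def secondVariation (κ φ : ℝ → ℝ) : ℝ := ∫ t, ((deriv φ t) ^ 2 - κ t * (φ t) ^ 2)

/-- The index of a noncompact geodesic with Gaussian curvature `κ` along it: the largest dimension
of a vector space of compactly supported normal variations on which the second derivative of length
is negative definite. -/
def noncompactIndex (κ : ℝ → ℝ) : ℕ∞ :=
  ⨆ V : {V : Submodule ℝ (ℝ → ℝ) // ∀ φ ∈ V, ContDiff ℝ ∞ φ ∧ HasCompactSupport φ ∧
      (φ ≠ 0 → secondVariation κ φ < 0)},
    Cardinal.toENat (Module.rank ℝ V.1)

/-- The set `ℓ` is the trace of a noncompact simple geodesic of positive index. -/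
def IsUnstableNoncompactLeaf (g : SurfaceMetric M) (ℓ : Set M) : Prop :=
  ∃ (γ : ℝ → M) (κ : ℝ → ℝ), IsUnitGeodesic g γ ∧ Function.Injective γ ∧ range γ = ℓ ∧
    (∀ t, HasGaussCurvature g (γ t) (κ t)) ∧ 0 < noncompactIndex κ

end Surface

/-! ### The middle sphere between two necks -/

/-- The middle-sphere part, with the two adjacent necks, of a surface of revolution: the metric
`ds² + R(s)² dθ²` on `domLow < s < domHigh`, with `s` the arclength along the meridians measured from
the equator.  Near the equator it is a round sphere, and the necks are the waists
`s = lower` and `s = upper`, which have negative curvature and the same radius. -/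
structure MiddleSphere where
  /-- the distance `R(s)` to the axis -/
  R : ℝ → ℝ
  domLow : ℝ
  lower : ℝ
  upper : ℝ
  domHigh : ℝ
  /-- the radius of the round sphere -/
  sphereRadius : ℝ
  /-- the common radius of the necks -/
  neckRadius : ℝ
  /-- the surface is a round sphere at distance less than `band` from the equator -/
  band : ℝ
  domLow_lt : domLow < lower
  lower_le : lower ≤ -band
  band_pos : 0 < band
  le_upper : band ≤ upper
  lt_domHigh : upper < domHigh
  sphereRadius_pos : 0 < sphereRadius
  contDiffOn : ContDiffOn ℝ ∞ R (Ioo domLow domHigh)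
  pos : ∀ s ∈ Ioo domLow domHigh, 0 < R s
  round : ∀ s, |s| < band → R s = sphereRadius * Real.cos (s / sphereRadius)
  lower_neck : R lower = neckRadius ∧ deriv R lower = 0 ∧ 0 < deriv (deriv R) lower
  upper_neck : R upper = neckRadius ∧ deriv R upper = 0 ∧ 0 < deriv (deriv R) upper
  neck_lt : ∀ s ∈ Ioo lower upper, neckRadius < R s

namespace MiddleSphere

variable (S : MiddleSphere)

/-- The coordinate domain; a point has coordinates `q 0 = s` and `q 1 = θ` (an angle). -/
def domain : Set Plane := {q | q 0 ∈ Ioo S.domLow S.domHigh}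

/-- The coefficients of the metric `ds² + R(s)² dθ²`. -/
def metric (q : Plane) : Matrix (Fin 2) (Fin 2) ℝ := !![1, 0; 0, (S.R (q 0)) ^ 2]

/-- The angle with the meridians at which limiting geodesics cross the equator: by Clairaut's
theorem `sphereRadius * sin α₀ = neckRadius`. -/
def criticalAngle : ℝ := Real.arcsin (S.neckRadius / S.sphereRadius)

/-- `c` is, in coordinates, the positive limiting geodesic through the point of the equator with
angular coordinate `θ₀`: the arclength parameterized geodesic of `ds² + R(s)² dθ²` that crosses
the equator there at the critical angle and spirals toward the upper neck as `t → ∞` and toward the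
lower neck as `t → -∞`. -/
structure IsLimitingGeodesic (θ₀ : ℝ) (c : ℝ → Plane) : Prop where
  mem_domain : ∀ t, c t ∈ S.domain
  geodesic : ∀ t, GeodesicEqAt S.metric c t
  start_s : c 0 0 = 0
  start_θ : c 0 1 = θ₀
  velocity_s : deriv (fun t => c t 0) 0 = Real.cos S.criticalAngle
  velocity_θ : deriv (fun t => c t 1) 0 = Real.sin S.criticalAngle / S.sphereRadius
  tendsto_upper : Tendsto (fun t => c t 0) atTop (𝓝 S.upper)
  tendsto_lower : Tendsto (fun t => c t 0) atBot (𝓝 S.lower)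
  winds_top : Tendsto (fun t => c t 1) atTop atTop
  winds_bot : Tendsto (fun t => c t 1) atBot atBot

/-- The distance on the round sphere from the point `q` to the point of the equator with angular
coordinate `θ₀` (spherical law of cosines). -/
def sphereDist (θ₀ : ℝ) (q : Plane) : ℝ :=
  S.sphereRadius * Real.arccos (Real.cos (q 0 / S.sphereRadius) * Real.cos (q 1 - θ₀))

/-- The disk in the round band around the equator, of radius `δ` and centered at the point of the
equator with angular coordinate `θ₀`. -/
def disk (θ₀ δ : ℝ) : Set Plane := {q | |q 0| < S.band ∧ S.sphereDist θ₀ q < δ}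

end MiddleSphere

/-! ### Bumps on the equator -/

/-- An infinite family of bumps on the equator of the middle sphere.  All are made with one smooth
monotone bump function of the distance to the center (`even`: it defines a smooth radial function),
and they are so far apart that no positive limiting geodesic meets two of them. -/
structure EquatorBumps (S : MiddleSphere) where
  f : ℝ → ℝ
  contDiff : ContDiff ℝ ∞ f
  even : ∀ x, f (-x) = f x
  antitone : AntitoneOn f (Ici 0)
  support : ∀ x, 1 / 2 ≤ x → f x = 0
  pos_zero : 0 < f 0
  /-- the angular coordinates of the bump centers -/
  center : ℕ → ℝ
  radius : ℕ → ℝ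
  radius_pos : ∀ i, 0 < radius i
  radius_le : ∀ i, radius i / 2 ≤ S.band
  separated : ∀ i j, i ≠ j → ∀ θ₀ c, S.IsLimitingGeodesic θ₀ c →
    ¬ ((∃ t, c t ∈ S.disk (center i) (radius i / 2)) ∧
       (∃ t, c t ∈ S.disk (center j) (radius j / 2)))

/-- The conformal factor, which is `1 + e^(-1/ρ) f(r/ρ)` on the bump of radius `ρ`, with `r` the
distance to its center, and which is `1` away from the bumps. -/
def EquatorBumps.factor {S : MiddleSphere} (B : EquatorBumps S) (q : Plane) : ℝ :=
  1 + ∑' i, (S.disk (B.center i) (B.radius i / 2)).indicator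
    (fun x => Real.exp (-1 / B.radius i) * B.f (S.sphereDist (B.center i) x / B.radius i)) q

/-- The surface `M` with metric `g` contains the middle sphere with necks and with the bumps, the
coordinates `(s, θ)` on this part being given by `ψ`; nothing is said about the rest of `M`. -/
structure IsBumpySurface {M : Type*} [TopologicalSpace M] [ChartedSpace Plane M]
    [IsManifold (𝓡 2) ∞ M] (g : SurfaceMetric M) (S : MiddleSphere) (B : EquatorBumps S)
    (ψ : Plane → M) : Prop where
  localDiffeo : IsLocalDiffeomorphOn 𝓘(ℝ, Plane) (𝓡 2) ∞ ψ S.domain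
  eq_iff : ∀ q ∈ S.domain, ∀ q' ∈ S.domain,
    ψ q = ψ q' ↔ q' 0 = q 0 ∧ ∃ k : ℤ, q' 1 = q 1 + k * (2 * Real.pi)
  metric_eq : ∀ q ∈ S.domain, ∀ v w : Plane,
    g.inner (ψ q) (mfderiv 𝓘(ℝ, Plane) (𝓡 2) ψ q v) (mfderiv 𝓘(ℝ, Plane) (𝓡 2) ψ q w) =
      B.factor q * ∑ i, ∑ j, S.metric q i j * v i * w j

end

/-!
Let `R₀` be the neck radius and `u = e ^ (2 w)` the conformal factor.

**Leaves.**  By Clairaut's relation the positive limiting geodesics of `g₀ = ds² + R(s)² dθ²` are the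
rotations of one curve, on which `dθ/ds = R₀ / (R √(R² - R₀²))`.  Since `R - R₀` vanishes to second
order at the necks, this slope is not integrable there: the curves wind infinitely often around the
necks, and together they foliate the part between the necks (`MiddleSphere.leaf`,
`MiddleSphere.isLimitingGeodesic`).

**They remain geodesics.**  A conformal change keeps a curve geodesic if the derivative of `w` normal
to it vanishes (`MiddleSphere.IsAdapted`, `MiddleSphere.IsAdapted.geodesicEqAt`).  Off the bumps `w`
is zero, which is its minimum, so that its differential vanishes even on the boundary of a bump,
and at the accumulation points of the bumps.  A leaf through the center of a bump meets no other
bump, by the separation hypothesis, and on this one `w` is radial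
(`EquatorBumps.isAdapted_center`).  A limit of such leaves meets a bump only if it goes through its
center, because otherwise nearby leaves would meet two bumps
(`EquatorBumps.eq_center_of_mem_closure`).  The factor `u` is smooth because it is a coefficient of
the smooth metric of the surface; nothing is assumed about convergence of the sum of the bumps.

**Instability.**  The rotation field has the normal length `φ = e ^ w √(R² - R₀²)` along a leaf.  For
the metric `g₀` it is a Jacobi field, and for `u g₀` one finds that `φ'' + K φ` is a positive
multiple of the radial slope of the bump towards the center, hence nonnegative, zero off the bump,
and positive somewhere (`EquatorBumps.jacobi_operator_of_mem`).  The second variation of `χ φ`, with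
a cutoff function `χ`, is `∫ φ² χ'² - ∫ χ² φ (φ'' + K φ)`.  As `φ` is bounded, the first term is
arbitrarily small for wide cutoffs, and the second variation is negative
(`exists_secondVariation_neg`).  The finitely many parameters where the leaf meets the center or the
boundary of the bump are treated by continuity.

**Lamination.**  The leaves are the limits of leaves through the bump centers, and the two necks,
which are limits of each of them.  Following the leaves through a given angle gives the holonomy
between parallels.  It is continuous up to the necks if it is extended by the identity, since the
leaves wind infinitely often (`MiddleSphere.continuous_holonomy`), and it gives charts in which
the leaves and the necks are horizontal (`MiddleSphere.flowBox`).  The union of the leaves is compact,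
hence closed in the surface, so that nothing needs to be known about the rest of the surface
(`IsBumpySurface.isClosed_sUnion`).
-/

noncomputable section

/-! ### Solutions of `s' = F(s)` on an interval -/

/-- `F` is a smooth positive speed on `(l, r)` that vanishes at least linearly at the ends, so that
a point moving with speed `F` needs an infinite time to reach either of them. -/
structure IsSpeed (F : ℝ → ℝ) (l r : ℝ) : Prop where
  neg : l < 0
  pos : 0 < r
  contDiffOn : ContDiffOn ℝ ∞ F (Ioo l r)
  speed_pos : ∀ s ∈ Ioo l r, 0 < F s
  bound : ∃ C, ∀ s ∈ Ioo l r, F s ≤ C * (r - s) ∧ F s ≤ C * (s - l)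

/-- The time at which a point that starts at `0` and moves with speed `F` reaches `s`. -/
def travelTime (F : ℝ → ℝ) (s : ℝ) : ℝ := ∫ x in (0 : ℝ)..s, (F x)⁻¹

/-- The position at time `t` of the point that starts at `0` and moves with speed `F` on `(l, r)`:
the inverse function of `travelTime`. -/
def travel (F : ℝ → ℝ) (l r : ℝ) : ℝ → ℝ := Function.invFunOn (travelTime F) (Ioo l r)

namespace IsSpeed

variable {F : ℝ → ℝ} {l r : ℝ}

lemma zero_mem (hF : IsSpeed F l r) : (0 : ℝ) ∈ Ioo l r := ⟨hF.neg, hF.pos⟩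

lemma continuousOn_inv (hF : IsSpeed F l r) : ContinuousOn (fun x => (F x)⁻¹) (Ioo l r) :=
  hF.contDiffOn.continuousOn.inv₀ fun s hs => (hF.speed_pos s hs).ne'

lemma hasDerivAt_travelTime (hF : IsSpeed F l r) {s : ℝ} (hs : s ∈ Ioo l r) :
    HasDerivAt (travelTime F) (F s)⁻¹ s := by
  have hsub : uIcc 0 s ⊆ Ioo l r := OrdConnected.uIcc_subset inferInstance hF.zero_mem hs
  exact intervalIntegral.integral_hasDerivAt_right
    ((hF.continuousOn_inv.mono hsub).intervalIntegrable)
    (hF.continuousOn_inv.stronglyMeasurableAtFilter isOpen_Ioo s hs)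
    (hF.continuousOn_inv.continuousAt (isOpen_Ioo.mem_nhds hs))

lemma travelTime_zero (F : ℝ → ℝ) : travelTime F 0 = 0 := by simp [travelTime]

lemma continuousOn_travelTime (hF : IsSpeed F l r) : ContinuousOn (travelTime F) (Ioo l r) :=
  fun _ hs => (hF.hasDerivAt_travelTime hs).continuousAt.continuousWithinAt

lemma strictMonoOn_travelTime (hF : IsSpeed F l r) : StrictMonoOn (travelTime F) (Ioo l r) := by
  refine strictMonoOn_of_deriv_pos (convex_Ioo l r) hF.continuousOn_travelTime fun s hs => ?_
  rw [interior_Ioo] at hs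
  rw [(hF.hasDerivAt_travelTime hs).deriv]
  exact inv_pos.2 (hF.speed_pos s hs)

lemma exists_pos_bound (hF : IsSpeed F l r) :
    ∃ C, 0 < C ∧ ∀ s ∈ Ioo l r, F s ≤ C * (r - s) ∧ F s ≤ C * (s - l) := by
  obtain ⟨C, hC⟩ := hF.bound
  refine ⟨C, ?_, hC⟩
  have h0 := (hF.speed_pos 0 hF.zero_mem).trans_le (hC 0 hF.zero_mem).1
  rw [sub_zero] at h0
  exact pos_of_mul_pos_left h0 hF.pos.le

/-- The integral of `1 / F` diverges at the right end, by comparison with `1 / (C (r - s))`. -/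
lemma exists_le_travelTime (hF : IsSpeed F l r) (y : ℝ) :
    ∃ s ∈ Ioo l r, y ≤ travelTime F s := by
  obtain ⟨C, hC0, hC⟩ := hF.exists_pos_bound
  have hd : ∀ s ∈ Ioo l r, HasDerivAt (fun s => travelTime F s + Real.log (r - s) / C)
      ((F s)⁻¹ + (-1) / (r - s) / C) s := fun s hs =>
    (hF.hasDerivAt_travelTime hs).add
      ((((hasDerivAt_id s).const_sub r).log (by simpa using (sub_pos.2 hs.2).ne')).div_const C)
  have hmono : MonotoneOn (fun s => travelTime F s + Real.log (r - s) / C) (Ioo l r) := by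
    refine monotoneOn_of_deriv_nonneg (convex_Ioo l r)
      (fun s hs => (hd s hs).continuousAt.continuousWithinAt)
      (fun s hs => (hd s (interior_subset hs)).differentiableAt.differentiableWithinAt)
      fun s hs => ?_
    rw [interior_Ioo] at hs
    rw [(hd s hs).deriv, neg_div, neg_div, div_div, one_div, ← sub_eq_add_neg, sub_nonneg]
    exact inv_anti₀ (hF.speed_pos s hs) (by rw [mul_comm]; exact (hC s hs).1)
  have hr := hF.pos
  have he : Real.exp (-(C * |y|)) ≤ 1 := Real.exp_le_one_iff.2 (by have := abs_nonneg y; nlinarith)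
  have hs : r - r * Real.exp (-(C * |y|)) ∈ Ioo l r :=
    ⟨hF.neg.trans_le (by nlinarith), by have := Real.exp_pos (-(C * |y|)); nlinarith⟩
  refine ⟨_, hs, ?_⟩
  have := hmono hF.zero_mem hs (by nlinarith)
  simp only [travelTime_zero, sub_zero, zero_add, sub_sub_cancel] at this
  rw [Real.log_mul hr.ne' (Real.exp_pos _).ne', Real.log_exp, add_div, neg_div,
    mul_div_cancel_left₀ _ hC0.ne'] at this
  linarith [le_abs_self y]

/-- The integral of `1 / F` diverges at the left end, by comparison with `1 / (C (s - l))`. -/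
lemma exists_travelTime_le (hF : IsSpeed F l r) (y : ℝ) :
    ∃ s ∈ Ioo l r, travelTime F s ≤ y := by
  obtain ⟨C, hC0, hC⟩ := hF.exists_pos_bound
  have hd : ∀ s ∈ Ioo l r, HasDerivAt (fun s => travelTime F s - Real.log (s - l) / C)
      ((F s)⁻¹ - 1 / (s - l) / C) s := fun s hs =>
    (hF.hasDerivAt_travelTime hs).sub
      ((((hasDerivAt_id s).sub_const l).log (by simpa using (sub_pos.2 hs.1).ne')).div_const C)
  have hmono : MonotoneOn (fun s => travelTime F s - Real.log (s - l) / C) (Ioo l r) := by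
    refine monotoneOn_of_deriv_nonneg (convex_Ioo l r)
      (fun s hs => (hd s hs).continuousAt.continuousWithinAt)
      (fun s hs => (hd s (interior_subset hs)).differentiableAt.differentiableWithinAt)
      fun s hs => ?_
    rw [interior_Ioo] at hs
    rw [(hd s hs).deriv, div_div, one_div, sub_nonneg]
    exact inv_anti₀ (hF.speed_pos s hs) (by rw [mul_comm]; exact (hC s hs).2)
  have hl := hF.neg
  have he : Real.exp (-(C * |y|)) ≤ 1 := Real.exp_le_one_iff.2 (by have := abs_nonneg y; nlinarith)
  have hs : l + (-l) * Real.exp (-(C * |y|)) ∈ Ioo l r :=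
    ⟨by have := Real.exp_pos (-(C * |y|)); nlinarith, lt_of_le_of_lt (by nlinarith) hF.pos⟩
  refine ⟨_, hs, ?_⟩
  have := hmono hs hF.zero_mem (by nlinarith)
  simp only [travelTime_zero, zero_sub, add_sub_cancel_left] at this
  rw [Real.log_mul (neg_ne_zero.2 hl.ne) (Real.exp_pos _).ne', Real.log_exp, add_div, neg_div,
    mul_div_cancel_left₀ _ hC0.ne'] at this
  linarith [neg_abs_le y]

lemma surjOn_travelTime (hF : IsSpeed F l r) : SurjOn (travelTime F) (Ioo l r) univ := by
  intro y _
  obtain ⟨s₁, hs₁, h₁⟩ := hF.exists_travelTime_le y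
  obtain ⟨s₂, hs₂, h₂⟩ := hF.exists_le_travelTime y
  exact isPreconnected_Ioo.intermediate_value hs₁ hs₂ hF.continuousOn_travelTime ⟨h₁, h₂⟩

lemma travel_mem (hF : IsSpeed F l r) (t : ℝ) : travel F l r t ∈ Ioo l r :=
  Function.invFunOn_mem (hF.surjOn_travelTime (mem_univ t))

@[simp]
lemma travelTime_travel (hF : IsSpeed F l r) (t : ℝ) : travelTime F (travel F l r t) = t :=
  Function.invFunOn_eq (hF.surjOn_travelTime (mem_univ t))

lemma travel_travelTime (hF : IsSpeed F l r) {s : ℝ} (hs : s ∈ Ioo l r) :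
    travel F l r (travelTime F s) = s :=
  hF.strictMonoOn_travelTime.injOn (hF.travel_mem _) hs (hF.travelTime_travel _)

lemma travel_zero (hF : IsSpeed F l r) : travel F l r 0 = 0 := by
  simpa [travelTime_zero] using hF.travel_travelTime hF.zero_mem

lemma strictMono_travel (hF : IsSpeed F l r) : StrictMono (travel F l r) := by
  intro t t' h
  rw [← hF.strictMonoOn_travelTime.lt_iff_lt (hF.travel_mem t) (hF.travel_mem t')]
  simpa [hF] using h

lemma lt_travel_iff (hF : IsSpeed F l r) {s t : ℝ} (hs : s ∈ Ioo l r) :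
    s < travel F l r t ↔ travelTime F s < t := by
  rw [← hF.strictMonoOn_travelTime.lt_iff_lt hs (hF.travel_mem t), hF.travelTime_travel]

lemma travel_lt_iff (hF : IsSpeed F l r) {s t : ℝ} (hs : s ∈ Ioo l r) :
    travel F l r t < s ↔ t < travelTime F s := by
  rw [← hF.strictMonoOn_travelTime.lt_iff_lt (hF.travel_mem t) hs, hF.travelTime_travel]

lemma continuous_travel (hF : IsSpeed F l r) : Continuous (travel F l r) := by
  refine continuous_iff_continuousAt.2 fun t => ?_
  refine continuousAt_of_monotoneOn_of_exists_between
    (hF.strictMono_travel.monotone.monotoneOn univ) univ_mem (fun b hb => ?_) fun b hb => ?_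
  · obtain ⟨c, hc₁, hc₂⟩ := exists_between (max_lt hb (hF.travel_mem t).1)
    have hc : c ∈ Ioo l r := ⟨(le_max_right _ _).trans_lt hc₁, hc₂.trans (hF.travel_mem t).2⟩
    refine ⟨travelTime F c, mem_univ _, ?_⟩
    rw [hF.travel_travelTime hc]
    exact ⟨(le_max_left _ _).trans_lt hc₁, hc₂⟩
  · obtain ⟨c, hc₁, hc₂⟩ := exists_between (lt_min hb (hF.travel_mem t).2)
    have hc : c ∈ Ioo l r := ⟨(hF.travel_mem t).1.trans hc₁, hc₂.trans_le (min_le_right _ _)⟩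
    refine ⟨travelTime F c, mem_univ _, ?_⟩
    rw [hF.travel_travelTime hc]
    exact ⟨hc₁, hc₂.trans_le (min_le_left _ _)⟩

lemma hasDerivAt_travel (hF : IsSpeed F l r) (t : ℝ) :
    HasDerivAt (travel F l r) (F (travel F l r t)) t := by
  have h := (hF.hasDerivAt_travelTime (hF.travel_mem t)).of_local_left_inverse
    hF.continuous_travel.continuousAt
    (inv_ne_zero (hF.speed_pos _ (hF.travel_mem t)).ne')
    (Eventually.of_forall hF.travelTime_travel)
  rwa [inv_inv] at h

lemma contDiff_travel (hF : IsSpeed F l r) : ContDiff ℝ ∞ (travel F l r) := by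
  refine contDiff_infty.2 fun n => ?_
  induction n with
  | zero => exact contDiff_zero.2 hF.continuous_travel
  | succ n ih =>
    rw [Nat.cast_add, Nat.cast_one]
    refine contDiff_succ_iff_deriv.2
      ⟨fun t => (hF.hasDerivAt_travel t).differentiableAt, by simp, ?_⟩
    rw [show deriv (travel F l r) = F ∘ travel F l r from
      funext fun t => (hF.hasDerivAt_travel t).deriv]
    exact (hF.contDiffOn.of_le (by exact_mod_cast le_top)).comp_contDiff ih hF.travel_mem

lemma tendsto_travel_atTop (hF : IsSpeed F l r) : Tendsto (travel F l r) atTop (𝓝 r) := by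
  refine tendsto_order.2 ⟨fun b hb => ?_, fun b hb =>
    Eventually.of_forall fun t => (hF.travel_mem t).2.trans hb⟩
  obtain ⟨c, hc₁, hc₂⟩ := exists_between (max_lt hb (hF.neg.trans hF.pos))
  filter_upwards [eventually_gt_atTop (travelTime F c)] with t ht
  exact (le_max_left _ _).trans_lt (hc₁.trans
    ((hF.lt_travel_iff ⟨(le_max_right _ _).trans_lt hc₁, hc₂⟩).2 ht))

lemma tendsto_travel_atBot (hF : IsSpeed F l r) : Tendsto (travel F l r) atBot (𝓝 l) := by
  refine tendsto_order.2 ⟨fun b hb => Eventually.of_forall fun t => hb.trans (hF.travel_mem t).1,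
    fun b hb => ?_⟩
  obtain ⟨c, hc₁, hc₂⟩ := exists_between (lt_min hb (hF.neg.trans hF.pos))
  filter_upwards [eventually_lt_atBot (travelTime F c)] with t ht
  exact ((hF.travel_lt_iff ⟨hc₁, hc₂.trans_le (min_le_right _ _)⟩).2 ht).trans
    (hc₂.trans_le (min_le_left _ _))

/-- The travel time has no interior limit at the ends of the interval, so it is proper there. -/
lemma tendsto_travelTime_comp_atTop (hF : IsSpeed F l r) {x : ℝ → ℝ} (hx : ∀ t, x t ∈ Ioo l r)
    (h : Tendsto x atTop (𝓝 r)) : Tendsto (fun t => travelTime F (x t)) atTop atTop := by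
  refine tendsto_atTop.2 fun y => ?_
  obtain ⟨s, hs, hy⟩ := hF.exists_le_travelTime y
  filter_upwards [h.eventually (lt_mem_nhds hs.2)] with t ht
  exact hy.trans (hF.strictMonoOn_travelTime hs (hx t) ht).le

lemma tendsto_travelTime_comp_atBot (hF : IsSpeed F l r) {x : ℝ → ℝ} (hx : ∀ t, x t ∈ Ioo l r)
    (h : Tendsto x atBot (𝓝 l)) : Tendsto (fun t => travelTime F (x t)) atBot atBot := by
  refine tendsto_atBot.2 fun y => ?_
  obtain ⟨s, hs, hy⟩ := hF.exists_travelTime_le y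
  filter_upwards [h.eventually (gt_mem_nhds hs.1)] with t ht
  exact (hF.strictMonoOn_travelTime (hx t) hs ht).le.trans hy

lemma contDiffOn_travelTime (hF : IsSpeed F l r) : ContDiffOn ℝ ∞ (travelTime F) (Ioo l r) := by
  refine (contDiffOn_infty_iff_deriv_of_isOpen isOpen_Ioo).2 ⟨fun s hs =>
    (hF.hasDerivAt_travelTime hs).differentiableAt.differentiableWithinAt, ?_⟩
  exact (hF.contDiffOn.inv fun s hs => (hF.speed_pos s hs).ne').congr
    fun s hs => (hF.hasDerivAt_travelTime hs).deriv

end IsSpeed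

/-! ### Partial derivatives -/

lemma partialD_congr {F F' : Plane → ℝ} {q : Plane} (h : F =ᶠ[𝓝 q] F') (k : Fin 2) :
    partialD k F q = partialD k F' q := by
  rw [partialD, partialD, h.fderiv_eq]

lemma partialD_eventuallyEq {F F' : Plane → ℝ} {q : Plane} (h : F =ᶠ[𝓝 q] F') (k : Fin 2) :
    partialD k F =ᶠ[𝓝 q] partialD k F' := by
  filter_upwards [h.eventuallyEq_nhds] with x hx using partialD_congr hx k

lemma HasFDerivAt.partialD {F : Plane → ℝ} {F' : Plane →L[ℝ] ℝ} {q : Plane}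
    (h : HasFDerivAt F F' q) (k : Fin 2) : partialD k F q = F' (EuclideanSpace.single k 1) := by
  rw [_root_.partialD, h.fderiv]

lemma partialD_const (c : ℝ) (k : Fin 2) (q : Plane) : partialD k (fun _ => c) q = 0 := by
  simp [partialD]

lemma hasFDerivAt_coord (i : Fin 2) (q : Plane) :
    HasFDerivAt (fun x : Plane => x i) (EuclideanSpace.proj i : Plane →L[ℝ] ℝ) q :=
  (EuclideanSpace.proj i : Plane →L[ℝ] ℝ).hasFDerivAt

lemma contDiff_coord (i : Fin 2) {n : WithTop ℕ∞} : ContDiff ℝ n (fun x : Plane => x i) :=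
  (EuclideanSpace.proj i : Plane →L[ℝ] ℝ).contDiff

lemma continuous_toPlane {X : Type*} [TopologicalSpace X] {f f' : X → ℝ} (hf : Continuous f)
    (hf' : Continuous f') : Continuous fun x => (!₂[f x, f' x] : Plane) := by
  refine (PiLp.continuous_toLp 2 _).comp (continuous_pi fun k => ?_)
  fin_cases k
  · exact hf
  · exact hf'

/-- The product rule for two functions of one coordinate each. -/
lemma partialD_mul_coord {f f' : ℝ → ℝ} {a b : ℝ} {q : Plane} (hf : HasDerivAt f a (q 0))
    (hf' : HasDerivAt f' b (q 1)) :
    partialD 0 (fun x => f (x 0) * f' (x 1)) q = a * f' (q 1) ∧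
      partialD 1 (fun x => f (x 0) * f' (x 1)) q = f (q 0) * b := by
  have h : HasFDerivAt (fun x : Plane => f (x 0) * f' (x 1)) _ q :=
    (hf.comp_hasFDerivAt q (hasFDerivAt_coord 0 q)).mul
      (hf'.comp_hasFDerivAt q (hasFDerivAt_coord 1 q))
  constructor
  · rw [HasFDerivAt.partialD h 0]; simp; ring
  · rw [HasFDerivAt.partialD h 1]; simp

lemma partialD_coord_zero {f : ℝ → ℝ} {a : ℝ} {q : Plane} (hf : HasDerivAt f a (q 0)) :
    partialD 0 (fun x => f (x 0)) q = a ∧ partialD 1 (fun x => f (x 0)) q = 0 := by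
  have h := hf.comp_hasFDerivAt q (hasFDerivAt_coord 0 q)
  constructor
  · rw [show (fun x : Plane => f (x 0)) = f ∘ fun x : Plane => x 0 from rfl,
      HasFDerivAt.partialD h 0]; simp
  · rw [show (fun x : Plane => f (x 0)) = f ∘ fun x : Plane => x 0 from rfl,
      HasFDerivAt.partialD h 1]; simp

lemma partialD_mul {F F' : Plane → ℝ} {q : Plane} (hF : DifferentiableAt ℝ F q)
    (hF' : DifferentiableAt ℝ F' q) (k : Fin 2) :
    partialD k (fun x => F x * F' x) q = partialD k F q * F' q + F q * partialD k F' q := by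
  have h : HasFDerivAt (fun x => F x * F' x) _ q := hF.hasFDerivAt.mul hF'.hasFDerivAt
  rw [HasFDerivAt.partialD h k]
  simp [partialD]; ring

lemma partialD_add {F F' : Plane → ℝ} {q : Plane} (hF : DifferentiableAt ℝ F q)
    (hF' : DifferentiableAt ℝ F' q) (k : Fin 2) :
    partialD k (fun x => F x + F' x) q = partialD k F q + partialD k F' q := by
  have h : HasFDerivAt (fun x => F x + F' x) _ q := hF.hasFDerivAt.add hF'.hasFDerivAt
  rw [HasFDerivAt.partialD h k]
  simp [partialD]

lemma partialD_neg (F : Plane → ℝ) (q : Plane) (k : Fin 2) :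
    partialD k (fun x => -F x) q = -partialD k F q := by
  simp [partialD]

lemma partialD_comp {f : ℝ → ℝ} {a : ℝ} {F : Plane → ℝ} {q : Plane} (hf : HasDerivAt f a (F q))
    (hF : DifferentiableAt ℝ F q) (k : Fin 2) :
    partialD k (fun x => f (F x)) q = a * partialD k F q := by
  rw [show (fun x => f (F x)) = f ∘ F from rfl,
    HasFDerivAt.partialD (hf.comp_hasFDerivAt q hF.hasFDerivAt) k]
  simp [partialD]

lemma ContDiffAt.deriv_infty {f : ℝ → ℝ} {x : ℝ} (hf : ContDiffAt ℝ ∞ f x) :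
    ContDiffAt ℝ ∞ (deriv f) x :=
  (hf.fderiv_right (m := ∞) (by simp)).clm_apply contDiffAt_const

lemma ContDiffAt.partialD {F : Plane → ℝ} {q : Plane} (hF : ContDiffAt ℝ ∞ F q) (k : Fin 2) :
    ContDiffAt ℝ ∞ (partialD k F) q :=
  (hF.fderiv_right (m := ∞) (by simp)).clm_apply contDiffAt_const

/-- The derivative of a function on the plane along a curve. -/
lemma hasDerivAt_comp_curve {F : Plane → ℝ} {c : ℝ → Plane} {t a b : ℝ}
    (hF : DifferentiableAt ℝ F (c t)) (h0 : HasDerivAt (fun τ => c τ 0) a t)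
    (h1 : HasDerivAt (fun τ => c τ 1) b t) :
    HasDerivAt (fun τ => F (c τ)) (partialD 0 F (c t) * a + partialD 1 F (c t) * b) t := by
  have hc : HasDerivAt c (!₂[a, b] : Plane) t := by
    rw [hasDerivAt_iff_hasFDerivAt, ← hasFDerivWithinAt_univ, hasFDerivWithinAt_euclidean]
    intro i; fin_cases i
    · convert! h0.hasFDerivAt.hasFDerivWithinAt using 1
    · convert! h1.hasFDerivAt.hasFDerivWithinAt using 1
  have h := hF.hasFDerivAt.comp_hasDerivAt t hc
  have e : (!₂[a, b] : Plane) = a • EuclideanSpace.single (0 : Fin 2) (1 : ℝ)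
      + b • EuclideanSpace.single (1 : Fin 2) (1 : ℝ) := by
    ext i; fin_cases i <;> simp
  rw [e, map_add, map_smul, map_smul, smul_eq_mul, smul_eq_mul, mul_comm a, mul_comm b] at h
  exact h

/-! ### Surfaces of revolution with a conformal factor -/

/-- The coefficients of the metric `e ^ (2 w) (ds² + R(s)² dθ²)`. -/
def conformalMetric (R : ℝ → ℝ) (w : Plane → ℝ) (q : Plane) : Matrix (Fin 2) (Fin 2) ℝ :=
  Real.exp (2 * w q) • !![1, 0; 0, (R (q 0)) ^ 2]

/-- The Christoffel symbols of the metric `e ^ (2 w) (ds² + R(s)² dθ²)`. -/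
def conformalChristoffel (R : ℝ → ℝ) (w : Plane → ℝ) (k i j : Fin 2) (q : Plane) : ℝ :=
  ![!![partialD 0 w q, partialD 1 w q;
      partialD 1 w q, -((R (q 0)) ^ 2 * partialD 0 w q + R (q 0) * deriv R (q 0))],
    !![-(partialD 1 w q / (R (q 0)) ^ 2), partialD 0 w q + deriv R (q 0) / R (q 0);
      partialD 0 w q + deriv R (q 0) / R (q 0), partialD 1 w q]] k i j

lemma christoffel_congr {G G' : Plane → Matrix (Fin 2) (Fin 2) ℝ} {q : Plane} (h : G =ᶠ[𝓝 q] G')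
    (k i j : Fin 2) : christoffel G k i j =ᶠ[𝓝 q] christoffel G' k i j := by
  filter_upwards [h.eventuallyEq_nhds] with x hx
  have hp : ∀ m a b, partialD m (fun y => G y a b) x = partialD m (fun y => G' y a b) x :=
    fun m a b => partialD_congr (hx.mono fun y hy => by simp [hy]) m
  simp only [christoffel, hp, hx.eq_of_nhds]

lemma GeodesicEqAt.congr {G G' : Plane → Matrix (Fin 2) (Fin 2) ℝ} {c : ℝ → Plane} {t : ℝ}
    (hc : GeodesicEqAt G' c t) (h : G =ᶠ[𝓝 (c t)] G') : GeodesicEqAt G c t := by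
  refine ⟨hc.1, fun k => ?_⟩
  simp only [fun k i j => (christoffel_congr h k i j).eq_of_nhds]
  exact hc.2 k

lemma GeodesicEqAt.congr_curve {G : Plane → Matrix (Fin 2) (Fin 2) ℝ} {c c' : ℝ → Plane} {t : ℝ}
    (hc : GeodesicEqAt G c' t) (h : c =ᶠ[𝓝 t] c') : GeodesicEqAt G c t := by
  refine ⟨hc.1.congr_of_eventuallyEq h, fun k => ?_⟩
  have hk : ∀ i, (fun τ => c τ i) =ᶠ[𝓝 t] fun τ => c' τ i :=
    fun i => h.mono fun τ hτ => by simp [hτ]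
  simp only [fun i => (hk i).deriv_eq, fun i => (hk i).deriv.deriv_eq, h.eq_of_nhds]
  exact hc.2 k

lemma coordGaussCurvature_congr {G G' : Plane → Matrix (Fin 2) (Fin 2) ℝ} {q : Plane}
    (h : G =ᶠ[𝓝 q] G') : coordGaussCurvature G q = coordGaussCurvature G' q := by
  simp only [coordGaussCurvature, riemannCoeff, h.eq_of_nhds,
    fun k i j => (christoffel_congr h k i j).eq_of_nhds,
    fun m k i j => partialD_congr (christoffel_congr h k i j) m]

lemma christoffel_conformalMetric {R : ℝ → ℝ} {w : Plane → ℝ} {q : Plane}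
    (hw : DifferentiableAt ℝ w q) (hR : DifferentiableAt ℝ R (q 0)) (h0 : R (q 0) ≠ 0)
    (k i j : Fin 2) :
    christoffel (conformalMetric R w) k i j q = conformalChristoffel R w k i j q := by
  have hE : DifferentiableAt ℝ (fun x => Real.exp (2 * w x)) q := (hw.const_mul 2).exp
  have hR' : DifferentiableAt ℝ (fun x : Plane => R (x 0) ^ 2) q :=
    (hR.comp q (hasFDerivAt_coord 0 q).differentiableAt).pow 2
  have pE : ∀ m, partialD m (fun x => Real.exp (2 * w x)) q =
      2 * Real.exp (2 * w q) * partialD m w q := fun m => by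
    rw [partialD_comp (f := fun y => Real.exp (2 * y)) (a := 2 * Real.exp (2 * w q)) _ hw]
    simpa [mul_comm] using ((hasDerivAt_id (w q)).const_mul 2).exp
  have pR : _ ∧ _ := partialD_coord_zero (f := fun x => R x ^ 2) (q := q) (hR.hasDerivAt.pow 2)
  have p00 : ∀ m, partialD m (fun x => conformalMetric R w x 0 0) q =
      2 * Real.exp (2 * w q) * partialD m w q := by simpa [conformalMetric] using pE
  have p01 : ∀ m, partialD m (fun x => conformalMetric R w x 0 1) q = 0 := by
    simp [conformalMetric, partialD_const]
  have p10 : ∀ m, partialD m (fun x => conformalMetric R w x 1 0) q = 0 := by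
    simp [conformalMetric, partialD_const]
  have p11 : ∀ m, partialD m (fun x => conformalMetric R w x 1 1) q =
      2 * Real.exp (2 * w q) * partialD m w q * R (q 0) ^ 2
        + Real.exp (2 * w q) * partialD m (fun x : Plane => R (x 0) ^ 2) q := by
    intro m
    rw [← pE, ← partialD_mul hE hR']
    simp [conformalMetric]
  have hinv : (conformalMetric R w q)⁻¹ =
      !![(Real.exp (2 * w q))⁻¹, 0; 0, (Real.exp (2 * w q) * R (q 0) ^ 2)⁻¹] := by
    refine Matrix.inv_eq_right_inv ?_
    have := (Real.exp_pos (2 * w q)).ne'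
    ext i j
    fin_cases i <;> fin_cases j <;> simp [conformalMetric, Matrix.mul_apply, this]
    field_simp
  have hE0 := (Real.exp_pos (2 * w q)).ne'
  fin_cases k <;> fin_cases i <;> fin_cases j <;>
    simp [christoffel, conformalChristoffel, hinv, p00, p01, p10, p11, pR.1, pR.2] <;>
    field_simp

/-- The geodesic equation of `e ^ (2 w) (ds² + R(s)² dθ²)`, written out. -/
lemma geodesicEqAt_conformalMetric {R : ℝ → ℝ} {w : Plane → ℝ} {c : ℝ → Plane} {t : ℝ}
    {x y : ℝ → ℝ} {x' y' : ℝ} (hc : ContDiffAt ℝ ∞ c t) (hw : DifferentiableAt ℝ w (c t))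
    (hR : DifferentiableAt ℝ R (c t 0)) (h0 : R (c t 0) ≠ 0)
    (hx : ∀ τ, HasDerivAt (fun τ => c τ 0) (x τ) τ) (hy : ∀ τ, HasDerivAt (fun τ => c τ 1) (y τ) τ)
    (hx' : HasDerivAt x x' t) (hy' : HasDerivAt y y' t)
    (e0 : x' + partialD 0 w (c t) * x t ^ 2 + 2 * partialD 1 w (c t) * x t * y t
      - (R (c t 0) ^ 2 * partialD 0 w (c t) + R (c t 0) * deriv R (c t 0)) * y t ^ 2 = 0)
    (e1 : y' - partialD 1 w (c t) / R (c t 0) ^ 2 * x t ^ 2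
      + 2 * (partialD 0 w (c t) + deriv R (c t 0) / R (c t 0)) * x t * y t
      + partialD 1 w (c t) * y t ^ 2 = 0) :
    GeodesicEqAt (conformalMetric R w) c t := by
  refine ⟨hc, fun k => ?_⟩
  simp only [christoffel_conformalMetric hw hR h0, Fin.sum_univ_two,
    funext fun τ => (hx τ).deriv, funext fun τ => (hy τ).deriv]
  fin_cases k
  · simp [funext fun τ => (hx τ).deriv, hx'.deriv, conformalChristoffel]
    linear_combination e0
  · simp [funext fun τ => (hy τ).deriv, hy'.deriv, conformalChristoffel]
    linear_combination e1

/-- The Gaussian curvature `e ^ (-2 w) (-R'' / R - Δ w)` of a metric that is conformal to a metric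
of revolution. -/
lemma coordGaussCurvature_conformalMetric {R : ℝ → ℝ} {w : Plane → ℝ} {q : Plane}
    (hw : ContDiffAt ℝ ∞ w q) (hR : ContDiffAt ℝ ∞ R (q 0)) (h0 : R (q 0) ≠ 0) :
    coordGaussCurvature (conformalMetric R w) q =
      Real.exp (-(2 * w q)) * (-(deriv (deriv R) (q 0) / R (q 0))
        - (partialD 0 (partialD 0 w) q + deriv R (q 0) / R (q 0) * partialD 0 w q
          + partialD 1 (partialD 1 w) q / R (q 0) ^ 2)) := by
  have hcoord : ContinuousAt (fun x : Plane => x 0) q :=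
    (contDiff_coord 0 (n := 0)).continuous.continuousAt
  have ev : ∀ k i j, christoffel (conformalMetric R w) k i j =ᶠ[𝓝 q]
      conformalChristoffel R w k i j := by
    intro k i j
    filter_upwards [(hw.of_le (m := 1) (by simp)).eventually (by simp),
      hcoord.eventually ((hR.of_le (m := 1) (by simp)).eventually (by simp)),
      hcoord.eventually (hR.continuousAt.eventually_ne h0)] with x hx hRx hx0
    exact christoffel_conformalMetric (hx.differentiableAt (by simp))
      (hRx.differentiableAt (by simp)) hx0 k i j
  have dR := (hR.differentiableAt (by simp)).hasDerivAt
  have dR1 := (hR.deriv_infty.differentiableAt (by simp)).hasDerivAt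
  have dw : ∀ k, DifferentiableAt ℝ (partialD k w) q := fun k =>
    (hw.partialD k).differentiableAt (by simp)
  have h1 : DifferentiableAt ℝ (fun x : Plane => R (x 0) ^ 2) q :=
    ((hR.differentiableAt (by simp)).comp q (hasFDerivAt_coord 0 q).differentiableAt).pow 2
  have pR : _ ∧ _ := partialD_coord_zero (f := fun x => R x ^ 2) (q := q) (dR.pow 2)
  have pR1 : _ ∧ _ := partialD_coord_zero (f := fun x => R x * deriv R x) (q := q) (dR.mul dR1)
  have h2 : DifferentiableAt ℝ (fun x : Plane => R (x 0) * deriv R (x 0)) q :=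
    DifferentiableAt.comp (g := fun x => R x * deriv R x) q (dR.mul dR1).differentiableAt
      (hasFDerivAt_coord 0 q).differentiableAt
  have p011 : partialD 0 (conformalChristoffel R w 0 1 1) q =
      -(2 * R (q 0) * deriv R (q 0) * partialD 0 w q + R (q 0) ^ 2 * partialD 0 (partialD 0 w) q
        + (deriv R (q 0) * deriv R (q 0) + R (q 0) * deriv (deriv R) (q 0))) := by
    rw [show conformalChristoffel R w 0 1 1 = fun x => -(R (x 0) ^ 2 * partialD 0 w x
        + R (x 0) * deriv R (x 0)) by ext x; simp [conformalChristoffel],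
      partialD_neg, partialD_add (F := fun x => R (x 0) ^ 2 * partialD 0 w x) (h1.mul (dw 0)) h2,
      partialD_mul h1 (dw 0), pR.1, pR1.1]
    simp
  have p001 : partialD 1 (conformalChristoffel R w 0 0 1) q = partialD 1 (partialD 1 w) q :=
    congrArg (fun F => partialD 1 F q) (by ext x; simp [conformalChristoffel])
  have hE0 := (Real.exp_pos (2 * w q)).ne'
  simp only [coordGaussCurvature, riemannCoeff, Fin.sum_univ_two,
    fun k i j => (ev k i j).eq_of_nhds, fun m k i j => partialD_congr (ev k i j) m, p011, p001]
  simp [conformalMetric, conformalChristoffel, Matrix.det_fin_two, Real.exp_neg]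
  field_simp
  ring

/-! ### A criterion for positive index -/

/-- If `k` is a bounded function with `k (k'' + κ k) ≥ 0`, and with strict inequality somewhere,
then some variation decreases the length to second order.  With a cutoff `χ`, the second variation
of `χ k` is `∫ k² χ'² - ∫ χ² k (k'' + κ k)`, and the first term tends to zero as the cutoff gets
wide. -/
lemma exists_secondVariation_neg {k κ : ℝ → ℝ} {C t₀ : ℝ} (hk : ContDiff ℝ ∞ k) (hκ : Continuous κ)
    (hC : ∀ t, k t ^ 2 ≤ C) (hq : ∀ t, 0 ≤ k t * (deriv (deriv k) t + κ t * k t))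
    (ht₀ : 0 < k t₀ * (deriv (deriv k) t₀ + κ t₀ * k t₀)) :
    ∃ φ : ℝ → ℝ, ContDiff ℝ ∞ φ ∧ HasCompactSupport φ ∧ secondVariation κ φ < 0 := by
  have hk1 : ContDiff ℝ ∞ (deriv k) := (contDiff_infty_iff_deriv.1 hk).2
  have hk2 : ContDiff ℝ ∞ (deriv (deriv k)) := (contDiff_infty_iff_deriv.1 hk1).2
  set q : ℝ → ℝ := fun t => k t * (deriv (deriv k) t + κ t * k t) with hqdef
  have hqc : Continuous q := hk.continuous.mul (hk2.continuous.add (hκ.mul hk.continuous))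
  let f : ContDiffBump (0 : ℝ) := ⟨1, 2, one_pos, one_lt_two⟩
  have hf : ContDiff ℝ ∞ f := f.contDiff
  have hf1 : Continuous (deriv f) := (contDiff_infty_iff_deriv.1 hf).2.continuous
  have hfd : HasCompactSupport (deriv f) := f.hasCompactSupport.deriv
  have hC0 : 0 ≤ C := (sq_nonneg _).trans (hC 0)
  -- the cutoffs
  let χ : ℝ → ℝ → ℝ := fun n t => f (t / n)
  have hχ : ∀ n, ContDiff ℝ ∞ (χ n) := fun n => hf.comp (contDiff_id.div_const n)
  have hχd : ∀ n t, HasDerivAt (χ n) (deriv f (t / n) * (1 / n)) t := fun n t =>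
    ((hf.differentiable (by simp)) _).hasDerivAt.comp t ((hasDerivAt_id t).div_const n)
  have hχs : ∀ n : ℝ, 0 < n → HasCompactSupport (χ n) := fun n hn => by
    have := f.hasCompactSupport.comp_homeomorph (Homeomorph.mulRight₀ n⁻¹ (inv_ne_zero hn.ne'))
    simpa [χ, Function.comp_def, div_eq_mul_inv] using this
  -- the second variation of `χ n * k`
  have hvar : ∀ n : ℝ, 0 < n → secondVariation κ (fun t => χ n t * k t) ≤
      C * (n⁻¹ * ∫ t, (deriv f t) ^ 2) - ∫ t, χ n t ^ 2 * q t := by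
    intro n hn
    have hχc := (hχ n).continuous
    have hχ1 : Continuous (fun t => deriv f (t / n) * (1 / n)) := by fun_prop
    have hkc := hk.continuous
    have hk1c := hk1.continuous
    have i1 : MeasureTheory.Integrable (fun t => χ n t ^ 2 * q t) :=
      Continuous.integrable_of_hasCompactSupport (by fun_prop)
        ((hχs n hn).mono fun t ht => by
          simp only [Function.mem_support] at ht ⊢; contrapose! ht; simp [ht])
    have i2 : MeasureTheory.Integrable (fun t => k t * deriv k t * χ n t ^ 2) :=
      Continuous.integrable_of_hasCompactSupport (by fun_prop)
        ((hχs n hn).mono fun t ht => by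
          simp only [Function.mem_support] at ht ⊢; contrapose! ht; simp [ht])
    have hk2c := hk2.continuous
    have i3 : MeasureTheory.Integrable (fun t => (deriv k t * deriv k t + k t * deriv (deriv k) t)
        * χ n t ^ 2 + k t * deriv k t * (2 * χ n t * (deriv f (t / n) * (1 / n)))) :=
      Continuous.integrable_of_hasCompactSupport (by fun_prop)
        ((hχs n hn).mono fun t ht => by
          simp only [Function.mem_support] at ht ⊢; contrapose! ht; simp [ht])
    have hds : HasCompactSupport fun t => deriv f (t / n) := by
      have := hfd.comp_homeomorph (Homeomorph.mulRight₀ n⁻¹ (inv_ne_zero hn.ne'))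
      simpa [Function.comp_def, div_eq_mul_inv] using this
    have i4 : MeasureTheory.Integrable (fun t => k t ^ 2 * (deriv f (t / n) * (1 / n)) ^ 2) :=
      Continuous.integrable_of_hasCompactSupport (by fun_prop)
        (hds.mono fun t ht => by
          simp only [Function.mem_support] at ht ⊢; contrapose! ht; simp [ht])
    have i5 : MeasureTheory.Integrable (fun t => C * (n⁻¹ ^ 2 * (deriv f (t / n)) ^ 2)) :=
      Continuous.integrable_of_hasCompactSupport (by fun_prop)
        (hds.mono fun t ht => by
          simp only [Function.mem_support] at ht ⊢; contrapose! ht; simp [ht])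
    have hzero := MeasureTheory.integral_eq_zero_of_hasDerivAt_of_integrable
      (f := fun t => k t * deriv k t * χ n t ^ 2) (fun t => by
        have h := ((hk.differentiable (by simp) t).hasDerivAt.mul
          (hk1.differentiable (by simp) t).hasDerivAt).mul ((hχd n t).pow 2)
        convert! h using 1
        simp) i3 i2
    have hder : ∀ t, deriv (fun t => χ n t * k t) t =
        deriv f (t / n) * (1 / n) * k t + χ n t * deriv k t := fun t =>
      ((hχd n t).mul (hk.differentiable (by simp) t).hasDerivAt).deriv
    have hsplit : secondVariation κ (fun t => χ n t * k t) =
        (∫ t, k t ^ 2 * (deriv f (t / n) * (1 / n)) ^ 2) +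
        (∫ t, ((deriv k t * deriv k t + k t * deriv (deriv k) t) * χ n t ^ 2 +
          k t * deriv k t * (2 * χ n t * (deriv f (t / n) * (1 / n))))) -
        ∫ t, χ n t ^ 2 * q t := by
      rw [← MeasureTheory.integral_add i4 i3]
      refine Eq.trans ?_ (MeasureTheory.integral_sub (i4.add i3) i1)
      rw [secondVariation]
      congr 1
      ext t
      simp only [hder, hqdef]
      ring
    have hle : ∫ t, k t ^ 2 * (deriv f (t / n) * (1 / n)) ^ 2 ≤
        C * (n⁻¹ * ∫ t, (deriv f t) ^ 2) := by
      have hint : ∫ t, C * (n⁻¹ ^ 2 * (deriv f (t / n)) ^ 2) =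
          C * (n⁻¹ * ∫ t, (deriv f t) ^ 2) := by
        rw [MeasureTheory.integral_const_mul, MeasureTheory.integral_const_mul,
          MeasureTheory.Measure.integral_comp_div (fun t => deriv f t ^ 2) n, smul_eq_mul,
          abs_of_pos hn]
        field_simp
      rw [← hint]
      refine MeasureTheory.integral_mono i4 i5 fun t => ?_
      have := mul_le_mul_of_nonneg_right (hC t) (sq_nonneg (deriv f (t / n) * (1 / n)))
      simp only
      calc _ ≤ _ := this
        _ = _ := by ring
    rw [hsplit, hzero]
    linarith
  -- the gain on a fixed cutoff around `t₀`
  obtain ⟨N, hN1, hN⟩ : ∃ N : ℝ, 1 ≤ N ∧ |t₀| ≤ N := ⟨max 1 |t₀|, le_max_left _ _, le_max_right _ _⟩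
  have hone : ∀ n t : ℝ, 0 < n → |t| ≤ n → χ n t = 1 := fun n t hn ht =>
    f.one_of_mem_closedBall (by
      simp only [f, mem_closedBall_zero_iff, Real.norm_eq_abs, abs_div, abs_of_pos hn]
      exact (div_le_one hn).2 ht)
  have hint : ∀ n : ℝ, 0 < n → MeasureTheory.Integrable (fun t => χ n t ^ 2 * q t) := fun n hn =>
    Continuous.integrable_of_hasCompactSupport (((hχ n).continuous.pow 2).mul hqc)
      ((hχs n hn).mono fun t ht => by
        simp only [Function.mem_support] at ht ⊢; contrapose! ht; simp [ht])
  have hδ : 0 < ∫ t, χ N t ^ 2 * q t := by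
    refine Continuous.integral_pos_of_hasCompactSupport_nonneg_nonzero (x := t₀)
      (((hχ N).continuous.pow 2).mul hqc) ((hχs N (by linarith)).mono fun t ht => by
        simp only [Function.mem_support] at ht ⊢; contrapose! ht; simp [ht])
      (fun t => mul_nonneg (sq_nonneg _) (hq t)) ?_
    rw [hone N t₀ (by linarith) hN]
    simpa [q] using ht₀.ne'
  have hmono : ∀ n : ℝ, 2 * N ≤ n → ∫ t, χ N t ^ 2 * q t ≤ ∫ t, χ n t ^ 2 * q t := by
    intro n hn
    refine MeasureTheory.integral_mono (hint N (by linarith)) (hint n (by linarith)) fun t => ?_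
    refine mul_le_mul_of_nonneg_right ?_ (hq t)
    rcases le_or_gt |t| n with h | h
    · rw [hone n t (by linarith) h]
      exact pow_le_pow_left₀ f.nonneg f.le_one 2
    · have hz : χ N t = 0 := f.zero_of_le_dist (by
        simp only [f, dist_zero_right, Real.norm_eq_abs, abs_div, abs_of_pos (by linarith : 0 < N)]
        rw [le_div_iff₀ (by linarith)]; linarith)
      rw [hz, zero_pow two_ne_zero]
      exact sq_nonneg _
  set δ := ∫ t, χ N t ^ 2 * q t
  set I := ∫ t, (deriv f t) ^ 2
  have hI : 0 ≤ I := MeasureTheory.integral_nonneg fun t => sq_nonneg _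
  have hn : 0 < 2 * N + C * I / δ := by positivity
  refine ⟨fun t => χ (2 * N + C * I / δ) t * k t, (hχ _).mul hk, (hχs _ hn).mul_right, ?_⟩
  refine (hvar _ hn).trans_lt ?_
  have h1 := hmono (2 * N + C * I / δ) (by linarith [div_nonneg (mul_nonneg hC0 hI) hδ.le])
  have h2 : C * ((2 * N + C * I / δ)⁻¹ * I) < δ := by
    rw [show C * ((2 * N + C * I / δ)⁻¹ * I) = (C * I) / (2 * N + C * I / δ) by ring,
      div_lt_iff₀ hn, mul_add, mul_div_cancel₀ _ hδ.ne']
    nlinarith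
  linarith

lemma noncompactIndex_pos {κ φ : ℝ → ℝ} (hφ : ContDiff ℝ ∞ φ) (hs : HasCompactSupport φ)
    (hneg : secondVariation κ φ < 0) : 0 < noncompactIndex κ := by
  have hφ0 : φ ≠ 0 := by
    rintro rfl
    simp [secondVariation] at hneg
  have hscale : ∀ c : ℝ, secondVariation κ (c • φ) = c ^ 2 * secondVariation κ φ := fun c => by
    rw [secondVariation, secondVariation, ← MeasureTheory.integral_const_mul]
    congr 1
    ext t
    rw [show c • φ = fun t => c * φ t from rfl, deriv_const_mul_field]
    ring
  have hV : ∀ ψ ∈ Submodule.span ℝ {φ}, ContDiff ℝ ∞ ψ ∧ HasCompactSupport ψ ∧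
      (ψ ≠ 0 → secondVariation κ ψ < 0) := by
    intro ψ hψ
    obtain ⟨c, rfl⟩ := Submodule.mem_span_singleton.1 hψ
    refine ⟨contDiff_const.smul hφ, hs.smul_left (f := fun _ => c), fun h => ?_⟩
    have hc : c ≠ 0 := by rintro rfl; simp at h
    rw [hscale]
    exact mul_neg_of_pos_of_neg (by positivity) hneg
  refine lt_iSup_iff.2 ⟨⟨_, hV⟩, pos_iff_ne_zero.2 fun h => ?_⟩
  rw [Cardinal.toENat_eq_zero, rank_eq_zero_iff] at h
  obtain ⟨a, ha, h⟩ := h ⟨φ, Submodule.mem_span_singleton_self φ⟩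
  rw [Subtype.ext_iff] at h
  exact (smul_eq_zero.1 h).elim ha hφ0

/-! ### The leaves between the necks -/

/-- A function is quadratically close to its value at a critical point. -/
lemma exists_abs_sub_le_sq {G : ℝ → ℝ} {l r p : ℝ} (hp : p ∈ Icc l r)
    (hG : ∀ s ∈ Icc l r, ContDiffAt ℝ ∞ G s) (h0 : deriv G p = 0) :
    ∃ M, 0 ≤ M ∧ ∀ s ∈ Icc l r, |G s - G p| ≤ M * (s - p) ^ 2 := by
  obtain ⟨M, hM⟩ := isCompact_Icc.exists_bound_of_continuousOn (s := Icc l r)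
    (f := deriv (deriv G)) fun s hs =>
      (hG s hs).deriv_infty.deriv_infty.continuousAt.continuousWithinAt
  have hM0 : 0 ≤ M := (norm_nonneg _).trans (hM p hp)
  have h1 : ∀ s ∈ Icc l r, ‖deriv G s‖ ≤ M * |s - p| := fun s hs => by
    have := (convex_Icc l r).norm_image_sub_le_of_norm_hasDerivWithin_le
      (f := deriv G) (fun x hx => ((hG x hx).deriv_infty.differentiableAt
        (by simp)).hasDerivAt.hasDerivWithinAt) hM hp hs
    simpa [h0] using this
  refine ⟨M, hM0, fun s hs => ?_⟩
  have hsub : uIcc p s ⊆ Icc l r := OrdConnected.uIcc_subset inferInstance hp hs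
  have := (convex_uIcc p s).norm_image_sub_le_of_norm_hasDerivWithin_le (C := M * |s - p|)
    (f := G) (fun x hx => ((hG x (hsub hx)).differentiableAt
      (by simp)).hasDerivAt.hasDerivWithinAt)
    (fun x hx => (h1 x (hsub hx)).trans (mul_le_mul_of_nonneg_left
      (abs_sub_left_of_mem_uIcc hx) hM0)) left_mem_uIcc right_mem_uIcc
  rw [Real.norm_eq_abs, Real.norm_eq_abs, mul_assoc, abs_mul_abs_self] at this
  linarith [this, sq (s - p)]

namespace MiddleSphere

variable (S : MiddleSphere)

lemma lower_neg : S.lower < 0 := by linarith [S.lower_le, S.band_pos]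

lemma upper_pos : 0 < S.upper := by linarith [S.le_upper, S.band_pos]

lemma Icc_subset : Icc S.lower S.upper ⊆ Ioo S.domLow S.domHigh :=
  Icc_subset_Ioo S.domLow_lt S.lt_domHigh

lemma Ioo_subset : Ioo S.lower S.upper ⊆ Ioo S.domLow S.domHigh :=
  Ioo_subset_Icc_self.trans S.Icc_subset

lemma contDiffAt_R {s : ℝ} (hs : s ∈ Ioo S.domLow S.domHigh) : ContDiffAt ℝ ∞ S.R s :=
  S.contDiffOn.contDiffAt (isOpen_Ioo.mem_nhds hs)

lemma hasDerivAt_R {s : ℝ} (hs : s ∈ Ioo S.domLow S.domHigh) : HasDerivAt S.R (deriv S.R s) s :=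
  ((S.contDiffAt_R hs).differentiableAt (by simp)).hasDerivAt

lemma neckRadius_pos : 0 < S.neckRadius := by
  rw [← S.upper_neck.1]
  exact S.pos _ (S.Icc_subset ⟨(S.lower_neg.trans S.upper_pos).le, le_rfl⟩)

lemma R_pos {s : ℝ} (hs : s ∈ Ioo S.lower S.upper) : 0 < S.R s := S.pos s (S.Ioo_subset hs)

/-- The normal component `√(R² - R₀²)` of the rotation field along the limiting geodesics. -/
def jacobi (s : ℝ) : ℝ := √(S.R s ^ 2 - S.neckRadius ^ 2)

lemma sq_sub_sq_pos {s : ℝ} (hs : s ∈ Ioo S.lower S.upper) :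
    0 < S.R s ^ 2 - S.neckRadius ^ 2 :=
  sub_pos.2 (pow_lt_pow_left₀ (S.neck_lt s hs) S.neckRadius_pos.le two_ne_zero)

lemma jacobi_pos {s : ℝ} (hs : s ∈ Ioo S.lower S.upper) : 0 < S.jacobi s :=
  Real.sqrt_pos.2 (S.sq_sub_sq_pos hs)

lemma jacobi_sq {s : ℝ} (hs : s ∈ Ioo S.lower S.upper) :
    S.jacobi s ^ 2 = S.R s ^ 2 - S.neckRadius ^ 2 :=
  Real.sq_sqrt (S.sq_sub_sq_pos hs).le

lemma hasDerivAt_jacobi {s : ℝ} (hs : s ∈ Ioo S.lower S.upper) :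
    HasDerivAt S.jacobi (S.R s * deriv S.R s / S.jacobi s) s := by
  have h := (((S.hasDerivAt_R (S.Ioo_subset hs)).pow 2).sub_const (S.neckRadius ^ 2)).sqrt
    (S.sq_sub_sq_pos hs).ne'
  convert! h using 1
  have := (S.jacobi_pos hs).ne'
  rw [show √((S.R ^ 2) s - S.neckRadius ^ 2) = S.jacobi s from rfl]
  field_simp
  simp
  ring

lemma contDiffOn_jacobi : ContDiffOn ℝ ∞ S.jacobi (Ioo S.lower S.upper) :=
  ((S.contDiffOn.mono S.Ioo_subset).pow 2 |>.sub contDiffOn_const).sqrt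
    fun _ hs => (S.sq_sub_sq_pos hs).ne'

/-- The rotation field decays at least linearly towards the necks, which are critical points of
`R`. -/
lemma exists_jacobi_le : ∃ C, 0 ≤ C ∧ ∀ s ∈ Ioo S.lower S.upper,
    S.jacobi s ≤ C * (S.upper - s) ∧ S.jacobi s ≤ C * (s - S.lower) := by
  have hG : ∀ s ∈ Icc S.lower S.upper, ContDiffAt ℝ ∞ (fun s => S.R s ^ 2) s :=
    fun s hs => (S.contDiffAt_R (S.Icc_subset hs)).pow 2
  have hd : ∀ s ∈ Icc S.lower S.upper, deriv S.R s = 0 → deriv (fun s => S.R s ^ 2) s = 0 :=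
    fun s hs h0 => by
      have : HasDerivAt (fun s => S.R s ^ 2) _ s := (S.hasDerivAt_R (S.Icc_subset hs)).pow 2
      rw [this.deriv, h0, mul_zero]
  have hlu := (S.lower_neg.trans S.upper_pos).le
  have key : ∀ p ∈ Icc S.lower S.upper, S.R p = S.neckRadius → deriv S.R p = 0 →
      ∃ C, 0 ≤ C ∧ ∀ s ∈ Ioo S.lower S.upper, S.jacobi s ≤ C * |s - p| := by
    intro p hp hRp h0
    obtain ⟨M, hM0, hM⟩ := exists_abs_sub_le_sq hp hG (hd p hp h0)
    refine ⟨√M, Real.sqrt_nonneg _, fun s hs => ?_⟩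
    rw [← Real.sqrt_sq_eq_abs, ← Real.sqrt_mul hM0]
    refine Real.sqrt_le_sqrt ?_
    have := hM s (Ioo_subset_Icc_self hs)
    rw [hRp] at this
    exact (le_abs_self _).trans this
  obtain ⟨C, hC0, hC⟩ := key S.upper ⟨hlu, le_rfl⟩ S.upper_neck.1 S.upper_neck.2.1
  obtain ⟨D, hD0, hD⟩ := key S.lower ⟨le_rfl, hlu⟩ S.lower_neck.1 S.lower_neck.2.1
  refine ⟨max C D, le_max_of_le_left hC0, fun s hs => ⟨?_, ?_⟩⟩
  · have h := hC s hs
    rw [abs_sub_comm, abs_of_pos (sub_pos.2 hs.2)] at h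
    exact h.trans (mul_le_mul_of_nonneg_right (le_max_left _ _) (sub_pos.2 hs.2).le)
  · have h := hD s hs
    rw [abs_of_pos (sub_pos.2 hs.1)] at h
    exact h.trans (mul_le_mul_of_nonneg_right (le_max_right _ _) (sub_pos.2 hs.1).le)

lemma exists_R_le : ∃ K, 0 ≤ K ∧ ∀ s ∈ Icc S.lower S.upper, S.R s ≤ K := by
  obtain ⟨K, hK⟩ := isCompact_Icc.exists_bound_of_continuousOn (s := Icc S.lower S.upper)
    (f := S.R) fun s hs => (S.contDiffAt_R (S.Icc_subset hs)).continuousAt.continuousWithinAt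
  have hlu := (S.lower_neg.trans S.upper_pos).le
  exact ⟨K, (norm_nonneg _).trans (hK _ ⟨le_rfl, hlu⟩), fun s hs => (le_abs_self _).trans (hK s hs)⟩

lemma isSpeed_mul_jacobi {m : ℝ → ℝ} {K : ℝ} (hm : ContDiffOn ℝ ∞ m (Ioo S.lower S.upper))
    (hpos : ∀ s ∈ Ioo S.lower S.upper, 0 < m s) (hK : ∀ s ∈ Ioo S.lower S.upper, m s ≤ K) :
    IsSpeed (fun s => m s * S.jacobi s) S.lower S.upper := by
  obtain ⟨C, hC0, hC⟩ := S.exists_jacobi_le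
  refine ⟨S.lower_neg, S.upper_pos, hm.mul S.contDiffOn_jacobi,
    fun s hs => mul_pos (hpos s hs) (S.jacobi_pos hs), K * C, fun s hs => ?_⟩
  have hK0 := (hpos s hs).le.trans (hK s hs)
  constructor <;> rw [mul_assoc]
  · exact mul_le_mul (hK s hs) (hC s hs).1 (S.jacobi_pos hs).le hK0
  · exact mul_le_mul (hK s hs) (hC s hs).2 (S.jacobi_pos hs).le hK0

/-- The reciprocal of the slope `dθ/ds` of the limiting geodesics. -/
def windingSpeed (s : ℝ) : ℝ := S.R s / S.neckRadius * S.jacobi s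

lemma isSpeed_windingSpeed : IsSpeed S.windingSpeed S.lower S.upper := by
  obtain ⟨K, -, hK⟩ := S.exists_R_le
  exact S.isSpeed_mul_jacobi ((S.contDiffOn.mono S.Ioo_subset).div_const _)
    (fun s hs => div_pos (S.R_pos hs) S.neckRadius_pos)
    fun s hs => div_le_div_of_nonneg_right (hK s (Ioo_subset_Icc_self hs)) S.neckRadius_pos.le

/-- The angle swept by a limiting geodesic between the equator and the parallel at `s`. -/
def winding : ℝ → ℝ := travelTime S.windingSpeed

/-- The inverse function of `winding`. -/
def unwinding : ℝ → ℝ := travel S.windingSpeed S.lower S.upper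

lemma hasDerivAt_winding {s : ℝ} (hs : s ∈ Ioo S.lower S.upper) :
    HasDerivAt S.winding (S.neckRadius / (S.R s * S.jacobi s)) s := by
  convert! S.isSpeed_windingSpeed.hasDerivAt_travelTime hs using 1
  rw [windingSpeed, div_mul_eq_mul_div, inv_div]

lemma continuousAt_winding {s : ℝ} (hs : s ∈ Ioo S.lower S.upper) : ContinuousAt S.winding s :=
  (S.hasDerivAt_winding hs).continuousAt

lemma winding_zero : S.winding 0 = 0 := IsSpeed.travelTime_zero _

/-- The leaf with angle `a` at the equator, parameterized by `s`. -/
def leaf (a s : ℝ) : Plane := !₂[s, a + S.winding s]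

@[simp] lemma leaf_zero (a s : ℝ) : S.leaf a s 0 = s := rfl

@[simp] lemma leaf_one (a s : ℝ) : S.leaf a s 1 = a + S.winding s := rfl

lemma leaf_mem_domain (a : ℝ) {s : ℝ} (hs : s ∈ Ioo S.lower S.upper) : S.leaf a s ∈ S.domain :=
  S.Ioo_subset hs

lemma continuous_leaf (s : ℝ) : Continuous fun a => S.leaf a s :=
  continuous_toPlane continuous_const (by fun_prop)

/-- The angle at the equator of the leaf through `q`. -/
def leafAngle (q : Plane) : ℝ := q 1 - S.winding (q 0)

lemma leaf_leafAngle (q : Plane) : S.leaf (S.leafAngle q) (q 0) = q := by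
  ext i
  fin_cases i <;> simp [leafAngle]

lemma continuousAt_leafAngle {q : Plane} (hq : q 0 ∈ Ioo S.lower S.upper) :
    ContinuousAt S.leafAngle q :=
  (contDiff_coord 1 (n := 0)).continuous.continuousAt.sub (ContinuousAt.comp'
    (S.continuousAt_winding hq) (contDiff_coord 0 (n := 0)).continuous.continuousAt)

lemma contDiffOn_leaf (a : ℝ) : ContDiffOn ℝ ∞ (S.leaf a) (Ioo S.lower S.upper) := by
  refine contDiffOn_euclidean.2 fun i => ?_
  fin_cases i
  · exact contDiffOn_id
  · exact contDiffOn_const.add S.isSpeed_windingSpeed.contDiffOn_travelTime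

/-- The conformal factor `e ^ (2 w)` is smooth and at least `1` along the leaf with angle `a`, and
its derivative normal to the leaf vanishes. -/
structure IsAdapted (w : Plane → ℝ) (a : ℝ) : Prop where
  contDiffAt : ∀ s ∈ Ioo S.lower S.upper, ContDiffAt ℝ ∞ w (S.leaf a s)
  nonneg : ∀ s ∈ Ioo S.lower S.upper, 0 ≤ w (S.leaf a s)
  normal : ∀ s ∈ Ioo S.lower S.upper, S.jacobi s * partialD 1 w (S.leaf a s) =
    S.R s * S.neckRadius * partialD 0 w (S.leaf a s)

lemma isAdapted_zero (a : ℝ) : S.IsAdapted (fun _ => 0) a :=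
  ⟨fun _ _ => contDiffAt_const, fun _ _ => le_rfl, fun s _ => by simp [partialD_const]⟩

/-- The speed `ds/dt` on the leaf with angle `a`, where `t` is the arclength of the metric
`e ^ (2 w) (ds² + R(s)² dθ²)`. -/
def leafSpeed (w : Plane → ℝ) (a s : ℝ) : ℝ :=
  Real.exp (-w (S.leaf a s)) / S.R s * S.jacobi s

/-- The parameter `s` on the leaf as a function of the arclength of
`e ^ (2 w) (ds² + R(s)² dθ²)`. -/
def leafParam (w : Plane → ℝ) (a : ℝ) : ℝ → ℝ := travel (S.leafSpeed w a) S.lower S.upper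

/-- The leaf with angle `a` at the equator, parameterized by the arclength of
`e ^ (2 w) (ds² + R(s)² dθ²)`. -/
def leafCurve (w : Plane → ℝ) (a t : ℝ) : Plane := S.leaf a (S.leafParam w a t)

variable {S} {w : Plane → ℝ} {a : ℝ}

namespace IsAdapted

lemma isSpeed (hw : S.IsAdapted w a) : IsSpeed (S.leafSpeed w a) S.lower S.upper := by
  refine S.isSpeed_mul_jacobi (m := fun s => Real.exp (-w (S.leaf a s)) / S.R s)
    (K := 1 / S.neckRadius) ?_ ?_ fun s hs => ?_
  · refine ContDiffOn.div ?_ (S.contDiffOn.mono S.Ioo_subset) fun s hs => (S.R_pos hs).ne'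
    exact ContDiffOn.exp (ContDiffOn.neg fun s hs =>
      (hw.contDiffAt s hs).comp_contDiffWithinAt s (S.contDiffOn_leaf a s hs))
  · exact fun s hs => div_pos (Real.exp_pos _) (S.R_pos hs)
  · exact div_le_div₀ zero_le_one (Real.exp_le_one_iff.2 (neg_nonpos.2 (hw.nonneg s hs)))
      S.neckRadius_pos (S.neck_lt s hs).le

lemma mem (hw : S.IsAdapted w a) (t : ℝ) : S.leafParam w a t ∈ Ioo S.lower S.upper :=
  hw.isSpeed.travel_mem t

lemma hasDerivAt_param (hw : S.IsAdapted w a) (t : ℝ) :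
    HasDerivAt (S.leafParam w a) (S.leafSpeed w a (S.leafParam w a t)) t :=
  hw.isSpeed.hasDerivAt_travel t

lemma contDiff_leafCurve (hw : S.IsAdapted w a) : ContDiff ℝ ∞ (S.leafCurve w a) :=
  (S.contDiffOn_leaf a).comp_contDiff hw.isSpeed.contDiff_travel hw.mem

lemma strictMono_param (hw : S.IsAdapted w a) : StrictMono (S.leafParam w a) :=
  hw.isSpeed.strictMono_travel

lemma range_param (hw : S.IsAdapted w a) : range (S.leafParam w a) = Ioo S.lower S.upper :=
  Subset.antisymm (range_subset_iff.2 hw.mem) fun _ hs => ⟨_, hw.isSpeed.travel_travelTime hs⟩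

lemma range_leafCurve (hw : S.IsAdapted w a) :
    range (S.leafCurve w a) = S.leaf a '' Ioo S.lower S.upper := by
  rw [← hw.range_param, ← range_comp]; rfl

/-- The derivative of the conformal exponent along the leaf. -/
lemma hasDerivAt_exponent (hw : S.IsAdapted w a) {s : ℝ} (hs : s ∈ Ioo S.lower S.upper) :
    HasDerivAt (fun s => w (S.leaf a s))
      (partialD 0 w (S.leaf a s) * S.R s ^ 2 / S.jacobi s ^ 2) s := by
  have h := hasDerivAt_comp_curve (c := S.leaf a) ((hw.contDiffAt s hs).differentiableAt (by simp))
    (hasDerivAt_id s) ((S.hasDerivAt_winding hs).const_add a)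
  convert! h using 1
  have hJ := (S.jacobi_pos hs).ne'
  have hR := (S.R_pos hs).ne'
  have hn := hw.normal s hs
  field_simp
  linear_combination (-(partialD 0 w (S.leaf a s) * S.R s)) * S.jacobi_sq hs - S.neckRadius * hn

lemma hasDerivAt_leafSpeed (hw : S.IsAdapted w a) {s : ℝ} (hs : s ∈ Ioo S.lower S.upper) :
    HasDerivAt (S.leafSpeed w a) (Real.exp (-w (S.leaf a s)) *
      (-(partialD 0 w (S.leaf a s) * S.R s) / S.jacobi s
        + deriv S.R s / S.jacobi s - deriv S.R s * S.jacobi s / S.R s ^ 2)) s := by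
  have h := ((hw.hasDerivAt_exponent hs).neg.exp.div (S.hasDerivAt_R (S.Ioo_subset hs))
    (S.R_pos hs).ne').mul (S.hasDerivAt_jacobi hs)
  convert! h using 1
  have hJ := (S.jacobi_pos hs).ne'
  have hR := (S.R_pos hs).ne'
  simp only [Pi.div_apply, Pi.neg_apply]
  field_simp
  ring

lemma hasDerivAt_angle (hw : S.IsAdapted w a) (t : ℝ) :
    HasDerivAt (fun τ => S.leafCurve w a τ 1) (Real.exp (-w (S.leaf a (S.leafParam w a t)))
      * S.neckRadius / S.R (S.leafParam w a t) ^ 2) t := by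
  have hs := hw.mem t
  have h := ((S.hasDerivAt_winding hs).comp t (hw.hasDerivAt_param t)).const_add a
  convert! h using 1
  have hJ := (S.jacobi_pos hs).ne'
  have hR := (S.R_pos hs).ne'
  rw [leafSpeed]
  field_simp

/-- The leaf, parameterized by arclength, is a geodesic. -/
lemma geodesicEqAt (hw : S.IsAdapted w a) (t : ℝ) :
    GeodesicEqAt (conformalMetric S.R w) (S.leafCurve w a) t := by
  have hx := hw.hasDerivAt_param
  have hy := hw.hasDerivAt_angle
  have hs := hw.mem t
  have hJ := (S.jacobi_pos hs).ne'
  have hR := (S.R_pos hs).ne'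
  have hx' := (hw.hasDerivAt_leafSpeed hs).comp t (hx t)
  have hy' := HasDerivAt.comp t (((hw.hasDerivAt_exponent hs).neg.exp.mul_const S.neckRadius).div
    ((S.hasDerivAt_R (S.Ioo_subset hs)).pow 2) (pow_ne_zero 2 hR)) (hx t)
  have hn := hw.normal _ hs
  have hJ2 := S.jacobi_sq hs
  refine geodesicEqAt_conformalMetric (hw.contDiff_leafCurve.contDiffAt)
    ((hw.contDiffAt _ hs).differentiableAt (by simp))
    ((S.contDiffAt_R (S.Ioo_subset hs)).differentiableAt (by simp)) hR hx hy hx' hy' ?_ ?_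
  all_goals
    simp only [leafCurve, leaf_zero, leafSpeed, Pi.neg_apply, Pi.pow_apply]
    set s := S.leafParam w a t
    have hn' : partialD 1 w (S.leaf a s) =
        S.R s * S.neckRadius * partialD 0 w (S.leaf a s) / S.jacobi s := by
      rw [← hn]; field_simp
    rw [hn']
    field_simp
    have hR0 : S.neckRadius ^ 2 = S.R s ^ 2 - S.jacobi s ^ 2 := by linarith
    simp only [hR0]
    ring

end IsAdapted

end MiddleSphere

/-! ### Limiting geodesics and parallels -/

namespace MiddleSphere

variable {S : MiddleSphere} {w : Plane → ℝ} {a : ℝ}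

namespace IsAdapted

lemma unit_speed (hw : S.IsAdapted w a) (t : ℝ) :
    Real.exp (2 * w (S.leafCurve w a t)) * (deriv (fun τ => S.leafCurve w a τ 0) t ^ 2
      + S.R (S.leafCurve w a t 0) ^ 2 * deriv (fun τ => S.leafCurve w a τ 1) t ^ 2) = 1 := by
  have hs := hw.mem t
  have hR := (S.R_pos hs).ne'
  have hx : deriv (fun τ => S.leafCurve w a τ 0) t = S.leafSpeed w a (S.leafParam w a t) :=
    (hw.hasDerivAt_param t).deriv
  rw [hx, (hw.hasDerivAt_angle t).deriv, leafSpeed, leafCurve, leaf_zero, Real.exp_neg, two_mul,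
    Real.exp_add]
  have hE := (Real.exp_pos (w (S.leaf a (S.leafParam w a t)))).ne'
  field_simp
  linear_combination S.jacobi_sq hs

end IsAdapted

variable (S)

lemma R_zero : S.R 0 = S.sphereRadius := by
  simpa using S.round 0 (by simpa using S.band_pos)

lemma zero_mem : (0 : ℝ) ∈ Ioo S.lower S.upper := ⟨S.lower_neg, S.upper_pos⟩

lemma conformalMetric_zero : conformalMetric S.R (fun _ => 0) = S.metric := by
  ext q i j
  simp [conformalMetric, metric]

/-- The limiting geodesic of the unperturbed metric through the point of the equator with angular
coordinate `a`. -/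
def limitingGeodesic (a : ℝ) : ℝ → Plane := S.leafCurve (fun _ => 0) a

lemma leafCurve_zero (hw : S.IsAdapted w a) : S.leafCurve w a 0 = S.leaf a 0 := by
  rw [leafCurve, leafParam, hw.isSpeed.travel_zero]

lemma isLimitingGeodesic (a : ℝ) : S.IsLimitingGeodesic a (S.limitingGeodesic a) := by
  have hw := S.isAdapted_zero a
  have h0 : S.leafParam (fun _ => 0) a 0 = 0 := hw.isSpeed.travel_zero
  have hr := S.sphereRadius_pos
  have hn := S.neckRadius_pos
  have hlt : S.neckRadius < S.sphereRadius := S.R_zero ▸ S.neck_lt 0 S.zero_mem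
  refine ⟨fun t => S.leaf_mem_domain a (hw.mem t), fun t => ?_, ?_, ?_, ?_, ?_,
    hw.isSpeed.tendsto_travel_atTop, hw.isSpeed.tendsto_travel_atBot, ?_, ?_⟩
  · rw [← conformalMetric_zero]
    exact hw.geodesicEqAt t
  · rw [limitingGeodesic, S.leafCurve_zero hw, leaf_zero]
  · rw [limitingGeodesic, S.leafCurve_zero hw, leaf_one, winding_zero, add_zero]
  · refine (hw.hasDerivAt_param 0).deriv.trans ?_
    rw [h0, leafSpeed, jacobi, R_zero, criticalAngle, Real.cos_arcsin]
    rw [neg_zero, Real.exp_zero, show 1 - (S.neckRadius / S.sphereRadius) ^ 2 =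
      (S.sphereRadius ^ 2 - S.neckRadius ^ 2) / S.sphereRadius ^ 2 by field_simp,
      Real.sqrt_div' _ (sq_nonneg _), Real.sqrt_sq hr.le]
    ring
  · refine (hw.hasDerivAt_angle 0).deriv.trans ?_
    rw [h0, R_zero, criticalAngle, Real.sin_arcsin (by linarith [div_pos hn hr])
      ((div_le_one hr).2 hlt.le)]
    simp
    field_simp
  · exact tendsto_atTop_add_const_left _ _
      (S.isSpeed_windingSpeed.tendsto_travelTime_comp_atTop hw.mem hw.isSpeed.tendsto_travel_atTop)
  · exact tendsto_atBot_add_const_left _ _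
      (S.isSpeed_windingSpeed.tendsto_travelTime_comp_atBot hw.mem hw.isSpeed.tendsto_travel_atBot)

/-- The parallel at `p`, with the parameterization that has unit speed for the neck radius. -/
def parallel (p t : ℝ) : Plane := !₂[p, t / S.neckRadius]

lemma contDiff_parallel (p : ℝ) : ContDiff ℝ ∞ (S.parallel p) := by
  refine contDiff_euclidean.2 fun i => ?_
  fin_cases i
  · exact contDiff_const
  · exact contDiff_id.div_const _

/-- The necks are geodesics: the derivative of `R` vanishes there. -/
lemma geodesicEqAt_parallel {p : ℝ} (hR : DifferentiableAt ℝ S.R p) (hp : S.R p = S.neckRadius)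
    (hp' : deriv S.R p = 0) {t : ℝ} (hw : DifferentiableAt ℝ w (S.parallel p t))
    (hdw : ∀ k, partialD k w (S.parallel p t) = 0) :
    GeodesicEqAt (conformalMetric S.R w) (S.parallel p) t := by
  refine geodesicEqAt_conformalMetric (x := fun _ => 0) (y := fun _ => 1 / S.neckRadius)
    (S.contDiff_parallel p).contDiffAt hw hR (hp ▸ S.neckRadius_pos.ne')
    (fun τ => hasDerivAt_const τ p) (fun τ => (hasDerivAt_id τ).div_const _)
    (hasDerivAt_const t _) (hasDerivAt_const t _) ?_ ?_
  · rw [hdw, hdw, show S.parallel p t 0 = p from rfl, hp']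
    ring
  · rw [hdw, hdw]
    ring

/-! ### The second variation along a leaf -/

variable {S}

/-- The rotation field along a leaf, rescaled to unit normal length for the metric
`e ^ (2 w) (ds² + R(s)² dθ²)`: the trial function for the second variation. -/
def trialField (S : MiddleSphere) (w : Plane → ℝ) (a t : ℝ) : ℝ :=
  Real.exp (w (S.leafCurve w a t)) * S.jacobi (S.leafParam w a t)

/-- The Gaussian curvature along a leaf. -/
def leafCurvature (S : MiddleSphere) (w : Plane → ℝ) (a t : ℝ) : ℝ :=
  coordGaussCurvature (conformalMetric S.R w) (S.leafCurve w a t)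

namespace IsAdapted

lemma contDiff_trialField (hw : S.IsAdapted w a) : ContDiff ℝ ∞ (S.trialField w a) := by
  refine ContDiff.mul (ContDiff.exp (contDiff_iff_contDiffAt.2 fun t => ?_))
    (S.contDiffOn_jacobi.comp_contDiff hw.isSpeed.contDiff_travel hw.mem)
  exact (hw.contDiffAt _ (hw.mem t)).comp t hw.contDiff_leafCurve.contDiffAt

lemma trialField_pos (hw : S.IsAdapted w a) (t : ℝ) : 0 < S.trialField w a t :=
  mul_pos (Real.exp_pos _) (S.jacobi_pos (hw.mem t))

lemma hasDerivAt_trialField (hw : S.IsAdapted w a) (t : ℝ) :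
    HasDerivAt (S.trialField w a) (deriv S.R (S.leafParam w a t)
      + S.R (S.leafParam w a t) * partialD 0 w (S.leafCurve w a t)) t := by
  have hs := hw.mem t
  have h := HasDerivAt.comp t ((hw.hasDerivAt_exponent hs).exp.mul (S.hasDerivAt_jacobi hs))
    (hw.hasDerivAt_param t)
  convert! h using 1
  have hJ := (S.jacobi_pos hs).ne'
  have hR := (S.R_pos hs).ne'
  rw [leafSpeed, leafCurve, Real.exp_neg]
  have hE := (Real.exp_pos (w (S.leaf a (S.leafParam w a t)))).ne'
  field_simp
  ring

lemma continuous_leafCurvature (hw : S.IsAdapted w a) : Continuous (S.leafCurvature w a) := by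
  have h : S.leafCurvature w a = fun t => _ := funext fun t =>
    coordGaussCurvature_conformalMetric (hw.contDiffAt _ (hw.mem t))
      (S.contDiffAt_R (S.Ioo_subset (hw.mem t))) (S.R_pos (hw.mem t)).ne'
  rw [h]
  have hp : Continuous (S.leafParam w a) := hw.isSpeed.continuous_travel
  have hc := hw.contDiff_leafCurve.continuous
  have cR : Continuous fun t => S.R (S.leafParam w a t) := continuous_iff_continuousAt.2 fun t =>
    ContinuousAt.comp' (S.contDiffAt_R (S.Ioo_subset (hw.mem t))).continuousAt hp.continuousAt
  have cR1 : Continuous fun t => deriv S.R (S.leafParam w a t) :=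
    continuous_iff_continuousAt.2 fun t => ContinuousAt.comp'
      (S.contDiffAt_R (S.Ioo_subset (hw.mem t))).deriv_infty.continuousAt hp.continuousAt
  have cR2 : Continuous fun t => deriv (deriv S.R) (S.leafParam w a t) :=
    continuous_iff_continuousAt.2 fun t => ContinuousAt.comp'
      (S.contDiffAt_R (S.Ioo_subset (hw.mem t))).deriv_infty.deriv_infty.continuousAt
      hp.continuousAt
  have cw : Continuous fun t => w (S.leafCurve w a t) := continuous_iff_continuousAt.2 fun t =>
    ContinuousAt.comp' (hw.contDiffAt _ (hw.mem t)).continuousAt hc.continuousAt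
  have cw1 : Continuous fun t => partialD 0 w (S.leafCurve w a t) :=
    continuous_iff_continuousAt.2 fun t => ContinuousAt.comp'
      ((hw.contDiffAt _ (hw.mem t)).partialD 0).continuousAt hc.continuousAt
  have cw2 : ∀ k, Continuous fun t => partialD k (partialD k w) (S.leafCurve w a t) := fun k =>
    continuous_iff_continuousAt.2 fun t => ContinuousAt.comp'
      (((hw.contDiffAt _ (hw.mem t)).partialD k).partialD k).continuousAt hc.continuousAt
  have hR0 : ∀ t, S.R (S.leafParam w a t) ≠ 0 := fun t => (S.R_pos (hw.mem t)).ne'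
  have c0 : ∀ t, S.leafCurve w a t 0 = S.leafParam w a t := fun t => rfl
  simp only [c0]
  exact ((cw.const_mul 2).neg.rexp).mul (((cR2.div cR hR0).neg).sub
    (((cw2 0).add ((cR1.div cR hR0).mul cw1)).add ((cw2 1).div (cR.pow 2)
      fun t => pow_ne_zero 2 (hR0 t))))

/-- The Jacobi operator on the trial function. -/
lemma jacobi_operator_trialField (hw : S.IsAdapted w a) (t : ℝ) :
    deriv (deriv (S.trialField w a)) t + S.leafCurvature w a t * S.trialField w a t =
      Real.exp (-w (S.leafCurve w a t)) / S.R (S.leafParam w a t) *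
        (S.neckRadius * partialD 1 (partialD 0 w) (S.leafCurve w a t)
          - S.jacobi (S.leafParam w a t) / S.R (S.leafParam w a t)
            * partialD 1 (partialD 1 w) (S.leafCurve w a t)) := by
  have hs := hw.mem t
  have hcw := hw.contDiffAt _ hs
  have hJ := (S.jacobi_pos hs).ne'
  have hR := (S.R_pos hs).ne'
  have hp := hasDerivAt_comp_curve (F := partialD 0 w) (c := S.leafCurve w a)
    ((hcw.partialD 0).differentiableAt (by simp)) (hw.hasDerivAt_param t) (hw.hasDerivAt_angle t)
  have hcR := S.contDiffAt_R (S.Ioo_subset hs)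
  have h := HasDerivAt.add
    (HasDerivAt.comp t (hcR.deriv_infty.differentiableAt (by simp)).hasDerivAt
      (hw.hasDerivAt_param t))
    (HasDerivAt.mul (HasDerivAt.comp t (S.hasDerivAt_R (S.Ioo_subset hs))
      (hw.hasDerivAt_param t)) hp)
  rw [show deriv (deriv (S.trialField w a)) t = _ from (congrArg (fun F : ℝ → ℝ => deriv F t)
    (funext fun t => (hw.hasDerivAt_trialField t).deriv)).trans h.deriv, leafCurvature, leafCurve,
    coordGaussCurvature_conformalMetric hcw hcR hR]
  simp only [leafCurve, leaf_zero, trialField, leafSpeed, Function.comp_apply, Real.exp_neg,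
    two_mul, Real.exp_add]
  have hE := (Real.exp_pos (w (S.leaf a (S.leafParam w a t)))).ne'
  field_simp
  ring

end IsAdapted

end MiddleSphere

/-! ### The round band around the equator -/

namespace MiddleSphere

variable (S : MiddleSphere)

lemma mem_of_abs_lt_band {s : ℝ} (hs : |s| < S.band) : s ∈ Ioo S.lower S.upper :=
  ⟨S.lower_le.trans_lt (abs_lt.1 hs).1, (abs_lt.1 hs).2.trans_le S.le_upper⟩

/-- The round band lies within the open hemispheres, since `R` is positive. -/
lemma band_le : S.band ≤ S.sphereRadius * (Real.pi / 2) := by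
  by_contra! h
  have hr := S.sphereRadius_pos
  have h0 : |S.sphereRadius * (Real.pi / 2)| < S.band := by
    rwa [abs_of_pos (by positivity)]
  have hR := S.R_pos (S.mem_of_abs_lt_band h0)
  rw [S.round _ h0, mul_div_cancel_left₀ _ hr.ne', Real.cos_pi_div_two, mul_zero] at hR
  exact hR.false

lemma cos_pos {s : ℝ} (hs : |s| < S.band) : 0 < Real.cos (s / S.sphereRadius) := by
  have hR := S.R_pos (S.mem_of_abs_lt_band hs)
  rw [S.round s hs] at hR
  exact pos_of_mul_pos_right hR S.sphereRadius_pos.le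

lemma isOpen_band : IsOpen {s : ℝ | |s| < S.band} := isOpen_lt continuous_abs continuous_const

lemma deriv_R_band {s : ℝ} (hs : |s| < S.band) :
    deriv S.R s = -Real.sin (s / S.sphereRadius) := by
  have h : S.R =ᶠ[𝓝 s] fun s => S.sphereRadius * Real.cos (s / S.sphereRadius) := by
    filter_upwards [S.isOpen_band.mem_nhds hs] with x hx using S.round x hx
  have hr := S.sphereRadius_pos.ne'
  have h' : HasDerivAt (fun s => S.sphereRadius * Real.cos (s / S.sphereRadius)) _ s :=
    ((hasDerivAt_id s).div_const S.sphereRadius).cos.const_mul S.sphereRadius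
  rw [h.deriv_eq, h'.deriv]
  simp only [id]
  field_simp

lemma jacobi_zero_sq : S.jacobi 0 ^ 2 = S.sphereRadius ^ 2 - S.neckRadius ^ 2 := by
  rw [S.jacobi_sq S.zero_mem, R_zero]

/-- In the round band the leaves are great circles. -/
lemma winding_band {s : ℝ} (hs : |s| < S.band) : S.winding s =
    Real.arctan (S.neckRadius * Real.sin (s / S.sphereRadius) / S.jacobi s) := by
  have hconn : IsPreconnected {s : ℝ | |s| < S.band} := by
    simp only [abs_lt]; exact isPreconnected_Ioo
  have hd : ∀ s : ℝ, |s| < S.band → HasDerivAt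
      (fun s => Real.arctan (S.neckRadius * Real.sin (s / S.sphereRadius) / S.jacobi s))
      (S.neckRadius / (S.R s * S.jacobi s)) s := fun s hs => by
    have hm := S.mem_of_abs_lt_band hs
    have hJ := (S.jacobi_pos hm).ne'
    have hr := S.sphereRadius_pos.ne'
    have h := ((((hasDerivAt_id s).div_const S.sphereRadius).sin.const_mul S.neckRadius).div
      (S.hasDerivAt_jacobi hm) hJ).arctan
    convert! h using 1
    have hJ2 := S.jacobi_sq hm
    rw [S.deriv_R_band hs]
    rw [S.round s hs] at hJ2 ⊢
    have hc := (S.cos_pos hs).ne'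
    simp only [id, Pi.div_apply]
    have h1 : S.jacobi s ^ 2 + S.neckRadius ^ 2 * Real.sin (s / S.sphereRadius) ^ 2 ≠ 0 := by
      have := S.jacobi_pos hm; positivity
    have h2 : 1 + (S.neckRadius * Real.sin (s / S.sphereRadius) / S.jacobi s) ^ 2 ≠ 0 := by
      positivity
    field_simp
    rw [hJ2, Real.sin_sq]
    ring
  refine S.isOpen_band.eqOn_of_deriv_eq hconn
    (fun s hs => (S.hasDerivAt_winding (S.mem_of_abs_lt_band
      hs)).differentiableAt.differentiableWithinAt)
    (fun s hs => (hd s hs).differentiableAt.differentiableWithinAt) (fun s hs => ?_)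
    (x := 0) (by simpa using S.band_pos) (by simp [winding_zero]) hs
  rw [(S.hasDerivAt_winding (S.mem_of_abs_lt_band hs)).deriv, (hd s hs).deriv]

lemma cos_mul_cos_winding {s : ℝ} (hs : |s| < S.band) :
    Real.cos (s / S.sphereRadius) * Real.cos (S.winding s) = S.jacobi s / S.jacobi 0 ∧
    Real.cos (s / S.sphereRadius) * Real.sin (S.winding s) =
      S.neckRadius / S.jacobi 0 * Real.sin (s / S.sphereRadius) := by
  have hm := S.mem_of_abs_lt_band hs
  have hJ := S.jacobi_pos hm
  have hJ0 := S.jacobi_pos S.zero_mem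
  have hc := S.cos_pos hs
  have hJ2 := S.jacobi_sq hm
  rw [S.round s hs] at hJ2
  have hsqrt : √(1 + (S.neckRadius * Real.sin (s / S.sphereRadius) / S.jacobi s) ^ 2) =
      Real.cos (s / S.sphereRadius) * S.jacobi 0 / S.jacobi s := by
    rw [Real.sqrt_eq_iff_mul_self_eq (by positivity) (by positivity)]
    field_simp
    rw [S.jacobi_zero_sq]
    linear_combination hJ2 + S.neckRadius ^ 2 * Real.sin_sq_add_cos_sq (s / S.sphereRadius)
  rw [S.winding_band hs, Real.cos_arctan, Real.sin_arctan, hsqrt]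
  constructor <;> field_simp

/-- The cosine of the angular distance to the point of the equator with angular coordinate `θ₀`. -/
def cosDist (θ₀ : ℝ) (q : Plane) : ℝ :=
  Real.cos (q 0 / S.sphereRadius) * Real.cos (q 1 - θ₀)

lemma sphereDist_eq (θ₀ : ℝ) (q : Plane) :
    S.sphereDist θ₀ q = S.sphereRadius * Real.arccos (S.cosDist θ₀ q) := rfl

lemma contDiff_cosDist (θ₀ : ℝ) : ContDiff ℝ ∞ (S.cosDist θ₀) :=
  (((contDiff_coord 0).div_const _).cos).mul (((contDiff_coord 1).sub contDiff_const).cos)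

lemma continuous_sphereDist (θ₀ : ℝ) : Continuous (S.sphereDist θ₀) :=
  (Real.continuous_arccos.comp (S.contDiff_cosDist θ₀).continuous).const_mul _

lemma isOpen_disk (θ₀ δ : ℝ) : IsOpen (S.disk θ₀ δ) :=
  (S.isOpen_band.preimage (contDiff_coord 0 (n := 0)).continuous).inter
    (isOpen_lt (S.continuous_sphereDist θ₀) continuous_const)

lemma center_mem_disk (θ₀ : ℝ) (k : ℤ) {δ : ℝ} (hδ : 0 < δ) :
    S.leaf (θ₀ + k * (2 * Real.pi)) 0 ∈ S.disk θ₀ δ := by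
  refine ⟨by simpa using S.band_pos, ?_⟩
  rw [sphereDist_eq, cosDist, leaf_zero, leaf_one, winding_zero, zero_div, Real.cos_zero, add_zero,
    add_sub_cancel_left, Real.cos_int_mul_two_pi, one_mul, Real.arccos_one, mul_zero]
  exact hδ

lemma cosDist_leaf {θ₀ s : ℝ} (hs : |s| < S.band) :
    S.cosDist θ₀ (S.leaf θ₀ s) = S.jacobi s / S.jacobi 0 := by
  rw [cosDist, leaf_zero, leaf_one, add_sub_cancel_left, (S.cos_mul_cos_winding hs).1]

lemma cosDist_le_one (θ₀ : ℝ) (q : Plane) : S.cosDist θ₀ q ≤ 1 := by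
  refine (le_abs_self _).trans ?_
  rw [cosDist, abs_mul]
  exact mul_le_one₀ (Real.abs_cos_le_one _) (abs_nonneg _) (Real.abs_cos_le_one _)

lemma partialD_cosDist (θ₀ : ℝ) :
    (partialD 0 (S.cosDist θ₀) = fun q => -(Real.sin (q 0 / S.sphereRadius) / S.sphereRadius)
      * Real.cos (q 1 - θ₀)) ∧
    (partialD 1 (S.cosDist θ₀) = fun q => Real.cos (q 0 / S.sphereRadius)
      * -Real.sin (q 1 - θ₀)) := by
  have h := fun q : Plane => partialD_mul_coord
    (((hasDerivAt_id (q 0)).div_const S.sphereRadius).cos)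
    (((hasDerivAt_id (q 1)).sub_const θ₀).cos)
  constructor <;> ext q
  · refine (h q).1.trans ?_; simp only [id]; ring
  · refine (h q).2.trans ?_; simp only [id]; ring

lemma partialD_partialD_cosDist (θ₀ : ℝ) (q : Plane) :
    partialD 1 (partialD 0 (S.cosDist θ₀)) q =
      Real.sin (q 0 / S.sphereRadius) / S.sphereRadius * Real.sin (q 1 - θ₀) ∧
    partialD 1 (partialD 1 (S.cosDist θ₀)) q = -S.cosDist θ₀ q := by
  have h1 := (((hasDerivAt_id (q 0)).div_const S.sphereRadius).sin.div_const S.sphereRadius).neg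
  have h2 := ((hasDerivAt_id (q 1)).sub_const θ₀).cos
  have h3 := ((hasDerivAt_id (q 0)).div_const S.sphereRadius).cos
  have h4 := ((hasDerivAt_id (q 1)).sub_const θ₀).sin.neg
  rw [(S.partialD_cosDist θ₀).1, (S.partialD_cosDist θ₀).2]
  constructor
  · refine (partialD_mul_coord h1 h2).2.trans ?_; simp only [id, Pi.neg_apply]; ring
  · refine (partialD_mul_coord h3 h4).2.trans ?_; simp only [id, cosDist]; ring

/-- In the round band, the derivative of the distance to a point of a leaf in the direction normal
to that leaf vanishes along the leaf. -/
lemma cosDist_normal {θ₀ s : ℝ} (hs : |s| < S.band) :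
    S.jacobi s * partialD 1 (S.cosDist θ₀) (S.leaf θ₀ s) =
      S.R s * S.neckRadius * partialD 0 (S.cosDist θ₀) (S.leaf θ₀ s) := by
  have hJ0 := (S.jacobi_pos S.zero_mem).ne'
  have hr := S.sphereRadius_pos.ne'
  obtain ⟨h1, h2⟩ := S.cos_mul_cos_winding hs
  rw [(S.partialD_cosDist θ₀).1, (S.partialD_cosDist θ₀).2]
  simp only [leaf_zero, leaf_one, add_sub_cancel_left, S.round s hs]
  field_simp at h1 h2 ⊢
  refine mul_right_cancel₀ hJ0 ?_
  linear_combination (-S.jacobi s) * h2 + S.neckRadius * Real.sin (s / S.sphereRadius) * h1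

/-- The combination of second derivatives of `cosDist` that enters the Jacobi operator on the trial
function is positive along the leaf. -/
lemma cosDist_second {θ₀ s : ℝ} (hs : |s| < S.band) :
    S.neckRadius * partialD 1 (partialD 0 (S.cosDist θ₀)) (S.leaf θ₀ s)
      - S.jacobi s / S.R s * partialD 1 (partialD 1 (S.cosDist θ₀)) (S.leaf θ₀ s) =
    Real.cos (s / S.sphereRadius) * S.jacobi 0 / S.sphereRadius := by
  have hJ0 := (S.jacobi_pos S.zero_mem).ne'
  have hr := S.sphereRadius_pos.ne'
  have hc := (S.cos_pos hs).ne'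
  obtain ⟨h1, h2⟩ := S.cos_mul_cos_winding hs
  have hJ2 := S.jacobi_sq (S.mem_of_abs_lt_band hs)
  rw [S.round s hs] at hJ2
  have h3 : Real.sin (S.winding s) = S.neckRadius / S.jacobi 0 * Real.sin (s / S.sphereRadius)
    / Real.cos (s / S.sphereRadius) := by rw [← h2]; field_simp
  rw [(S.partialD_partialD_cosDist θ₀ _).1, (S.partialD_partialD_cosDist θ₀ _).2,
    S.cosDist_leaf hs]
  simp only [leaf_zero, leaf_one, add_sub_cancel_left, S.round s hs, h3]
  field_simp
  rw [hJ2, S.jacobi_zero_sq, Real.sin_sq]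
  ring

end MiddleSphere

/-! ### The bumps -/

namespace EquatorBumps

variable {S : MiddleSphere} (B : EquatorBumps S)

lemma f_nonneg {x : ℝ} (hx : 0 ≤ x) : 0 ≤ B.f x := by
  rw [← B.support (max x (1 / 2)) (le_max_right _ _)]
  exact B.antitone hx (hx.trans (le_max_left _ _)) (le_max_left _ _)

/-- The disk on which the bump number `i` lives. -/
def bumpDisk (i : ℕ) : Set Plane := S.disk (B.center i) (B.radius i / 2)

lemma isOpen_bumpDisk (i : ℕ) : IsOpen (B.bumpDisk i) := S.isOpen_disk _ _

lemma mem_of_mem_bumpDisk {q : Plane} {i : ℕ} (hq : q ∈ B.bumpDisk i) :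
    q 0 ∈ Ioo S.lower S.upper := S.mem_of_abs_lt_band hq.1

lemma center_mem (i : ℕ) (k : ℤ) :
    S.leaf (B.center i + k * (2 * Real.pi)) 0 ∈ B.bumpDisk i :=
  S.center_mem_disk _ k (half_pos (B.radius_pos i))

lemma center_mem' (i : ℕ) : S.leaf (B.center i) 0 ∈ B.bumpDisk i := by
  simpa using B.center_mem i 0

/-- A leaf meets at most one disk. -/
lemma eq_of_leaf_mem {a s s' : ℝ} {i j : ℕ} (hi : S.leaf a s ∈ B.bumpDisk i)
    (hj : S.leaf a s' ∈ B.bumpDisk j) : i = j := by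
  by_contra h
  have hr : ∀ s ∈ Ioo S.lower S.upper, ∃ t, S.limitingGeodesic a t = S.leaf a s := fun s hs => by
    have : S.leaf a s ∈ range (S.limitingGeodesic a) := by
      rw [MiddleSphere.limitingGeodesic, (S.isAdapted_zero a).range_leafCurve]
      exact mem_image_of_mem _ hs
    exact this
  obtain ⟨t, ht⟩ := hr s (B.mem_of_mem_bumpDisk hi)
  obtain ⟨t', ht'⟩ := hr s' (B.mem_of_mem_bumpDisk hj)
  exact B.separated i j h a _ (S.isLimitingGeodesic a) ⟨⟨t, ht ▸ hi⟩, ⟨t', ht' ▸ hj⟩⟩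

/-- The disks are disjoint, because the leaf through a common point would meet both. -/
lemma eq_of_mem {q : Plane} {i j : ℕ} (hi : q ∈ B.bumpDisk i) (hj : q ∈ B.bumpDisk j) : i = j := by
  rw [← S.leaf_leafAngle q] at hi hj
  exact B.eq_of_leaf_mem hi hj

lemma factor_of_mem {q : Plane} {i : ℕ} (hq : q ∈ B.bumpDisk i) : B.factor q =
    1 + Real.exp (-1 / B.radius i) * B.f (S.sphereDist (B.center i) q / B.radius i) := by
  change 1 + ∑' j, (B.bumpDisk j).indicator _ q = _
  rw [tsum_eq_single i fun j hj => indicator_of_notMem (fun h => hj (B.eq_of_mem h hq)) _,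
    indicator_of_mem hq]

lemma factor_of_notMem {q : Plane} (hq : ∀ i, q ∉ B.bumpDisk i) : B.factor q = 1 := by
  change 1 + ∑' j, (B.bumpDisk j).indicator _ q = _
  rw [tsum_congr fun i => indicator_of_notMem (hq i) _, tsum_zero, add_zero]

lemma sphereDist_nonneg (θ₀ : ℝ) (q : Plane) : 0 ≤ S.sphereDist θ₀ q :=
  mul_nonneg S.sphereRadius_pos.le (Real.arccos_nonneg _)

lemma one_le_factor (q : Plane) : 1 ≤ B.factor q := by
  by_cases h : ∃ i, q ∈ B.bumpDisk i
  · obtain ⟨i, hi⟩ := h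
    rw [B.factor_of_mem hi, le_add_iff_nonneg_right]
    exact mul_nonneg (Real.exp_pos _).le
      (B.f_nonneg (div_nonneg (sphereDist_nonneg _ _) (B.radius_pos i).le))
  · rw [B.factor_of_notMem (not_exists.1 h)]

/-- The conformal exponent: half the logarithm of the conformal factor. -/
def exponent (q : Plane) : ℝ := Real.log (B.factor q) / 2

lemma exp_exponent (q : Plane) : Real.exp (2 * B.exponent q) = B.factor q := by
  rw [exponent, mul_div_cancel₀ _ two_ne_zero,
    Real.exp_log (zero_lt_one.trans_le (B.one_le_factor q))]

lemma exponent_nonneg (q : Plane) : 0 ≤ B.exponent q :=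
  div_nonneg (Real.log_nonneg (B.one_le_factor q)) zero_le_two

lemma exponent_of_notMem {q : Plane} (hq : ∀ i, q ∉ B.bumpDisk i) : B.exponent q = 0 := by
  rw [exponent, B.factor_of_notMem hq, Real.log_one, zero_div]

/-- The conformal exponent on the disk number `i`, as a function of the cosine of the angular
distance to the center. -/
def profile (i : ℕ) (x : ℝ) : ℝ := Real.log (1 + Real.exp (-1 / B.radius i) *
  B.f (S.sphereRadius * Real.arccos x / B.radius i)) / 2

lemma exponent_of_mem {q : Plane} {i : ℕ} (hq : q ∈ B.bumpDisk i) :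
    B.exponent q = B.profile i (S.cosDist (B.center i) q) := by
  rw [exponent, B.factor_of_mem hq]; rfl

lemma one_le_profile_arg (i : ℕ) (x : ℝ) : 1 ≤ 1 + Real.exp (-1 / B.radius i) *
    B.f (S.sphereRadius * Real.arccos x / B.radius i) :=
  le_add_of_nonneg_right (mul_nonneg (Real.exp_pos _).le (B.f_nonneg (div_nonneg
    (mul_nonneg S.sphereRadius_pos.le (Real.arccos_nonneg _)) (B.radius_pos i).le)))

lemma monotone_profile (i : ℕ) : Monotone (B.profile i) := by
  intro x y h
  refine div_le_div_of_nonneg_right (Real.log_le_log (zero_lt_one.trans_le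
    (B.one_le_profile_arg i x)) ?_) zero_le_two
  have hd : ∀ x, S.sphereRadius * Real.arccos x / B.radius i ∈ Ici 0 := fun x => div_nonneg
    (mul_nonneg S.sphereRadius_pos.le (Real.arccos_nonneg x)) (B.radius_pos i).le
  gcongr
  exact B.antitone (hd y) (hd x) (div_le_div_of_nonneg_right
    (mul_le_mul_of_nonneg_left (Real.antitone_arccos h) S.sphereRadius_pos.le) (B.radius_pos i).le)

lemma continuous_profile (i : ℕ) : Continuous (B.profile i) := by
  refine (Continuous.log ?_ fun x =>
    (zero_lt_one.trans_le (B.one_le_profile_arg i x)).ne').div_const 2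
  exact continuous_const.add (continuous_const.mul (B.contDiff.continuous.comp
    ((Real.continuous_arccos.const_mul _).div_const _)))

lemma contDiffAt_profile (i : ℕ) {x : ℝ} (h : x ∈ Ioo (-1 : ℝ) 1) :
    ContDiffAt ℝ ∞ (B.profile i) x := by
  have h1 : ContDiffAt ℝ ∞ (fun x => 1 + Real.exp (-1 / B.radius i) *
      B.f (S.sphereRadius * Real.arccos x / B.radius i)) x :=
    contDiffAt_const.add (contDiffAt_const.mul (B.contDiff.contDiffAt.comp x
      ((contDiffAt_const.mul (Real.contDiffAt_arccos h.1.ne' h.2.ne)).div_const _)))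
  exact (h1.log (zero_lt_one.trans_le (B.one_le_profile_arg i x)).ne').div_const 2

lemma deriv_profile_nonneg (i : ℕ) (x : ℝ) : 0 ≤ deriv (B.profile i) x :=
  (B.monotone_profile i).deriv_nonneg

/-- The angular radius of the disk number `i`. -/
def angularRadius (i : ℕ) : ℝ := B.radius i / 2 / S.sphereRadius

lemma angularRadius_mem (i : ℕ) : B.angularRadius i ∈ Ioc 0 (Real.pi / 2) := by
  refine ⟨div_pos (half_pos (B.radius_pos i)) S.sphereRadius_pos, ?_⟩
  rw [angularRadius, div_le_iff₀' S.sphereRadius_pos]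
  exact (B.radius_le i).trans S.band_le

lemma mem_bumpDisk_iff {q : Plane} {i : ℕ} : q ∈ B.bumpDisk i ↔
    |q 0| < S.band ∧ Real.arccos (S.cosDist (B.center i) q) < B.angularRadius i := by
  rw [angularRadius, lt_div_iff₀' S.sphereRadius_pos]; rfl

/-- The bump is not constant, so its profile is strictly increasing somewhere. -/
lemma exists_deriv_profile_pos (i : ℕ) :
    ∃ x ∈ Ioo (Real.cos (B.angularRadius i)) 1, 0 < deriv (B.profile i) x := by
  obtain ⟨h0, hpi⟩ := B.angularRadius_mem i
  have hlt : Real.cos (B.angularRadius i) < 1 := by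
    rw [← Real.cos_zero]
    exact Real.cos_lt_cos_of_nonneg_of_le_pi le_rfl (by linarith [Real.pi_pos]) h0
  obtain ⟨x, hx, h⟩ := exists_deriv_eq_slope (B.profile i) hlt (B.continuous_profile i).continuousOn
    fun x hx => ((B.contDiffAt_profile i ⟨(Real.neg_one_le_cos _).trans_lt hx.1,
      hx.2⟩).differentiableAt (by simp)).differentiableWithinAt
  refine ⟨x, hx, h ▸ div_pos ?_ (sub_pos.2 hlt)⟩
  have h1 : B.profile i (Real.cos (B.angularRadius i)) = 0 := by
    have hr := S.sphereRadius_pos.ne'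
    have hρ := (B.radius_pos i).ne'
    rw [profile, Real.arccos_cos h0.le (by linarith [Real.pi_pos]), angularRadius,
      B.support _ (le_of_eq (by field_simp))]
    simp
  rw [h1, sub_zero, profile, Real.arccos_one, mul_zero, zero_div]
  exact half_pos (Real.log_pos (by linarith [mul_pos (Real.exp_pos (-1 / B.radius i)) B.pos_zero]))

/-! ### The conformal exponent is adapted to the leaves -/

variable {B}

lemma contDiffAt_exponent (hB : ContDiffOn ℝ ∞ B.factor S.domain) {q : Plane} (hq : q ∈ S.domain) :
    ContDiffAt ℝ ∞ B.exponent q :=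
  ((hB.contDiffAt ((isOpen_Ioo.preimage (contDiff_coord 0 (n := 0)).continuous).mem_nhds hq)).log
    (zero_lt_one.trans_le (B.one_le_factor q)).ne').div_const 2

/-- The exponent has a minimum wherever it vanishes. -/
lemma partialD_exponent_of_notMem {q : Plane} (hq : ∀ i, q ∉ B.bumpDisk i) (k : Fin 2) :
    partialD k B.exponent q = 0 := by
  have h : IsLocalMin B.exponent q := Eventually.of_forall fun x => by
    rw [B.exponent_of_notMem hq]
    exact B.exponent_nonneg x
  rw [partialD, h.fderiv_eq_zero, zero_apply]

/-- The exponent has a local maximum at the center of each bump. -/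
lemma partialD_exponent_center (i : ℕ) (k : Fin 2) :
    partialD k B.exponent (S.leaf (B.center i) 0) = 0 := by
  have h : IsLocalMax B.exponent (S.leaf (B.center i) 0) := by
    filter_upwards [(B.isOpen_bumpDisk i).mem_nhds (B.center_mem' i)] with x hx
    rw [B.exponent_of_mem hx, B.exponent_of_mem (B.center_mem' i)]
    refine B.monotone_profile i ?_
    rw [S.cosDist_leaf (by simpa using S.band_pos), div_self (S.jacobi_pos S.zero_mem).ne']
    exact S.cosDist_le_one _ _
  rw [partialD, h.fderiv_eq_zero, zero_apply]

/-- On the part in the round band of the leaf through the center of a bump,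
only the center is at distance zero from it. -/
lemma cosDist_leaf_mem {i : ℕ} {s : ℝ} (hs : |s| < S.band) (h0 : s ≠ 0) :
    S.cosDist (B.center i) (S.leaf (B.center i) s) ∈ Ioo (-1 : ℝ) 1 := by
  have hJ0 := S.jacobi_pos S.zero_mem
  have hJ := S.jacobi_pos (S.mem_of_abs_lt_band hs)
  rw [S.cosDist_leaf hs]
  refine ⟨by linarith [div_pos hJ hJ0], ?_⟩
  rw [← S.cosDist_leaf hs (θ₀ := B.center i), MiddleSphere.cosDist]
  have hc := S.cos_pos hs
  have h1 : Real.cos (s / S.sphereRadius) < 1 := by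
    refine (Real.cos_le_one _).lt_of_ne fun h => ?_
    have hr := S.sphereRadius_pos
    have hb := hs.trans_le S.band_le
    rw [Real.cos_eq_one_iff_of_lt_of_lt, div_eq_zero_iff] at h
    · exact h.elim h0 hr.ne'
    · rw [lt_div_iff₀' hr]; nlinarith [(abs_lt.1 hb).1, Real.pi_pos]
    · rw [div_lt_iff₀' hr]; nlinarith [(abs_lt.1 hb).2, Real.pi_pos]
  exact (mul_le_of_le_one_right hc.le (Real.cos_le_one _)).trans_lt h1

lemma exponent_eventuallyEq {q : Plane} {i : ℕ} (hq : q ∈ B.bumpDisk i) :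
    B.exponent =ᶠ[𝓝 q] fun x => B.profile i (S.cosDist (B.center i) x) := by
  filter_upwards [(B.isOpen_bumpDisk i).mem_nhds hq] with x hx using B.exponent_of_mem hx

/-- The leaf through the center of a bump meets no other bump, and the gradient of a radial function
is tangent to it. -/
lemma isAdapted_center (hB : ContDiffOn ℝ ∞ B.factor S.domain) (i : ℕ) :
    S.IsAdapted B.exponent (B.center i) := by
  refine ⟨fun s hs => contDiffAt_exponent hB (S.leaf_mem_domain _ hs),
    fun s _ => B.exponent_nonneg _, fun s hs => ?_⟩
  by_cases hd : S.leaf (B.center i) s ∈ B.bumpDisk i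
  · rcases eq_or_ne s 0 with rfl | h0
    · rw [partialD_exponent_center, partialD_exponent_center, mul_zero, mul_zero]
    · have hb : |s| < S.band := hd.1
      have hP := cosDist_leaf_mem (B := B) (i := i) hb h0
      have hW := ((B.contDiffAt_profile i hP).differentiableAt (by simp)).hasDerivAt
      have hdP := (S.contDiff_cosDist (B.center i)).differentiable (by simp)
        (S.leaf (B.center i) s)
      simp only [partialD_congr (exponent_eventuallyEq hd), partialD_comp hW hdP]
      linear_combination deriv (B.profile i) (S.cosDist (B.center i) (S.leaf (B.center i) s)) *
        S.cosDist_normal (θ₀ := B.center i) hb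
  · have hno : ∀ j, S.leaf (B.center i) s ∉ B.bumpDisk j := fun j hj => by
      obtain rfl := B.eq_of_leaf_mem hj (B.center_mem' i)
      exact hd hj
    rw [partialD_exponent_of_notMem hno, partialD_exponent_of_notMem hno, mul_zero, mul_zero]

lemma isAdapted_of_notMem (hB : ContDiffOn ℝ ∞ B.factor S.domain) {a : ℝ}
    (ha : ∀ s i, S.leaf a s ∉ B.bumpDisk i) : S.IsAdapted B.exponent a := by
  refine ⟨fun s hs => contDiffAt_exponent hB (S.leaf_mem_domain _ hs),
    fun s _ => B.exponent_nonneg _, fun s _ => ?_⟩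
  rw [partialD_exponent_of_notMem (ha s), partialD_exponent_of_notMem (ha s), mul_zero, mul_zero]

end EquatorBumps

/-! ### Instability of the leaves through the bump centers -/

lemma partialD_partialD_comp {w P : Plane → ℝ} {W : ℝ → ℝ} {q : Plane}
    (hw : w =ᶠ[𝓝 q] fun x => W (P x)) (hW : ContDiffAt ℝ ∞ W (P q)) (hP : ContDiff ℝ ∞ P)
    (j k : Fin 2) : partialD j (partialD k w) q =
      deriv (deriv W) (P q) * partialD j P q * partialD k P q
        + deriv W (P q) * partialD j (partialD k P) q := by
  have hd : ∀ x, DifferentiableAt ℝ P x := hP.differentiable (by simp)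
  have h : partialD k (fun x => W (P x)) =ᶠ[𝓝 q] fun x => deriv W (P x) * partialD k P x := by
    filter_upwards [hP.continuous.continuousAt.eventually
      ((hW.of_le (m := 1) (by simp)).eventually (by simp))] with x hx
    exact partialD_comp (hx.differentiableAt (by simp)).hasDerivAt (hd x) k
  have hW' := (hW.deriv_infty.differentiableAt (by simp)).hasDerivAt
  rw [partialD_congr ((partialD_eventuallyEq hw k).trans h) j,
    partialD_mul (F := fun x => deriv W (P x)) (hW'.differentiableAt.comp q (hd q))
      ((hP.contDiffAt.partialD k).differentiableAt (by simp)) j, partialD_comp hW' (hd q)]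

namespace EquatorBumps

variable {S : MiddleSphere} {B : EquatorBumps S}

/-- The Jacobi operator on the trial function inside the bump: its sign is that of the slope of the
profile of the bump. -/
lemma jacobi_operator_of_mem (hB : ContDiffOn ℝ ∞ B.factor S.domain) {i : ℕ} {t : ℝ}
    (hd : S.leafCurve B.exponent (B.center i) t ∈ B.bumpDisk i)
    (h0 : S.leafParam B.exponent (B.center i) t ≠ 0) :
    deriv (deriv (S.trialField B.exponent (B.center i))) t
      + S.leafCurvature B.exponent (B.center i) t * S.trialField B.exponent (B.center i) t =
    Real.exp (-B.exponent (S.leafCurve B.exponent (B.center i) t))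
      / S.R (S.leafParam B.exponent (B.center i) t) *
      (deriv (B.profile i) (S.cosDist (B.center i) (S.leafCurve B.exponent (B.center i) t)) *
        (Real.cos (S.leafParam B.exponent (B.center i) t / S.sphereRadius) * S.jacobi 0
          / S.sphereRadius)) := by
  rw [(isAdapted_center hB i).jacobi_operator_trialField t]
  have hb : |S.leafParam B.exponent (B.center i) t| < S.band := hd.1
  rw [MiddleSphere.leafCurve] at hd ⊢
  set s := S.leafParam B.exponent (B.center i) t
  have hW := B.contDiffAt_profile i (cosDist_leaf_mem (B := B) (i := i) hb h0)
  have hP := S.contDiff_cosDist (B.center i)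
  have hR := (S.R_pos (S.mem_of_abs_lt_band hb)).ne'
  have hn := S.cosDist_normal (θ₀ := B.center i) hb
  have hn' : partialD 0 (S.cosDist (B.center i)) (S.leaf (B.center i) s) * S.neckRadius =
      S.jacobi s * partialD 1 (S.cosDist (B.center i)) (S.leaf (B.center i) s) / S.R s := by
    rw [hn]; field_simp
  rw [partialD_partialD_comp (exponent_eventuallyEq hd) hW hP,
    partialD_partialD_comp (exponent_eventuallyEq hd) hW hP,
    ← S.cosDist_second (θ₀ := B.center i) hb]
  linear_combination Real.exp (-B.exponent (S.leaf (B.center i) s)) / S.R s *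
    deriv (deriv (B.profile i)) (S.cosDist (B.center i) (S.leaf (B.center i) s)) *
    partialD 1 (S.cosDist (B.center i)) (S.leaf (B.center i) s) * hn'

/-- Near the leaf through the center of the bump number `i`, there is no other bump. -/
lemma eventually_notMem (i : ℕ) {s : ℝ} (hs : s ∈ Ioo S.lower S.upper) :
    ∀ᶠ q in 𝓝 (S.leaf (B.center i) s), ∀ j, q ∈ B.bumpDisk j → j = i := by
  have hc : ContinuousAt (fun q => S.leaf (S.leafAngle q) 0) (S.leaf (B.center i) s) :=
    ContinuousAt.comp' (g := fun a => S.leaf a 0) (S.continuous_leaf 0).continuousAt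
      (S.continuousAt_leafAngle hs)
  have hmem : S.leaf (S.leafAngle (S.leaf (B.center i) s)) 0 ∈ B.bumpDisk i := by
    simpa [MiddleSphere.leafAngle] using B.center_mem' i
  filter_upwards [hc.eventually ((B.isOpen_bumpDisk i).mem_nhds hmem)] with q hq j hj
  rw [← S.leaf_leafAngle q] at hj
  exact B.eq_of_leaf_mem hj hq

/-- Where the leaf through the center of the bump leaves the bump, up to finitely many parameters,
the metric is not perturbed near the leaf. -/
lemma exponent_eventuallyEq_zero {i : ℕ} {s : ℝ} (hs : s ∈ Ioo S.lower S.upper)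
    (hb : |s| ≠ S.band) (hr : |s| < S.band →
      Real.arccos (S.cosDist (B.center i) (S.leaf (B.center i) s)) ≠ B.angularRadius i)
    (hd : S.leaf (B.center i) s ∉ B.bumpDisk i) :
    B.exponent =ᶠ[𝓝 (S.leaf (B.center i) s)] fun _ => 0 := by
  have hc0 : Continuous fun q : Plane => |q 0| := (contDiff_coord 0 (n := 0)).continuous.abs
  have hcd : Continuous fun q => Real.arccos (S.cosDist (B.center i) q) :=
    Real.continuous_arccos.comp (S.contDiff_cosDist _).continuous
  have hev : ∀ᶠ q in 𝓝 (S.leaf (B.center i) s), q ∉ B.bumpDisk i := by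
    rcases lt_or_gt_of_ne hb with h | h
    · have : B.angularRadius i <
          Real.arccos (S.cosDist (B.center i) (S.leaf (B.center i) s)) :=
        lt_of_le_of_ne (not_lt.1 fun hlt => hd (B.mem_bumpDisk_iff.2 ⟨h, hlt⟩)) (hr h).symm
      filter_upwards [hcd.continuousAt.eventually (lt_mem_nhds this)] with q hq hq'
      exact hq.not_gt (B.mem_bumpDisk_iff.1 hq').2
    · filter_upwards [hc0.continuousAt.eventually (lt_mem_nhds (a := S.band)
        (b := |S.leaf (B.center i) s 0|) h)] with q hq hq'
      exact hq.not_gt hq'.1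
  filter_upwards [hev, eventually_notMem i hs] with q hq hq'
  exact B.exponent_of_notMem fun j hj => hq (hq' j hj ▸ hj)

/-- The parameters at which the leaf meets the center or the boundary of the bump are finitely
many. -/
lemma finite_exceptional (i : ℕ) : {s : ℝ | s = 0 ∨ |s| = S.band ∨ (|s| < S.band ∧
    Real.arccos (S.cosDist (B.center i) (S.leaf (B.center i) s)) = B.angularRadius i)}.Finite := by
  have hr := S.sphereRadius_pos
  have habs : ∀ c : ℝ, {s : ℝ | |s| = c}.Finite := fun c =>
    (Set.toFinite {c, -c}).subset fun s hs => by
      simpa using eq_or_eq_neg_of_abs_eq hs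
  refine (((finite_singleton 0).union (habs S.band)).union (habs (S.sphereRadius * Real.arccos
    (√((S.jacobi 0 * Real.cos (B.angularRadius i)) ^ 2 + S.neckRadius ^ 2)
      / S.sphereRadius)))).subset fun s hs => ?_
  rcases hs with h | h | ⟨h, h'⟩
  · exact Or.inl (Or.inl h)
  · exact Or.inl (Or.inr h)
  · refine Or.inr ?_
    have hm := S.mem_of_abs_lt_band h
    have hJ0 := S.jacobi_pos S.zero_mem
    have hJ := S.jacobi_pos hm
    have h1 : S.jacobi 0 * Real.cos (B.angularRadius i) = S.jacobi s := by
      rw [← h', S.cosDist_leaf h, Real.cos_arccos (by linarith [div_pos hJ hJ0]),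
        mul_div_cancel₀ _ hJ0.ne']
      exact S.cosDist_leaf h (θ₀ := 0) ▸ S.cosDist_le_one _ _
    have h2 : √((S.jacobi 0 * Real.cos (B.angularRadius i)) ^ 2 + S.neckRadius ^ 2) =
        S.sphereRadius * Real.cos (s / S.sphereRadius) := by
      rw [h1, S.jacobi_sq hm, sub_add_cancel, Real.sqrt_sq (S.R_pos hm).le, S.round s h]
    have hb := h.le.trans S.band_le
    have h3 : Real.cos (s / S.sphereRadius) = Real.cos (|s| / S.sphereRadius) := by
      rw [← Real.cos_abs, abs_div, abs_of_pos hr]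
    rw [mem_ofPred_eq, h2, mul_div_cancel_left₀ _ hr.ne', h3, Real.arccos_cos (by positivity),
      mul_div_cancel₀ _ hr.ne']
    rw [div_le_iff₀' hr]
    nlinarith [Real.pi_pos]

lemma factor_leaf_le (i : ℕ) (s : ℝ) : B.factor (S.leaf (B.center i) s) ≤
    1 + Real.exp (-1 / B.radius i) * B.f 0 := by
  by_cases hd : S.leaf (B.center i) s ∈ B.bumpDisk i
  · rw [B.factor_of_mem hd]
    have h0 : 0 ≤ S.sphereDist (B.center i) (S.leaf (B.center i) s) / B.radius i :=
      div_nonneg (sphereDist_nonneg _ _) (B.radius_pos i).le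
    gcongr
    exact B.antitone self_mem_Ici h0 h0
  · rw [B.factor_of_notMem fun j hj => hd (B.eq_of_leaf_mem hj (B.center_mem' i) ▸ hj)]
    exact le_add_of_nonneg_right (mul_nonneg (Real.exp_pos _).le B.pos_zero.le)

/-- The leaf through the center of a bump is unstable. -/
theorem noncompactIndex_center_pos (hB : ContDiffOn ℝ ∞ B.factor S.domain) (i : ℕ) :
    0 < noncompactIndex (S.leafCurvature B.exponent (B.center i)) := by
  have hw := isAdapted_center hB i
  set w := B.exponent
  set a := B.center i
  have hk := hw.contDiff_trialField
  have hk2 : Continuous (deriv (deriv (S.trialField w a))) :=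
    (contDiff_infty_iff_deriv.1 (contDiff_infty_iff_deriv.1 hk).2).2.continuous
  have hκ := hw.continuous_leafCurvature
  obtain ⟨K, hK0, hK⟩ := S.exists_R_le
  have hJ0 := S.jacobi_pos S.zero_mem
  -- the trial function is bounded
  have hbound : ∀ t, S.trialField w a t ^ 2 ≤
      (1 + Real.exp (-1 / B.radius i) * B.f 0) * K ^ 2 := fun t => by
    have hs := hw.mem t
    have h1 : S.trialField w a t ^ 2 =
        B.factor (S.leafCurve w a t) * S.jacobi (S.leafParam w a t) ^ 2 := by
      rw [MiddleSphere.trialField, mul_pow, ← B.exp_exponent, ← Real.exp_nat_mul]; rfl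
    rw [h1, S.jacobi_sq hs]
    refine mul_le_mul (factor_leaf_le i _) ?_ (S.sq_sub_sq_pos hs).le
      (zero_le_one.trans (by linarith [mul_pos (Real.exp_pos (-1 / B.radius i)) B.pos_zero]))
    have := pow_le_pow_left₀ (S.R_pos hs).le (hK _ (Ioo_subset_Icc_self hs)) 2
    linarith [sq_nonneg S.neckRadius]
  -- the integrand has a sign, first off the exceptional set and then everywhere by continuity
  have hmem : ∀ t, S.leafCurve w a t ∈ B.bumpDisk i → S.leafParam w a t ≠ 0 →
      0 ≤ deriv (deriv (S.trialField w a)) t + S.leafCurvature w a t * S.trialField w a t := by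
    intro t hd h0
    rw [jacobi_operator_of_mem hB hd h0]
    exact mul_nonneg (div_nonneg (Real.exp_pos _).le (S.R_pos (hw.mem t)).le)
      (mul_nonneg (B.deriv_profile_nonneg i _) (div_nonneg (mul_nonneg (S.cos_pos hd.1).le hJ0.le)
        S.sphereRadius_pos.le))
  have hclosed : IsClosed {t | 0 ≤ S.trialField w a t *
      (deriv (deriv (S.trialField w a)) t + S.leafCurvature w a t * S.trialField w a t)} :=
    isClosed_le continuous_const (hk.continuous.mul (hk2.add (hκ.mul hk.continuous)))
  have hdense : Dense ((S.leafParam w a) ⁻¹' {s : ℝ | s = 0 ∨ |s| = S.band ∨ (|s| < S.band ∧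
      Real.arccos (S.cosDist a (S.leaf a s)) = B.angularRadius i)})ᶜ :=
    (((finite_exceptional i).preimage
      hw.strictMono_param.injective.injOn).countable).dense_compl ℝ
  have hq : ∀ t, 0 ≤ S.trialField w a t *
      (deriv (deriv (S.trialField w a)) t + S.leafCurvature w a t * S.trialField w a t) := by
    intro t
    refine hclosed.closure_subset_iff.2 (fun t ht => ?_) (hdense t)
    simp only [mem_compl_iff, mem_preimage, mem_ofPred_eq, not_or, not_and] at ht
    refine mul_nonneg (hw.trialField_pos t).le ?_
    by_cases hd : S.leafCurve w a t ∈ B.bumpDisk i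
    · exact hmem t hd ht.1
    · have hz : w =ᶠ[𝓝 (S.leafCurve w a t)] fun _ => 0 :=
        exponent_eventuallyEq_zero (hw.mem t) ht.2.1 ht.2.2 hd
      have hz2 : ∀ k, partialD 1 (partialD k w) (S.leafCurve w a t) = 0 := fun k => by
        rw [partialD_congr (partialD_eventuallyEq hz k) 1,
          show partialD k (fun _ => (0 : ℝ)) = fun _ => 0 from funext (partialD_const 0 k),
          partialD_const]
      rw [hw.jacobi_operator_trialField, hz2, hz2]
      simp
  -- a parameter at which the slope of the bump is positive
  obtain ⟨x, hx, hx'⟩ := B.exists_deriv_profile_pos i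
  obtain ⟨hr0, hrpi⟩ := B.angularRadius_mem i
  have hx0 : 0 ≤ x :=
    (Real.cos_nonneg_of_neg_pi_div_two_le_of_le (by linarith) hrpi).trans hx.1.le
  have hr := S.sphereRadius_pos
  have hax : Real.arccos x < B.angularRadius i := by
    rw [← Real.arccos_cos hr0.le (by linarith [Real.pi_pos])]
    exact Real.strictAntiOn_arccos ⟨Real.neg_one_le_cos _, Real.cos_le_one _⟩
      ⟨by linarith, hx.2.le⟩ hx.1
  have hs1 : S.sphereRadius * Real.arccos x < S.band := by
    refine lt_of_lt_of_le ?_ (B.radius_le i)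
    rwa [angularRadius, lt_div_iff₀' hr] at hax
  have hs0 : 0 ≤ S.sphereRadius * Real.arccos x := mul_nonneg hr.le (Real.arccos_nonneg x)
  have hlt : ∀ s ∈ Icc 0 (S.sphereRadius * Real.arccos x), |s| < S.band := fun s hs => by
    rw [abs_of_nonneg hs.1]; exact hs.2.trans_lt hs1
  obtain ⟨s, hs, hsx⟩ : x ∈ (fun s => S.jacobi s / S.jacobi 0) ''
      Icc 0 (S.sphereRadius * Real.arccos x) := by
    refine intermediate_value_Icc' hs0 ?_ ⟨?_, ?_⟩
    · exact (S.contDiffOn_jacobi.continuousOn.mono fun s hs =>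
        S.mem_of_abs_lt_band (hlt s hs)).div_const _
    · have hb := hlt _ (right_mem_Icc.2 hs0)
      change S.jacobi _ / S.jacobi 0 ≤ x
      rw [← (S.cos_mul_cos_winding hb).1]
      refine (mul_le_of_le_one_right (S.cos_pos hb).le (Real.cos_le_one _)).trans_eq ?_
      rw [mul_div_cancel_left₀ _ hr.ne', Real.cos_arccos (by linarith) hx.2.le]
    · change x ≤ S.jacobi 0 / S.jacobi 0
      rw [div_self hJ0.ne']
      exact hx.2.le
  simp only at hsx
  have hb := hlt s hs
  have hsm := S.mem_of_abs_lt_band hb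
  obtain ⟨t, rfl⟩ : s ∈ range (S.leafParam w a) := hw.range_param ▸ hsm
  have hsd : S.leafCurve w a t ∈ B.bumpDisk i := by
    refine B.mem_bumpDisk_iff.2 ⟨hb, ?_⟩
    rw [MiddleSphere.leafCurve, S.cosDist_leaf hb, hsx]
    exact hax
  have hne : S.leafParam w a t ≠ 0 := fun h => by
    rw [h, div_self hJ0.ne'] at hsx
    exact hx.2.ne hsx.symm
  have hpos : 0 < S.trialField w a t * (deriv (deriv (S.trialField w a)) t
      + S.leafCurvature w a t * S.trialField w a t) := by
    refine mul_pos (hw.trialField_pos t) ?_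
    rw [jacobi_operator_of_mem hB hsd hne, MiddleSphere.leafCurve, S.cosDist_leaf hb, hsx]
    exact mul_pos (div_pos (Real.exp_pos _) (S.R_pos hsm)) (mul_pos hx'
      (div_pos (mul_pos (S.cos_pos hb) hJ0) hr))
  obtain ⟨φ, h1, h2, h3⟩ := exists_secondVariation_neg hk hκ hbound hq hpos
  exact noncompactIndex_pos h1 h2 h3

end EquatorBumps

/-! ### From coordinates to the surface -/

lemma MiddleSphere.isOpen_domain (S : MiddleSphere) : IsOpen S.domain :=
  isOpen_Ioo.preimage (contDiff_coord 0 (n := 0)).continuous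

lemma MiddleSphere.IsAdapted.range_comp_leafCurve {S : MiddleSphere} {w : Plane → ℝ} {a : ℝ}
    (hw : S.IsAdapted w a) {X : Type*} (ψ : Plane → X) :
    range (fun t => ψ (S.leafCurve w a t)) = ψ '' (S.leaf a '' Ioo S.lower S.upper) := by
  rw [← hw.range_leafCurve, ← range_comp]; rfl

section Surface

variable {M : Type*} [TopologicalSpace M] [ChartedSpace Plane M] [IsManifold (𝓡 2) ∞ M]
  {g : SurfaceMetric M}

lemma inner_congr (g : SurfaceMetric M) {p p' : M} (h : p = p') (v w : Plane) :
    g.inner p (v : TangentSpace (𝓡 2) p) (w : TangentSpace (𝓡 2) p) =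
      g.inner p' (v : TangentSpace (𝓡 2) p') (w : TangentSpace (𝓡 2) p') := by
  subst h; rfl

/-- The metric coefficients in the coordinates of a local diffeomorphism are smooth. -/
lemma contDiffAt_inner_mfderiv (g : SurfaceMetric M) {ψ : Plane → M} {q : Plane}
    (h : ContMDiffAt 𝓘(ℝ, Plane) (𝓡 2) ∞ ψ q) (v : Plane) :
    ContDiffAt ℝ ∞ (fun x => g.inner (ψ x) (mfderiv 𝓘(ℝ, Plane) (𝓡 2) ψ x v)
      (mfderiv 𝓘(ℝ, Plane) (𝓡 2) ψ x v)) q := by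
  have h1 : ContMDiffAt 𝓘(ℝ, Plane) ((𝓡 2).prod 𝓘(ℝ, Plane)) ∞
      (fun x => (⟨ψ x, mfderiv 𝓘(ℝ, Plane) (𝓡 2) ψ x v⟩ : TangentBundle (𝓡 2) M)) q := by
    have hD := h.mfderiv_const (m := ∞) (by simp)
    have hv : ContMDiffAt 𝓘(ℝ, Plane) (𝓘(ℝ, Plane).prod 𝓘(ℝ, Plane)) ∞
      (fun x => (⟨x, v⟩ : TangentBundle 𝓘(ℝ, Plane) Plane)) q := by
      rw [Bundle.contMDiffAt_totalSpace]
      refine ⟨contMDiffAt_id, ?_⟩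
      simpa using contMDiffAt_const
    exact ContMDiffAt.clm_apply_of_inCoordinates hD hv h
  have h2 := ContMDiffAt.clm_bundle_apply₂ (F₁ := Plane) (F₂ := Plane) (F₃ := ℝ)
    (E₃ := Bundle.Trivial M ℝ) (b := ψ)
    (ψ := fun x => g.inner (ψ x)) ((g.contMDiff (ψ q)).comp q h) h1 h1
  rw [Bundle.contMDiffAt_totalSpace] at h2
  exact contMDiffAt_iff_contDiffAt.1 h2.2

lemma exists_chart_of_isLocalDiffeomorphAt {ψ : Plane → M} {q : Plane}
    (h : IsLocalDiffeomorphAt 𝓘(ℝ, Plane) (𝓡 2) ∞ ψ q) :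
    ∃ e ∈ IsManifold.maximalAtlas (𝓡 2) ∞ M, q ∈ e.target ∧
      (∀ x ∈ e.target, e.symm x = ψ x) := by
  obtain ⟨Φ, hq, hΦ⟩ := h
  exact ⟨Φ.symm.toOpenPartialHomeomorph,
    OpenPartialHomeomorph.mem_maximalAtlas_of_contMDiffOn _ Φ.contMDiffOn_invFun
      Φ.contMDiffOn_toFun, hq, fun x hx => (hΦ hx).symm⟩

lemma chartMetric_apply {ψ : Plane → M} {e : OpenPartialHomeomorph M Plane} {x : Plane}
    (hx : x ∈ e.target) (he : ∀ x ∈ e.target, e.symm x = ψ x) (i j : Fin 2) :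
    chartMetric g e x i j = g.inner (ψ x)
      (mfderiv 𝓘(ℝ, Plane) (𝓡 2) ψ x (EuclideanSpace.single i (1 : ℝ) : Plane))
      (mfderiv 𝓘(ℝ, Plane) (𝓡 2) ψ x (EuclideanSpace.single j (1 : ℝ) : Plane)) := by
  have hev : e.symm =ᶠ[𝓝 x] ψ := by
    filter_upwards [e.open_target.mem_nhds hx] with y hy using he y hy
  refine (inner_congr g (he x hx) _ _).trans ?_
  have h := hev.mfderiv_eq (I := 𝓘(ℝ, Plane)) (I' := 𝓡 2)
  exact congrArg (fun D : Plane →L[ℝ] Plane => g.inner (ψ x)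
    (D (EuclideanSpace.single i (1 : ℝ)) : Plane) (D (EuclideanSpace.single j (1 : ℝ)) : Plane)) h

namespace IsBumpySurface

variable {S : MiddleSphere} {B : EquatorBumps S} {ψ : Plane → M}

lemma contMDiffAt (hM : IsBumpySurface g S B ψ) {q : Plane} (hq : q ∈ S.domain) :
    ContMDiffAt 𝓘(ℝ, Plane) (𝓡 2) ∞ ψ q :=
  (hM.localDiffeo ⟨q, hq⟩).contMDiffAt

/-- The conformal factor is smooth because the metric of the surface is. -/
lemma contDiffOn_factor (hM : IsBumpySurface g S B ψ) : ContDiffOn ℝ ∞ B.factor S.domain := by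
  refine fun q hq => ContDiffAt.contDiffWithinAt ?_
  refine (contDiffAt_inner_mfderiv g (hM.contMDiffAt hq)
    (EuclideanSpace.single 0 1)).congr_of_eventuallyEq ?_
  filter_upwards [S.isOpen_domain.mem_nhds hq] with x hx
  rw [hM.metric_eq x hx]
  simp [MiddleSphere.metric]

lemma exists_chart (hM : IsBumpySurface g S B ψ) {q : Plane} (hq : q ∈ S.domain) :
    ∃ e ∈ IsManifold.maximalAtlas (𝓡 2) ∞ M, ψ q ∈ e.source ∧ (e ∘ ψ =ᶠ[𝓝 q] id) ∧
      chartMetric g e =ᶠ[𝓝 q] conformalMetric S.R B.exponent := by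
  obtain ⟨e, he, hqe, heq⟩ := exists_chart_of_isLocalDiffeomorphAt (hM.localDiffeo ⟨q, hq⟩)
  refine ⟨e, he, heq q hqe ▸ e.map_target hqe, ?_, ?_⟩
  · filter_upwards [e.open_target.mem_nhds hqe] with x hx
    rw [Function.comp_apply, ← heq x hx, e.right_inv hx, id]
  · filter_upwards [e.open_target.mem_nhds hqe, S.isOpen_domain.mem_nhds hq] with x hx hxd
    ext i j
    rw [chartMetric_apply hx heq, hM.metric_eq x hxd, conformalMetric, B.exp_exponent]
    fin_cases i <;> fin_cases j <;> simp [MiddleSphere.metric]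

lemma hasGaussCurvature (hM : IsBumpySurface g S B ψ) {q : Plane} (hq : q ∈ S.domain) :
    HasGaussCurvature g (ψ q) (coordGaussCurvature (conformalMetric S.R B.exponent) q) := by
  obtain ⟨e, he, hs, hinv, hG⟩ := hM.exists_chart hq
  refine ⟨e, he, hs, ?_⟩
  rw [show e (ψ q) = q from hinv.eq_of_nhds]
  exact coordGaussCurvature_congr hG

/-- A geodesic in coordinates is a geodesic of the surface. -/
lemma isUnitGeodesic (hM : IsBumpySurface g S B ψ) {c : ℝ → Plane} (hc : ContDiff ℝ ∞ c)
    (hd : ∀ t, c t ∈ S.domain) (hgeo : ∀ t, GeodesicEqAt (conformalMetric S.R B.exponent) c t)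
    (hunit : ∀ t, Real.exp (2 * B.exponent (c t)) * (deriv (fun τ => c τ 0) t ^ 2
      + S.R (c t 0) ^ 2 * deriv (fun τ => c τ 1) t ^ 2) = 1) :
    IsUnitGeodesic g (fun t => ψ (c t)) := by
  refine ⟨fun t => (hM.contMDiffAt (hd t)).comp t (contMDiff_iff_contDiff.2 hc t), fun t => ?_,
    fun t => ?_⟩
  · have hv : velocity (fun t => ψ (c t)) t =
        mfderiv 𝓘(ℝ, Plane) (𝓡 2) ψ (c t) (deriv c t) := by
      have := mfderiv_comp (I := 𝓘(ℝ, ℝ)) (I' := 𝓘(ℝ, Plane)) (I'' := 𝓡 2) t (f := c) (g := ψ)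
        ((hM.contMDiffAt (hd t)).mdifferentiableAt (by simp))
        ((hc.differentiable (by simp) t).mdifferentiableAt)
      rw [velocity]
      change mfderiv 𝓘(ℝ, ℝ) (𝓡 2) (ψ ∘ c) t (1 : ℝ) = _
      rw [this, mfderiv_eq_fderiv]
      rfl
    have hi : ∀ i, deriv (fun τ => c τ i) t = deriv c t i := fun i =>
      ((hasFDerivAt_coord i (c t)).comp_hasDerivAt t
        (hc.differentiable (by simp) t).hasDerivAt).deriv
    have h := hunit t
    rw [hi, hi, B.exp_exponent] at h
    rw [hv]
    refine (hM.metric_eq _ (hd t) (deriv c t) (deriv c t)).trans (Eq.trans ?_ h)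
    congr 1
    simp [MiddleSphere.metric, Fin.sum_univ_two]
    ring
  · obtain ⟨e, he, hs, hinv, hG⟩ := hM.exists_chart (hd t)
    refine ⟨e, he, hs, ?_⟩
    have hcc : (fun τ => e (ψ (c τ))) =ᶠ[𝓝 t] c :=
      hc.continuous.continuousAt.eventually hinv
    exact ((hgeo t).congr hG).congr_curve hcc

lemma isUnitGeodesic_leaf (hM : IsBumpySurface g S B ψ) {a : ℝ}
    (hw : S.IsAdapted B.exponent a) : IsUnitGeodesic g (fun t => ψ (S.leafCurve B.exponent a t)) :=
  hM.isUnitGeodesic hw.contDiff_leafCurve (fun t => S.leaf_mem_domain a (hw.mem t))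
    hw.geodesicEqAt hw.unit_speed

lemma injective_leaf (hM : IsBumpySurface g S B ψ) {a : ℝ} (hw : S.IsAdapted B.exponent a) :
    Function.Injective (fun t => ψ (S.leafCurve B.exponent a t)) := by
  intro t t' h
  have := ((hM.eq_iff _ (S.leaf_mem_domain a (hw.mem t)) _ (S.leaf_mem_domain a (hw.mem t'))).1 h).1
  exact hw.strictMono_param.injective this.symm

/-- The leaves through the bump centers are unstable noncompact geodesics. -/
lemma isUnstable_center (hM : IsBumpySurface g S B ψ) (i : ℕ) :
    IsUnstableNoncompactLeaf g (ψ '' (S.leaf (B.center i) '' Ioo S.lower S.upper)) := by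
  have hB := hM.contDiffOn_factor
  have hw := EquatorBumps.isAdapted_center hB i
  exact ⟨_, S.leafCurvature B.exponent (B.center i), hM.isUnitGeodesic_leaf hw,
    hM.injective_leaf hw, hw.range_comp_leafCurve ψ,
    fun t => hM.hasGaussCurvature (S.leaf_mem_domain _ (hw.mem t)),
    EquatorBumps.noncompactIndex_center_pos hB i⟩

/-- The necks are closed geodesics. -/
lemma neck_geodesic (hM : IsBumpySurface g S B ψ) {p : ℝ} (hp : p = S.lower ∨ p = S.upper) :
    IsUnitGeodesic g (fun t => ψ (S.parallel p t)) ∧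
      IsSimpleCurve (fun t => ψ (S.parallel p t)) := by
  have hlu := (S.lower_neg.trans S.upper_pos).le
  have hn := S.neckRadius_pos
  have hpd : p ∈ Ioo S.domLow S.domHigh := by
    rcases hp with rfl | rfl
    · exact S.Icc_subset ⟨le_rfl, hlu⟩
    · exact S.Icc_subset ⟨hlu, le_rfl⟩
  have hR : S.R p = S.neckRadius ∧ deriv S.R p = 0 := by
    rcases hp with rfl | rfl
    · exact ⟨S.lower_neck.1, S.lower_neck.2.1⟩
    · exact ⟨S.upper_neck.1, S.upper_neck.2.1⟩
  have hno : ∀ t i, S.parallel p t ∉ B.bumpDisk i := fun t i hi => by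
    have hm : p ∈ Ioo S.lower S.upper := B.mem_of_mem_bumpDisk hi
    rcases hp with rfl | rfl
    · exact hm.1.false
    · exact hm.2.false
  refine ⟨hM.isUnitGeodesic (S.contDiff_parallel p) (fun t => hpd) (fun t => S.geodesicEqAt_parallel
    (S.hasDerivAt_R hpd).differentiableAt hR.1 hR.2
    ((EquatorBumps.contDiffAt_exponent hM.contDiffOn_factor hpd).differentiableAt (by simp))
    fun k => EquatorBumps.partialD_exponent_of_notMem (hno t) k) fun t => ?_,
    Or.inr ⟨2 * Real.pi * S.neckRadius, by positivity, fun t t' => ?_⟩⟩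
  · have h0 : deriv (fun τ => S.parallel p τ 0) t = 0 := (hasDerivAt_const t p).deriv
    have h1 : deriv (fun τ => S.parallel p τ 1) t = 1 / S.neckRadius :=
      ((hasDerivAt_id t).div_const _).deriv
    rw [B.exponent_of_notMem (hno t), h0, h1, show S.parallel p t 0 = p from rfl, hR.1]
    simp [hn.ne']
  · rw [hM.eq_iff _ hpd _ hpd]
    simp only [MiddleSphere.parallel, Matrix.cons_val_zero, Matrix.cons_val_one, true_and]
    refine exists_congr fun k => ?_
    rw [div_eq_iff hn.ne', add_mul, div_mul_cancel₀ _ hn.ne', mul_assoc (k : ℝ)]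

end IsBumpySurface

end Surface

/-! ### Flow boxes -/

namespace MiddleSphere

variable (S : MiddleSphere)

lemma unwinding_mem (x : ℝ) : S.unwinding x ∈ Ioo S.lower S.upper :=
  S.isSpeed_windingSpeed.travel_mem x

@[simp] lemma winding_unwinding (x : ℝ) : S.winding (S.unwinding x) = x :=
  S.isSpeed_windingSpeed.travelTime_travel x

lemma unwinding_winding {s : ℝ} (hs : s ∈ Ioo S.lower S.upper) : S.unwinding (S.winding s) = s :=
  S.isSpeed_windingSpeed.travel_travelTime hs

lemma strictMonoOn_winding : StrictMonoOn S.winding (Ioo S.lower S.upper) :=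
  S.isSpeed_windingSpeed.strictMonoOn_travelTime

lemma continuous_unwinding : Continuous S.unwinding := S.isSpeed_windingSpeed.continuous_travel

/-- The holonomy of the foliation by the leaves and the necks: the leaf through the point of the
parallel at `s` is followed backwards through the angle `τ`.  Outside the part between the necks it
is extended by the identity. -/
def holonomy (τ s : ℝ) : ℝ :=
  open scoped Classical in
  if s ∈ Ioo S.lower S.upper then S.unwinding (S.winding s - τ) else s

lemma holonomy_of_mem (τ : ℝ) {s : ℝ} (hs : s ∈ Ioo S.lower S.upper) :
    S.holonomy τ s = S.unwinding (S.winding s - τ) := if_pos hs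

lemma holonomy_of_notMem (τ : ℝ) {s : ℝ} (hs : s ∉ Ioo S.lower S.upper) : S.holonomy τ s = s :=
  if_neg hs

lemma holonomy_mem_iff {τ s : ℝ} :
    S.holonomy τ s ∈ Ioo S.lower S.upper ↔ s ∈ Ioo S.lower S.upper := by
  by_cases hs : s ∈ Ioo S.lower S.upper
  · exact iff_of_true (S.holonomy_of_mem τ hs ▸ S.unwinding_mem _) hs
  · rw [S.holonomy_of_notMem τ hs]

lemma winding_holonomy (τ : ℝ) {s : ℝ} (hs : s ∈ Ioo S.lower S.upper) :
    S.winding (S.holonomy τ s) = S.winding s - τ := by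
  rw [S.holonomy_of_mem τ hs, winding_unwinding]

lemma holonomy_neg_holonomy (τ s : ℝ) : S.holonomy (-τ) (S.holonomy τ s) = s := by
  by_cases hs : s ∈ Ioo S.lower S.upper
  · rw [S.holonomy_of_mem (-τ) (S.holonomy_mem_iff.2 hs), S.winding_holonomy τ hs, sub_neg_eq_add,
      sub_add_cancel, S.unwinding_winding hs]
  · rw [S.holonomy_of_notMem τ hs, S.holonomy_of_notMem (-τ) hs]

lemma holonomy_le_max (τ s : ℝ) : S.holonomy τ s ≤ max s S.upper := by
  by_cases hs : s ∈ Ioo S.lower S.upper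
  · exact (S.holonomy_mem_iff.2 hs).2.le.trans (le_max_right _ _)
  · rw [S.holonomy_of_notMem τ hs]; exact le_max_left _ _

lemma min_le_holonomy (τ s : ℝ) : min s S.lower ≤ S.holonomy τ s := by
  by_cases hs : s ∈ Ioo S.lower S.upper
  · exact (min_le_right _ _).trans (S.holonomy_mem_iff.2 hs).1.le
  · rw [S.holonomy_of_notMem τ hs]; exact min_le_left _ _

/-- The holonomy is continuous up to the necks, because the leaves wind infinitely often around
them. -/
lemma continuous_holonomy : Continuous fun p : ℝ × ℝ => S.holonomy p.1 p.2 := by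
  refine continuous_iff_continuousAt.2 fun ⟨τ₀, s₀⟩ => ?_
  have h1 : Tendsto (fun p : ℝ × ℝ => p.1) (𝓝 (τ₀, s₀)) (𝓝 τ₀) := continuousAt_fst
  have h2 : Tendsto (fun p : ℝ × ℝ => p.2) (𝓝 (τ₀, s₀)) (𝓝 s₀) := continuousAt_snd
  by_cases hs : s₀ ∈ Ioo S.lower S.upper
  · have hc : ContinuousAt (fun p : ℝ × ℝ => S.unwinding (S.winding p.2 - p.1)) (τ₀, s₀) :=
      S.continuous_unwinding.continuousAt.comp'
        ((ContinuousAt.comp' (S.continuousAt_winding hs) continuousAt_snd).sub continuousAt_fst)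
    refine hc.congr ?_
    filter_upwards [h2.eventually (isOpen_Ioo.mem_nhds hs)] with p hp
    exact (S.holonomy_of_mem p.1 hp).symm
  have key : Tendsto (fun p : ℝ × ℝ => S.holonomy p.1 p.2) (𝓝 (τ₀, s₀)) (𝓝 s₀) := by
    have hlu := S.lower_neg.trans S.upper_pos
    refine tendsto_order.2 ⟨fun b hb => ?_, fun b hb => ?_⟩
    · rcases lt_or_ge s₀ S.upper with h | h
      · have hsl : s₀ ≤ S.lower := not_lt.1 fun hl => hs ⟨hl, h⟩
        filter_upwards [h2.eventually (lt_mem_nhds hb)] with p hp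
        exact (lt_min hp (hb.trans_le hsl)).trans_le (S.min_le_holonomy _ _)
      · obtain ⟨c, hc₁, hc₂⟩ := exists_between (max_lt hb (hlu.trans_le h))
        rcases le_or_gt S.upper c with hcu | hcu
        · filter_upwards [h2.eventually (lt_mem_nhds hc₂)] with p hp
          rw [S.holonomy_of_notMem _ fun h => (hcu.trans_lt hp).not_gt h.2]
          exact (le_max_left _ _).trans_lt (hc₁.trans hp)
        · have hc : c ∈ Ioo S.lower S.upper := ⟨(le_max_right _ _).trans_lt hc₁, hcu⟩
          have hm := S.unwinding_mem (S.winding c + (τ₀ + 1))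
          filter_upwards [h1.eventually (gt_mem_nhds (lt_add_one τ₀)),
            h2.eventually (lt_mem_nhds hc₂), h2.eventually (lt_mem_nhds (hm.2.trans_le h))]
            with p hp hp' hp''
          refine (le_max_left _ _).trans_lt (hc₁.trans ?_)
          by_cases hps : p.2 ∈ Ioo S.lower S.upper
          · rw [← S.strictMonoOn_winding.lt_iff_lt hc (S.holonomy_mem_iff.2 hps),
              S.winding_holonomy _ hps]
            have := S.strictMonoOn_winding hm hps hp''
            rw [winding_unwinding] at this
            linarith
          · rw [S.holonomy_of_notMem _ hps]
            exact hp'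
    · rcases lt_or_ge S.lower s₀ with h | h
      · have hsu : S.upper ≤ s₀ := not_lt.1 fun hl => hs ⟨h, hl⟩
        filter_upwards [h2.eventually (gt_mem_nhds hb)] with p hp
        exact (S.holonomy_le_max _ _).trans_lt (max_lt hp (hsu.trans_lt hb))
      · obtain ⟨c, hc₁, hc₂⟩ := exists_between (lt_min hb (h.trans_lt hlu))
        rcases le_or_gt c S.lower with hcl | hcl
        · filter_upwards [h2.eventually (gt_mem_nhds hc₁)] with p hp
          rw [S.holonomy_of_notMem _ fun h => (hp.trans_le hcl).not_gt h.1]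
          exact (hp.trans hc₂).trans_le (min_le_left _ _)
        · have hc : c ∈ Ioo S.lower S.upper := ⟨hcl, hc₂.trans_le (min_le_right _ _)⟩
          have hm := S.unwinding_mem (S.winding c + (τ₀ - 1))
          filter_upwards [h1.eventually (lt_mem_nhds (sub_one_lt τ₀)),
            h2.eventually (gt_mem_nhds hc₁), h2.eventually (gt_mem_nhds (h.trans_lt hm.1))]
            with p hp hp' hp''
          refine lt_of_lt_of_le (lt_trans ?_ hc₂) (min_le_left _ _)
          by_cases hps : p.2 ∈ Ioo S.lower S.upper
          · rw [← S.strictMonoOn_winding.lt_iff_lt (S.holonomy_mem_iff.2 hps) hc,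
              S.winding_holonomy _ hps]
            have := S.strictMonoOn_winding hps hm hp''
            rw [winding_unwinding] at this
            linarith
          · rw [S.holonomy_of_notMem _ hps]
            exact hp'
  rw [ContinuousAt]
  simp only [S.holonomy_of_notMem τ₀ hs]
  exact key

/-- Coordinates around the point `(s₀, θ₀)`, rescaled by `δ`, in which the leaves are horizontal:
the first one is the angle, and the second one is constant along leaves. -/
def flowBox (s₀ θ₀ : ℝ) {δ : ℝ} (hδ : 0 < δ) : ℝ × ℝ ≃ₜ Plane where
  toFun p := !₂[S.holonomy (-(δ * p.1)) (s₀ + δ * p.2), θ₀ + δ * p.1]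
  invFun q := ((q 1 - θ₀) / δ, (S.holonomy (q 1 - θ₀) (q 0) - s₀) / δ)
  left_inv p := by
    have h := S.holonomy_neg_holonomy (-(δ * p.1)) (s₀ + δ * p.2)
    rw [neg_neg] at h
    ext
    · simp [hδ.ne']
    · simp [h, hδ.ne']
  right_inv q := by
    have h := S.holonomy_neg_holonomy (q 1 - θ₀) (q 0)
    ext i
    fin_cases i
    · simp only [mul_div_cancel₀ _ hδ.ne', add_sub_cancel]; exact h
    · simp [mul_div_cancel₀ _ hδ.ne']
  continuous_toFun := continuous_toPlane
    (S.continuous_holonomy.comp (f := fun p : ℝ × ℝ => (-(δ * p.1), s₀ + δ * p.2)) (by fun_prop))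
    (by fun_prop)
  continuous_invFun := by
    have h0 := (contDiff_coord 0 (n := 0)).continuous
    have h1 := (contDiff_coord 1 (n := 0)).continuous
    have h2 : Continuous fun q : Plane => S.holonomy (q 1 - θ₀) (q 0) :=
      S.continuous_holonomy.comp ((h1.sub continuous_const).prodMk h0)
    fun_prop

end MiddleSphere

/-- The open unit square in which lamination charts take their values. -/
abbrev unitSquare : Set (ℝ × ℝ) := Ioo (-1) 1 ×ˢ Ioo (-1) 1

/-- A parameterization of an open set by the square in which the leaves are horizontal gives a
lamination chart. -/
lemma exists_lamination_chart {M : Type*} [TopologicalSpace M] {G : ℝ × ℝ → M} {L : Set (Set M)}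
    (hinj : InjOn G unitSquare) (hopen : ∀ p ∈ unitSquare, map G (𝓝 p) = 𝓝 (G p))
    (hL : ∀ ℓ ∈ L, ∃ T : Set ℝ, ∀ p ∈ unitSquare, G p ∈ ℓ ↔ p.2 ∈ T) :
    ∃ Φ : OpenPartialHomeomorph M (ℝ × ℝ), G 0 ∈ Φ.source ∧ Φ.target = unitSquare ∧
      ∀ ℓ ∈ L, ∃ T : Set ℝ, Φ '' (ℓ ∩ Φ.source) = (univ ×ˢ T) ∩ Φ.target := by
  have hQ : IsOpen unitSquare := isOpen_Ioo.prod isOpen_Ioo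
  let e : OpenPartialHomeomorph (ℝ × ℝ) M :=
    OpenPartialHomeomorph.ofContinuousOpenRestrict (hinj.toPartialEquiv G unitSquare)
      (fun p hp => ContinuousAt.continuousWithinAt (hopen p hp).le) (by
        intro U hU
        rw [isOpen_iff_mem_nhds]
        rintro _ ⟨⟨p, hp⟩, hpU, rfl⟩
        change _ ∈ 𝓝 (G p)
        rw [← hopen p hp]
        obtain ⟨V, hV, rfl⟩ := isOpen_induced_iff.1 hU
        filter_upwards [image_mem_map ((hV.inter hQ).mem_nhds ⟨hpU, hp⟩)]
        rintro _ ⟨x, ⟨hxV, hxQ⟩, rfl⟩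
        exact ⟨⟨x, hxQ⟩, hxV, rfl⟩) hQ
  have h0 : (0 : ℝ × ℝ) ∈ unitSquare := by simp
  refine ⟨e.symm, e.map_source h0, rfl, fun ℓ hℓ => ?_⟩
  obtain ⟨T, hT⟩ := hL ℓ hℓ
  refine ⟨T, ?_⟩
  ext p
  constructor
  · rintro ⟨x, ⟨hxℓ, hx⟩, rfl⟩
    have hp : e.symm x ∈ unitSquare := e.map_target hx
    refine ⟨⟨mem_univ _, (hT _ hp).1 ?_⟩, hp⟩
    rwa [show G (e.symm x) = x from e.right_inv hx]
  · rintro ⟨⟨-, hpT⟩, hp⟩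
    exact ⟨G p, ⟨(hT p hp).2 hpT, e.map_source hp⟩, e.left_inv hp⟩

/-! ### The lamination -/

namespace EquatorBumps

variable {S : MiddleSphere} (B : EquatorBumps S)

/-- The angular coordinates of the bump centers, with all their representatives modulo `2π`. -/
def centers : Set ℝ := {a | ∃ i, ∃ k : ℤ, a = B.center i + k * (2 * Real.pi)}

lemma closure_centers_add {a : ℝ} (ha : a ∈ closure B.centers) (k : ℤ) :
    a + k * (2 * Real.pi) ∈ closure B.centers := by
  refine map_mem_closure (f := fun a => a + k * (2 * Real.pi)) (by fun_prop) ha ?_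
  rintro _ ⟨i, m, rfl⟩
  exact ⟨i, m + k, by push_cast; ring⟩

lemma isClosed_translates (c : ℝ) : IsClosed {a : ℝ | ∃ k : ℤ, a = c + k * (2 * Real.pi)} := by
  have h := Int.isClosedEmbedding_coe_real.isClosed_range.preimage
    (f := fun a : ℝ => (a - c) / (2 * Real.pi)) (by fun_prop)
  convert! h using 1
  ext a
  refine exists_congr fun k => ?_
  have := Real.pi_pos.ne'
  rw [eq_div_iff (by positivity), eq_sub_iff_add_eq, eq_comm, add_comm]

/-- A limit of leaves through bump centers meets a bump only if it goes through its center: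
otherwise, nearby leaves through the centers of other bumps would meet that bump. -/
lemma eq_center_of_mem_closure {a s : ℝ} {i : ℕ} (ha : a ∈ closure B.centers)
    (hs : S.leaf a s ∈ B.bumpDisk i) : ∃ k : ℤ, a = B.center i + k * (2 * Real.pi) := by
  by_contra h
  have hopen : IsOpen ((fun a => S.leaf a s) ⁻¹' B.bumpDisk i ∩
      {a : ℝ | ∃ k : ℤ, a = B.center i + k * (2 * Real.pi)}ᶜ) :=
    ((B.isOpen_bumpDisk i).preimage (S.continuous_leaf s)).inter
      (isClosed_translates _).isOpen_compl
  obtain ⟨_, ⟨hb, hb'⟩, j, k, rfl⟩ := mem_closure_iff.1 ha _ hopen ⟨hs, h⟩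
  obtain rfl := B.eq_of_leaf_mem hb (B.center_mem j k)
  exact hb' ⟨k, rfl⟩

/-- The coordinates of the points on the necks and on the limits of leaves through bump centers. -/
def leafSupport : Set Plane := {q | q 0 = S.lower ∨ q 0 = S.upper ∨
  (q 0 ∈ Ioo S.lower S.upper ∧ S.leafAngle q ∈ closure B.centers)}

lemma mem_Icc_of_mem_support {q : Plane} (hq : q ∈ B.leafSupport) : q 0 ∈ Icc S.lower S.upper := by
  have hlu := (S.lower_neg.trans S.upper_pos).le
  rcases hq with h | h | h
  · rw [h]; exact ⟨le_rfl, hlu⟩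
  · rw [h]; exact ⟨hlu, le_rfl⟩
  · exact Ioo_subset_Icc_self h.1

lemma isClosed_support : IsClosed B.leafSupport := by
  rw [← isOpen_compl_iff, isOpen_iff_mem_nhds]
  intro q hq
  have h0 := (contDiff_coord 0 (n := 0)).continuous
  by_cases h : q 0 ∈ Icc S.lower S.upper
  · simp only [leafSupport, mem_compl_iff, mem_ofPred_eq, not_or] at hq
    have hm : q 0 ∈ Ioo S.lower S.upper :=
      ⟨h.1.lt_of_ne (Ne.symm hq.1), h.2.lt_of_ne hq.2.1⟩
    have ha : S.leafAngle q ∈ (closure B.centers)ᶜ := fun ha => hq.2.2 ⟨hm, ha⟩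
    filter_upwards [h0.continuousAt.eventually (isOpen_Ioo.mem_nhds hm),
      (S.continuousAt_leafAngle hm).eventually (isClosed_closure.isOpen_compl.mem_nhds ha)]
      with x hx hx' hxs
    rcases hxs with h | h | h
    · exact hx.1.ne' h
    · exact hx.2.ne h
    · exact hx' h.2
  · filter_upwards [h0.continuousAt.eventually (isClosed_Icc.isOpen_compl.mem_nhds h)] with x hx hxs
    exact hx (B.mem_Icc_of_mem_support hxs)

end EquatorBumps

/-- Coordinates of the plane centered at `c` and rescaled by `δ`. -/
def rescaledCoordinates (c : Plane) {δ : ℝ} (hδ : 0 < δ) : ℝ × ℝ ≃ₜ Plane where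
  toFun p := !₂[c 0 + δ * p.1, c 1 + δ * p.2]
  invFun q := ((q 0 - c 0) / δ, (q 1 - c 1) / δ)
  left_inv p := by ext <;> simp [hδ.ne']
  right_inv q := by
    ext i
    fin_cases i <;> simp [mul_div_cancel₀ _ hδ.ne']
  continuous_toFun := continuous_toPlane (by fun_prop) (by fun_prop)
  continuous_invFun := by
    have h0 := (contDiff_coord 0 (n := 0)).continuous
    have h1 := (contDiff_coord 1 (n := 0)).continuous
    fun_prop

/-- Around a point off a closed set there is a square chart that misses the closed set. -/
lemma exists_chart_of_notMem {M : Type*} [TopologicalSpace M] [ChartedSpace Plane M]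
    {L : Set (Set M)} (hL : IsClosed (⋃₀ L)) {x : M} (hx : x ∉ ⋃₀ L) :
    ∃ Φ : OpenPartialHomeomorph M (ℝ × ℝ), x ∈ Φ.source ∧ Φ.target = unitSquare ∧
      ∀ ℓ ∈ L, ∃ T : Set ℝ, Φ '' (ℓ ∩ Φ.source) = (univ ×ˢ T) ∩ Φ.target := by
  set e := chartAt Plane x with he
  have hxe : x ∈ e.source := mem_chart_source Plane x
  have hN : e.target ∩ e.symm ⁻¹' (⋃₀ L)ᶜ ∈ 𝓝 (e x) :=
    inter_mem (e.open_target.mem_nhds (e.map_source hxe))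
      ((e.symm.continuousAt (e.map_source hxe)).preimage_mem_nhds
        (hL.isOpen_compl.mem_nhds (by rwa [e.left_inv hxe])))
  have ha : Continuous fun p : ℝ × ℝ => (!₂[e x 0 + p.1, e x 1 + p.2] : Plane) :=
    continuous_toPlane (by fun_prop) (by fun_prop)
  have ha0 : (!₂[e x 0 + (0 : ℝ × ℝ).1, e x 1 + (0 : ℝ × ℝ).2] : Plane) = e x := by
    ext i
    fin_cases i <;> simp
  obtain ⟨δ, hδ, hball⟩ := Metric.mem_nhds_iff.1 (ha.continuousAt.preimage_mem_nhds
    (x := (0 : ℝ × ℝ)) (by rwa [ha0]))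
  set H := rescaledCoordinates (e x) hδ with hH
  have hmem : ∀ p ∈ unitSquare, H p ∈ e.target ∩ e.symm ⁻¹' (⋃₀ L)ᶜ := by
    intro p hp
    have : δ • p ∈ Metric.ball (0 : ℝ × ℝ) δ := by
      rw [mem_ball_zero_iff, norm_smul, Real.norm_of_nonneg hδ.le]
      have : ‖p‖ < 1 := max_lt (abs_lt.2 hp.1) (abs_lt.2 hp.2)
      nlinarith
    exact hball this
  have h0 : e.symm (H 0) = x := by
    have : H 0 = e x := by
      ext i
      fin_cases i
      · change e x 0 + δ * 0 = e x 0
        simp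
      · change e x 1 + δ * 0 = e x 1
        simp
    rw [this, e.left_inv hxe]
  have hchart := exists_lamination_chart (G := fun p => e.symm (H p)) (L := L)
    (fun p hp p' hp' h => H.injective (e.symm.injOn (hmem p hp).1 (hmem p' hp').1 h))
    (fun p hp => by
      rw [← e.symm.map_nhds_eq (hmem p hp).1, ← H.map_nhds_eq p, Filter.map_map]
      rfl)
    fun ℓ hℓ => ⟨∅, fun p hp => iff_of_false (fun h => (hmem p hp).2 ⟨ℓ, hℓ, h⟩) id⟩
  simpa only [h0] using hchart

section Surface

variable {M : Type*} {ψ : Plane → M} {S : MiddleSphere} (B : EquatorBumps S)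

/-- The leaf with angle `a` at the equator, as a subset of the surface. -/
def leafSet (S : MiddleSphere) (ψ : Plane → M) (a : ℝ) : Set M :=
  ψ '' (S.leaf a '' Ioo S.lower S.upper)

/-- The parallel at `p`, as a subset of the surface. -/
def parallelSet (S : MiddleSphere) (ψ : Plane → M) (p : ℝ) : Set M :=
  range fun t => ψ (S.parallel p t)

/-- The lamination by the two necks and by the limits of the leaves through the bump centers. -/
def bumpLamination (ψ : Plane → M) : Set (Set M) :=
  leafSet S ψ '' closure B.centers ∪ {parallelSet S ψ S.lower, parallelSet S ψ S.upper}

variable {B} [TopologicalSpace M] [ChartedSpace Plane M] [IsManifold (𝓡 2) ∞ M]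
  {g : SurfaceMetric M}

namespace IsBumpySurface

lemma mem_leafSet_iff (hM : IsBumpySurface g S B ψ) {a : ℝ} {q : Plane} (hq : q ∈ S.domain) :
    ψ q ∈ leafSet S ψ a ↔ q 0 ∈ Ioo S.lower S.upper ∧
      ∃ k : ℤ, S.leafAngle q = a + k * (2 * Real.pi) := by
  constructor
  · rintro ⟨_, ⟨s, hs, rfl⟩, h⟩
    obtain ⟨h0, k, hk⟩ := (hM.eq_iff _ (S.leaf_mem_domain a hs) _ hq).1 h
    refine ⟨h0 ▸ hs, k, ?_⟩
    rw [MiddleSphere.leafAngle, hk, h0]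
    simp only [MiddleSphere.leaf_zero, MiddleSphere.leaf_one]
    ring
  · rintro ⟨hs, k, hk⟩
    refine ⟨_, ⟨q 0, hs, rfl⟩, (hM.eq_iff _ (S.leaf_mem_domain a hs) _ hq).2 ⟨rfl, k, ?_⟩⟩
    rw [MiddleSphere.leafAngle] at hk
    rw [MiddleSphere.leaf_one]
    linarith

lemma mem_parallelSet_iff (hM : IsBumpySurface g S B ψ) {p : ℝ}
    (hp : p ∈ Ioo S.domLow S.domHigh) {q : Plane} (hq : q ∈ S.domain) :
    ψ q ∈ parallelSet S ψ p ↔ q 0 = p := by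
  constructor
  · rintro ⟨t, ht⟩
    exact ((hM.eq_iff _ hp _ hq).1 ht).1
  · intro h
    refine ⟨q 1 * S.neckRadius, (hM.eq_iff _ hp _ hq).2 ⟨h, 0, ?_⟩⟩
    simp [MiddleSphere.parallel, S.neckRadius_pos.ne']

lemma leafSet_add (hM : IsBumpySurface g S B ψ) (a : ℝ) (k : ℤ) :
    leafSet S ψ (a + k * (2 * Real.pi)) = leafSet S ψ a := by
  have key : ∀ (a : ℝ) (k : ℤ), leafSet S ψ (a + k * (2 * Real.pi)) ⊆ leafSet S ψ a := by
    rintro a k _ ⟨_, ⟨s, hs, rfl⟩, rfl⟩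
    refine (hM.mem_leafSet_iff (S.leaf_mem_domain _ hs)).2 ⟨hs, k, ?_⟩
    simp [MiddleSphere.leafAngle]
  refine (key a k).antisymm ?_
  simpa using key (a + k * (2 * Real.pi)) (-k)

lemma neck_mem_domain (S : MiddleSphere) :
    S.lower ∈ Ioo S.domLow S.domHigh ∧ S.upper ∈ Ioo S.domLow S.domHigh :=
  have hlu := (S.lower_neg.trans S.upper_pos).le
  ⟨S.Icc_subset ⟨le_rfl, hlu⟩, S.Icc_subset ⟨hlu, le_rfl⟩⟩

/-- Every leaf of the lamination that is not a neck is a leaf to which the conformal exponent is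
adapted. -/
lemma exists_isAdapted (hM : IsBumpySurface g S B ψ) {a : ℝ} (ha : a ∈ closure B.centers) :
    ∃ a', S.IsAdapted B.exponent a' ∧ leafSet S ψ a' = leafSet S ψ a := by
  have hB := hM.contDiffOn_factor
  by_cases h : ∃ s i, S.leaf a s ∈ B.bumpDisk i
  · obtain ⟨s, i, hs⟩ := h
    obtain ⟨k, rfl⟩ := B.eq_center_of_mem_closure ha hs
    exact ⟨_, EquatorBumps.isAdapted_center hB i, (hM.leafSet_add _ k).symm⟩
  · push Not at h
    exact ⟨a, EquatorBumps.isAdapted_of_notMem hB h, rfl⟩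

lemma geodesic_of_mem (hM : IsBumpySurface g S B ψ) {ℓ : Set M} (hℓ : ℓ ∈ bumpLamination B ψ) :
    ∃ γ : ℝ → M, IsUnitGeodesic g γ ∧ IsSimpleCurve γ ∧ range γ = ℓ := by
  rcases hℓ with ⟨a, ha, rfl⟩ | rfl | rfl
  · obtain ⟨a', hw, h⟩ := hM.exists_isAdapted ha
    exact ⟨_, hM.isUnitGeodesic_leaf hw, Or.inl (hM.injective_leaf hw),
      (hw.range_comp_leafCurve ψ).trans h⟩
  · exact ⟨_, (hM.neck_geodesic (Or.inl rfl)).1, (hM.neck_geodesic (Or.inl rfl)).2, rfl⟩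
  · exact ⟨_, (hM.neck_geodesic (Or.inr rfl)).1, (hM.neck_geodesic (Or.inr rfl)).2, rfl⟩

/-- Membership in the union of the leaves, in coordinates. -/
lemma exists_mem_bumpLamination_iff (hM : IsBumpySurface g S B ψ) {q : Plane} (hq : q ∈ S.domain) :
    ψ q ∈ ⋃₀ bumpLamination B ψ ↔ q ∈ B.leafSupport := by
  obtain ⟨hl, hu⟩ := neck_mem_domain S
  constructor
  · rintro ⟨_, ⟨a, ha, rfl⟩ | rfl | rfl, h⟩
    · obtain ⟨hs, k, hk⟩ := (hM.mem_leafSet_iff hq).1 h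
      exact Or.inr (Or.inr ⟨hs, hk ▸ B.closure_centers_add ha k⟩)
    · exact Or.inl ((hM.mem_parallelSet_iff hl hq).1 h)
    · exact Or.inr (Or.inl ((hM.mem_parallelSet_iff hu hq).1 h))
  · rintro (h | h | ⟨hs, ha⟩)
    · exact ⟨_, Or.inr (Or.inl rfl), (hM.mem_parallelSet_iff hl hq).2 h⟩
    · exact ⟨_, Or.inr (Or.inr rfl), (hM.mem_parallelSet_iff hu hq).2 h⟩
    · exact ⟨_, Or.inl ⟨_, ha, rfl⟩, (hM.mem_leafSet_iff hq).2 ⟨hs, 0, by simp⟩⟩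

lemma support_subset_domain : B.leafSupport ⊆ S.domain :=
  fun _ hq => S.Icc_subset (B.mem_Icc_of_mem_support hq)

lemma sUnion_bumpLamination (hM : IsBumpySurface g S B ψ) :
    ⋃₀ bumpLamination B ψ = ψ '' B.leafSupport := by
  obtain ⟨hl, hu⟩ := neck_mem_domain S
  refine Subset.antisymm (fun x hx => ?_) ?_
  · obtain ⟨q, hq, rfl⟩ : ∃ q ∈ S.domain, ψ q = x := by
      obtain ⟨_, ⟨a, ha, rfl⟩ | rfl | rfl, h⟩ := hx
      · obtain ⟨_, ⟨s, hs, rfl⟩, rfl⟩ := h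
        exact ⟨_, S.leaf_mem_domain a hs, rfl⟩
      · obtain ⟨t, rfl⟩ := h
        exact ⟨_, hl, rfl⟩
      · obtain ⟨t, rfl⟩ := h
        exact ⟨_, hu, rfl⟩
    exact mem_image_of_mem ψ ((hM.exists_mem_bumpLamination_iff hq).1 hx)
  · rintro _ ⟨q, hq, rfl⟩
    exact (hM.exists_mem_bumpLamination_iff (support_subset_domain hq)).2 hq

lemma continuousAt (hM : IsBumpySurface g S B ψ) {q : Plane} (hq : q ∈ S.domain) :
    ContinuousAt ψ q := (hM.contMDiffAt hq).continuousAt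

/-- The union of the leaves is closed, because it is the image of a compact set: one period of the
angle suffices. -/
lemma isClosed_sUnion [T2Space M] (hM : IsBumpySurface g S B ψ) :
    IsClosed (⋃₀ bumpLamination B ψ) := by
  have hK : IsCompact ((fun p : ℝ × ℝ => (!₂[p.1, p.2] : Plane)) ''
      (Icc S.lower S.upper ×ˢ Icc 0 (2 * Real.pi))) :=
    (isCompact_Icc.prod isCompact_Icc).image
      (continuous_toPlane continuous_fst continuous_snd)
  have hc := (hK.inter_left B.isClosed_support).image_of_continuousOn (f := ψ)
    fun q hq => (hM.continuousAt (support_subset_domain hq.1)).continuousWithinAt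
  convert! hc.isClosed using 1
  rw [hM.sUnion_bumpLamination]
  refine Subset.antisymm ?_ (image_mono inter_subset_left)
  rintro _ ⟨q, hq, rfl⟩
  have hqd := support_subset_domain hq
  have hp : 0 < 2 * Real.pi := by positivity
  obtain ⟨k, hk, -⟩ := existsUnique_sub_zsmul_mem_Ico hp (q 1) 0
  rw [zero_add, zsmul_eq_mul] at hk
  have hd : (!₂[q 0, q 1 - k * (2 * Real.pi)] : Plane) ∈ S.domain := hqd
  have he : ψ !₂[q 0, q 1 - k * (2 * Real.pi)] = ψ q :=
    (hM.eq_iff _ hd _ hqd).2 ⟨rfl, k, by simp⟩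
  refine ⟨!₂[q 0, q 1 - k * (2 * Real.pi)], ⟨?_, ?_⟩, he⟩
  · rw [← hM.exists_mem_bumpLamination_iff hd, he, hM.exists_mem_bumpLamination_iff hqd]
    exact hq
  · exact ⟨(q 0, q 1 - k * (2 * Real.pi)),
      ⟨B.mem_Icc_of_mem_support hq, Ico_subset_Icc_self hk⟩, rfl⟩

/-- The necks are limits of the leaves that spiral towards them. -/
lemma sUnion_eq_closure [T2Space M] (hM : IsBumpySurface g S B ψ) :
    ⋃₀ bumpLamination B ψ = closure (⋃ i, leafSet S ψ (B.center i)) := by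
  have hmem : ∀ i, B.center i ∈ closure B.centers := fun i =>
    subset_closure ⟨i, 0, by simp⟩
  refine Subset.antisymm ?_ (closure_minimal (iUnion_subset fun i x hx =>
    ⟨_, Or.inl ⟨_, hmem i, rfl⟩, hx⟩) hM.isClosed_sUnion)
  -- a point on a parallel to which the leaf through the first center spirals
  have hspiral : ∀ (q : Plane) (x : ℕ → ℝ), q ∈ S.domain → (∀ n, ∃ k : ℤ,
      x n = q 1 + k * (2 * Real.pi)) →
      Tendsto (fun n => S.unwinding (x n - B.center 0)) atTop (𝓝 (q 0)) →
      ψ q ∈ closure (⋃ i, leafSet S ψ (B.center i)) := by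
    intro q x hq hx hlim
    have hlim' : Tendsto (fun n => (!₂[S.unwinding (x n - B.center 0), q 1] : Plane)) atTop
        (𝓝 q) := by
      have h : Continuous fun s : ℝ => (!₂[s, q 1] : Plane) :=
        continuous_toPlane continuous_id continuous_const
      have := (h.tendsto (q 0)).comp hlim
      rwa [show (!₂[q 0, q 1] : Plane) = q by ext i; fin_cases i <;> rfl] at this
    refine mem_closure_of_tendsto ((hM.continuousAt hq).tendsto.comp hlim')
      (Eventually.of_forall fun n => mem_iUnion.2 ⟨0, ?_⟩)
    have hm := S.unwinding_mem (x n - B.center 0)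
    refine (hM.mem_leafSet_iff (S.Ioo_subset hm)).2 ⟨hm, ?_⟩
    obtain ⟨k, hk⟩ := hx n
    refine ⟨-k, ?_⟩
    simp only [MiddleSphere.leafAngle, Matrix.cons_val_zero, Matrix.cons_val_one,
      MiddleSphere.winding_unwinding]
    push_cast
    linarith
  have hpi := Real.two_pi_pos
  have hlim : ∀ θ : ℝ, Tendsto (fun n : ℕ => θ + (n : ℝ) * (2 * Real.pi) - B.center 0) atTop
      atTop := fun θ => tendsto_atTop_add_const_right _ _
    (tendsto_atTop_add_const_left _ _ (tendsto_natCast_atTop_atTop.atTop_mul_const hpi))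
  have hlim' : ∀ θ : ℝ, Tendsto (fun n : ℕ => θ + -(n : ℝ) * (2 * Real.pi) - B.center 0) atTop
      atBot := fun θ => tendsto_atBot_add_const_right _ _
    (tendsto_atBot_add_const_left _ _
      ((tendsto_neg_atTop_atBot.comp tendsto_natCast_atTop_atTop).atBot_mul_const hpi))
  rw [hM.sUnion_bumpLamination]
  rintro _ ⟨q, hq, rfl⟩
  have hqd := support_subset_domain hq
  rcases hq with h | h | ⟨hs, ha⟩
  · refine hspiral q (fun n => q 1 + -(n : ℝ) * (2 * Real.pi)) hqd
      (fun n => ⟨-n, by push_cast; rfl⟩) ?_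
    rw [h]
    exact S.isSpeed_windingSpeed.tendsto_travel_atBot.comp (hlim' (q 1))
  · refine hspiral q (fun n => q 1 + (n : ℝ) * (2 * Real.pi)) hqd
      (fun n => ⟨n, by push_cast; rfl⟩) ?_
    rw [h]
    exact S.isSpeed_windingSpeed.tendsto_travel_atTop.comp (hlim (q 1))
  · have hc : Continuous fun a => ψ (S.leaf a (q 0)) := continuous_iff_continuousAt.2 fun a =>
      ContinuousAt.comp' (g := ψ) (f := fun a => S.leaf a (q 0))
        (hM.continuousAt (S.leaf_mem_domain a hs))
        (S.continuous_leaf (q 0)).continuousAt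
    rw [← S.leaf_leafAngle q]
    refine map_mem_closure (f := fun a => ψ (S.leaf a (q 0))) hc ha ?_
    rintro _ ⟨i, k, rfl⟩
    refine mem_iUnion.2 ⟨i, hM.leafSet_add (B.center i) k ▸ ?_⟩
    exact mem_image_of_mem ψ (mem_image_of_mem _ hs)

lemma map_nhds_eq (hM : IsBumpySurface g S B ψ) {q : Plane} (hq : q ∈ S.domain) :
    map ψ (𝓝 q) = 𝓝 (ψ q) := by
  obtain ⟨e, -, hqe, he⟩ := exists_chart_of_isLocalDiffeomorphAt (hM.localDiffeo ⟨q, hq⟩)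
  have h := e.symm.map_nhds_eq hqe
  have hev : e.symm =ᶠ[𝓝 q] ψ := by
    filter_upwards [e.open_target.mem_nhds hqe] with x hx using he x hx
  rwa [he q hqe, map_congr hev] at h

lemma exists_chart_of_mem (hM : IsBumpySurface g S B ψ) {q : Plane} (hq : q ∈ S.domain) :
    ∃ Φ : OpenPartialHomeomorph M (ℝ × ℝ), ψ q ∈ Φ.source ∧ Φ.target = unitSquare ∧
      ∀ ℓ ∈ bumpLamination B ψ, ∃ T : Set ℝ, Φ '' (ℓ ∩ Φ.source) = (univ ×ˢ T) ∩ Φ.target := by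
  obtain ⟨hl, hu⟩ := neck_mem_domain S
  obtain ⟨ε, hε, hball⟩ := Metric.isOpen_iff.1 isOpen_Ioo _ hq
  obtain ⟨δ, hδ, hδ'⟩ := exists_between (lt_min hε Real.pi_pos)
  have hδε := hδ'.trans_le (min_le_left _ _)
  have hδπ := hδ'.trans_le (min_le_right _ _)
  set H := S.flowBox (q 0) (q 1) hδ with hH
  have h0 : ∀ p, H p 0 = S.holonomy (-(δ * p.1)) (q 0 + δ * p.2) := fun p => rfl
  have h1 : ∀ p, H p 1 = q 1 + δ * p.1 := fun p => rfl
  have hiff : ∀ p, H p 0 ∈ Ioo S.lower S.upper ↔ q 0 + δ * p.2 ∈ Ioo S.lower S.upper :=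
    fun p => S.holonomy_mem_iff
  have hdom : ∀ p ∈ unitSquare, H p ∈ S.domain := by
    intro p hp
    by_cases hm : q 0 + δ * p.2 ∈ Ioo S.lower S.upper
    · exact S.Ioo_subset ((hiff p).2 hm)
    · have : H p 0 = q 0 + δ * p.2 := S.holonomy_of_notMem _ hm
      change H p 0 ∈ Ioo S.domLow S.domHigh
      rw [this]
      refine hball ?_
      rw [Metric.mem_ball, Real.dist_eq, add_sub_cancel_left, abs_mul, abs_of_pos hδ]
      nlinarith [abs_lt.2 hp.2, abs_nonneg p.2]
  have hcenter : H 0 = q := by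
    ext i
    fin_cases i
    · change S.holonomy (-(δ * 0)) (q 0 + δ * 0) = q 0
      have := S.holonomy_neg_holonomy 0 (q 0)
      simp only [mul_zero, neg_zero, add_zero] at this ⊢
      by_cases hm : q 0 ∈ Ioo S.lower S.upper
      · rw [S.holonomy_of_mem _ hm, sub_zero, S.unwinding_winding hm]
      · exact S.holonomy_of_notMem _ hm
    · change q 1 + δ * 0 = q 1
      ring
  have hneck : ∀ {p : ℝ × ℝ} {s : ℝ}, s ∉ Ioo S.lower S.upper →
      (H p 0 = s ↔ q 0 + δ * p.2 = s) := by
    intro p s hs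
    by_cases hm : q 0 + δ * p.2 ∈ Ioo S.lower S.upper
    · exact iff_of_false (fun h => hs (h ▸ (hiff p).2 hm)) fun h => hs (h ▸ hm)
    · rw [h0, S.holonomy_of_notMem _ hm]
  rw [← hcenter]
  refine exists_lamination_chart (G := fun p => ψ (H p)) ?_ ?_ ?_
  · intro p hp p' hp' h
    obtain ⟨e0, k, hk⟩ := (hM.eq_iff _ (hdom p hp) _ (hdom p' hp')).1 h
    -- the box is narrower than one full turn
    have hk0 : k = 0 := by
      rw [h1, h1] at hk
      have h2 : |(k : ℝ)| * (2 * Real.pi) < 1 * (2 * Real.pi) := by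
        rw [← abs_of_pos Real.two_pi_pos, ← abs_mul,
          show (k : ℝ) * (2 * Real.pi) = δ * (p'.1 - p.1) by linarith, abs_mul, abs_of_pos hδ,
          abs_of_pos Real.two_pi_pos]
        have : |p'.1 - p.1| < 2 := abs_lt.2 ⟨by linarith [hp'.1.1, hp.1.2], by
          linarith [hp'.1.2, hp.1.1]⟩
        nlinarith [abs_nonneg (p'.1 - p.1)]
      have h3 := lt_of_mul_lt_mul_right h2 Real.two_pi_pos.le
      exact Int.abs_lt_one_iff.1 (by exact_mod_cast h3)
    rw [hk0, Int.cast_zero, zero_mul, add_zero] at hk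
    refine H.injective ?_
    ext i
    fin_cases i
    · exact e0.symm
    · exact hk.symm
  · intro p hp
    rw [← hM.map_nhds_eq (hdom p hp), ← H.map_nhds_eq p, Filter.map_map]
    rfl
  · rintro _ (⟨a, -, rfl⟩ | rfl | rfl)
    · refine ⟨{v | q 0 + δ * v ∈ Ioo S.lower S.upper ∧
        ∃ k : ℤ, q 1 - S.winding (q 0 + δ * v) = a + k * (2 * Real.pi)}, fun p hp => ?_⟩
      rw [hM.mem_leafSet_iff (hdom p hp), hiff]
      refine and_congr_right fun hm => exists_congr fun k => ?_
      rw [MiddleSphere.leafAngle, h0, h1, S.winding_holonomy _ hm,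
        show q 1 + δ * p.1 - (S.winding (q 0 + δ * p.2) - -(δ * p.1)) =
          q 1 - S.winding (q 0 + δ * p.2) by ring]
    · exact ⟨{v | q 0 + δ * v = S.lower}, fun p hp =>
        (hM.mem_parallelSet_iff hl (hdom p hp)).trans (hneck fun h => h.1.false)⟩
    · exact ⟨{v | q 0 + δ * v = S.upper}, fun p hp =>
        (hM.mem_parallelSet_iff hu (hdom p hp)).trans (hneck fun h => h.2.false)⟩

end IsBumpySurface

lemma IsUnitGeodesic.velocity_ne_zero {γ : ℝ → M} (h : IsUnitGeodesic g γ) (t : ℝ) :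
    velocity γ t ≠ 0 := by
  intro h0
  have := h.2.1 t
  rw [h0] at this
  simp at this

namespace IsBumpySurface

lemma isGeodesicLamination [T2Space M] (hM : IsBumpySurface g S B ψ) :
    IsGeodesicLamination g (bumpLamination B ψ) := by
  obtain ⟨hl, hu⟩ := neck_mem_domain S
  have hlu := S.lower_neg.trans S.upper_pos
  refine ⟨⟨fun ℓ hℓ => ?_, ?_, hM.isClosed_sUnion, fun x => ?_⟩, fun ℓ => hM.geodesic_of_mem⟩
  · obtain ⟨γ, h1, h2, h3⟩ := hM.geodesic_of_mem hℓ
    exact ⟨γ, h1.1, h1.velocity_ne_zero, h2, h3⟩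
  · intro ℓ hℓ ℓ' hℓ' hne
    refine disjoint_left.2 fun x hx hx' => hne ?_
    obtain ⟨q, hq, rfl⟩ : x ∈ ψ '' B.leafSupport :=
      hM.sUnion_bumpLamination ▸ ⟨ℓ, hℓ, hx⟩
    have hqd := support_subset_domain hq
    simp only [id] at hx hx'
    rcases hℓ with ⟨a, -, rfl⟩ | rfl | rfl <;> rcases hℓ' with ⟨a', -, rfl⟩ | rfl | rfl <;>
      simp only [hM.mem_leafSet_iff hqd, hM.mem_parallelSet_iff hl hqd,
        hM.mem_parallelSet_iff hu hqd] at hx hx'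
    · obtain ⟨-, k, hk⟩ := hx
      obtain ⟨-, k', hk'⟩ := hx'
      rw [← hM.leafSet_add a k, ← hk, hk', hM.leafSet_add]
    · exact absurd hx' hx.1.1.ne'
    · exact absurd hx' hx.1.2.ne
    · exact absurd hx hx'.1.1.ne'
    · rfl
    · exact absurd (hx.symm.trans hx') hlu.ne
    · exact absurd hx hx'.1.2.ne
    · exact absurd (hx'.symm.trans hx) hlu.ne
    · rfl
  · by_cases hx : x ∈ ⋃₀ bumpLamination B ψ
    · rw [hM.sUnion_bumpLamination] at hx
      obtain ⟨q, hq, rfl⟩ := hx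
      exact hM.exists_chart_of_mem (support_subset_domain hq)
    · exact exists_chart_of_notMem hM.isClosed_sUnion hx

lemma injective_leafSet_center (hM : IsBumpySurface g S B ψ) :
    Function.Injective fun i => leafSet S ψ (B.center i) := by
  intro i j h
  have hm : ψ (S.leaf (B.center i) 0) ∈ leafSet S ψ (B.center i) :=
    mem_image_of_mem ψ (mem_image_of_mem _ S.zero_mem)
  simp only at h
  rw [h, hM.mem_leafSet_iff (S.leaf_mem_domain _ S.zero_mem)] at hm
  obtain ⟨-, k, hk⟩ := hm
  simp only [MiddleSphere.leafAngle, MiddleSphere.leaf_zero, MiddleSphere.leaf_one,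
    add_sub_cancel_right] at hk
  exact B.eq_of_mem (B.center_mem' i) (hk ▸ B.center_mem j k)

end IsBumpySurface

end Surface

end

theorem mainTheorem6 {M : Type*} [TopologicalSpace M] [T2Space M] [ChartedSpace Plane M]
    [IsManifold (𝓡 2) ∞ M] (g : SurfaceMetric M) (S : MiddleSphere) (B : EquatorBumps S)
    (ψ : Plane → M) (hM : IsBumpySurface g S B ψ) :
    ∃ ζ : ℕ → ℝ → Plane, (∀ i, S.IsLimitingGeodesic (B.center i) (ζ i)) ∧
      ∃ L : Set (Set M), IsGeodesicLamination g L ∧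
        ⋃₀ L = closure (⋃ i, range (fun t => ψ (ζ i t))) ∧
        (∀ i, range (fun t => ψ (ζ i t)) ∈ L ∧
          IsUnstableNoncompactLeaf g (range (fun t => ψ (ζ i t)))) ∧
        {ℓ ∈ L | IsUnstableNoncompactLeaf g ℓ}.Infinite := by
  have hr : ∀ i, range (fun t => ψ (S.limitingGeodesic (B.center i) t)) =
      leafSet S ψ (B.center i) := fun i => (S.isAdapted_zero _).range_comp_leafCurve ψ
  have hmem : ∀ i, leafSet S ψ (B.center i) ∈ bumpLamination B ψ := fun i =>
    Or.inl ⟨_, subset_closure ⟨i, 0, by simp⟩, rfl⟩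
  refine ⟨fun i => S.limitingGeodesic (B.center i), fun i => S.isLimitingGeodesic _,
    bumpLamination B ψ, hM.isGeodesicLamination, ?_, fun i => ?_, ?_⟩
  · simp only [hr]
    exact hM.sUnion_eq_closure
  · rw [hr]
    exact ⟨hmem i, hM.isUnstable_center i⟩
  · refine (infinite_range_of_injective hM.injective_leafSet_center).mono ?_
    rintro _ ⟨i, rfl⟩
    exact ⟨hmem i, hM.isUnstable_center i⟩
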